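/- All vector spaces are over $\mathbb C$. A *weak quantum vertex algebra* is a vector space $V$ with a vector $\mathbf 1\in V$ (the vacuum) and a linear map $Y(\cdot,x):V\to \mathrm{Hom}(V,V((x)))$, $v\mapsto Y(v,x)=\sum_{n\in\mathbb Z}v_nx^{-n-1}$, such that $Y(\mathbf 1,x)=1$; for every $v\in V$, $Y(v,x)\mathbf 1\in V[[x]]$ with constant term $v$; and for all $u,v\in V$ there are finitely many $v^{(i)},u^{(i)}\in V$, $f_i(x)\in\mathbb C((x))$, $1\le i\le r$, with $$x_0^{-1}\delta\Big(\frac{x_1-x_2}{x_0}\Big)Y(u,x_1)Y(v,x_2)-x_0^{-1}\delta\Big(\frac{x_2-x_1}{-x_0}\Big)\sum_{i=1}^r f_i(-x_0)Y(v^{(i)},x_2)Y(u^{(i)},x_1)=x_2^{-1}\delta\Big(\frac{x_1-x_0}{x_2}\Big)Y(Y(u,x_0)v,x_2).$$ Let $E=K\oplus\mathfrak g$ be a semidirect product Lie algebra (of arbitrary dimension) with $K$ an ideal and $\mathfrak g$ a subalgebra. Let $\langle\cdot,\cdot\rangle$ be a symmetric invariant bilinear form on $K$ with $\langle[a,u],v\rangle=-\langle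 u,[a,v]\rangle$ for $u,v\in K$, $a\in\mathfrak g$, and extend it to $E$ by $\langle u+a,v+b\rangle=\langle u,v\rangle$ for $u,v\in K$, $a,b\in\mathfrak g$. Assume that the extended form is invariant on $E$ (equivalently, $\langle[a,u],v\rangle=0$ for all $a\in\mathfrak g$, $u,v\in K$). Let $\hat E=E\otimes\mathbb C[t,t^{-1}]\oplus\mathbb Cc$ be the affine Lie algebra, with $c$ central and $[x\otimes t^m,y\otimes t^n]=[x,y]\otimes t^{m+n}+m\langle x,y\rangle\delta_{m+n,0}c$, and let $$\mathcal L=K\otimes\mathbb C[t,t^{-1}]\oplus\mathbb Cc\oplus\big(\mathfrak g\otimes t^{-1}\mathbb C[t^{-1}]\big),$$ a Lie subalgebra of $\hat E$. For $\ell\in\mathbb C$ let $\mathbb C_\ell$ be the one-dimensional module of the subalgebra $K[t]\oplus\mathbb Cc$ of $\mathcal L$ on which $K[t]=K\otimes\mathbb C[t]$ acts as zero and $c$ acts as the scalar $\ell$, and put $$V_{\mathcal L}(\ell,0)=U(\mathcal L)\otimes_{U(K[t]\oplus\mathbb Cc)}\mathbb C_\ell,\qquad \mathbf 1=1\otimes1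 .$$ For $x\otimes t^n\in\mathcal L$ write $x(n)$ for the corresponding operator on $V_{\mathcal L}(\ell,0)$, and regard $v\in E$ as the vector $v(-1)\mathbf 1\in V_{\mathcal L}(\ell,0)$. **Proposition.** For every $\ell\in\mathbb C$ there exists a unique weak quantum vertex algebra structure $Y$ on $V_{\mathcal L}(\ell,0)$ with $\mathbf 1$ as the vacuum vector such that for all $u\in K$ and $a\in\mathfrak g$ $$Y(u,x)=u(x)=\sum_{n\in\mathbb Z}u(n)x^{-n-1},\qquad Y(a,x)=a(x)^+=\sum_{n\ge1}a(-n)x^{n-1}.$$ -/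

import Mathlib

open scoped TensorProduct

noncomputable section

namespace SemidirectVertex

/-! ### Weak quantum vertex algebras -/

section WeakQuantumVertexAlgebra

open VertexOperator

variable {V : Type*} [AddCommGroup V] [Module ℂ V]

/-- The coefficient of `x₀^(-n-1) x₁^(-p-1) x₂^(-q-1)` in
`x₀⁻¹ δ((x₁ - x₂)/x₀) Y(u,x₁) Y(v,x₂) w = ∑ₙ x₀^(-n-1) (x₁ - x₂)^n Y(u,x₁) Y(v,x₂) w`,
where `(x₁ - x₂)^n = ∑ᵢ (-1)^i C(n,i) x₁^(n-i) x₂^i` and `Y(u,x) = ∑ₙ uₙ x^(-n-1)`.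
The sum is finite, because `v_m w = 0` for all large `m`. -/
def jacobiLeft (Y : V →ₗ[ℂ] VertexOperator ℂ V) (u v w : V) (n p q : ℤ) : V :=
  ∑ᶠ i : ℕ, ((-1) ^ i * Ring.choose n i : ℤ) •
    ncoeff (Y u) (p + n - i) (ncoeff (Y v) (q + i) w)

/-- The coefficient of `x₀^(-n-1) x₁^(-p-1) x₂^(-q-1)` in
`x₀⁻¹ δ((x₂ - x₁)/(-x₀)) f(-x₀) Y(v,x₂) Y(u,x₁) w
  = ∑ₘ x₀⁻¹ (-x₀)^(-m) (x₂ - x₁)^m f(-x₀) Y(v,x₂) Y(u,x₁) w`,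
where `(x₂ - x₁)^m = ∑ᵢ (-1)^i C(m,i) x₂^(m-i) x₁^i` and `f(x) = ∑ₖ fₖ x^k` is a formal Laurent
series; the terms that contribute have `m = n + k`. The sum is finite, because `u_m w = 0` for all
large `m` bounds `i`, and then, for each of these `i`, `fₖ = 0` for `k` small and
`v_m (u_(p+i) w) = 0` for `m` large bound `k`. -/
def jacobiRight (f : LaurentSeries ℂ) (Y : V →ₗ[ℂ] VertexOperator ℂ V) (v u w : V)
    (n p q : ℤ) : V :=
  ∑ᶠ ik : ℕ × ℤ,
    ((-1 : ℂ) ^ n * f.coeff ik.2 * (((-1) ^ ik.1 * Ring.choose (n + ik.2) ik.1 : ℤ) : ℂ)) •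
      ncoeff (Y v) (q + n + ik.2 - ik.1) (ncoeff (Y u) (p + ik.1) w)

/-- The coefficient of `x₀^(-n-1) x₁^(-p-1) x₂^(-q-1)` in
`x₂⁻¹ δ((x₁ - x₀)/x₂) Y(Y(u,x₀)v,x₂) w = ∑ₘ x₂^(-m-1) (x₁ - x₀)^m Y(Y(u,x₀)v,x₂) w`,
where `(x₁ - x₀)^m = ∑ᵢ (-1)^i C(m,i) x₁^(m-i) x₀^i`; the terms that contribute have
`m = i - p - 1`. The sum is finite, because `u_m v = 0` for all large `m`. -/
def jacobiIterate (Y : V →ₗ[ℂ] VertexOperator ℂ V) (u v w : V) (n p q : ℤ) : V :=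
  ∑ᶠ i : ℕ, ((-1) ^ i * Ring.choose ((i : ℤ) - p - 1) i : ℤ) •
    ncoeff (Y (ncoeff (Y u) (n + i) v)) (p + q - i) w

/-- `(V, Y, vac)` is a weak quantum vertex algebra over `ℂ`. Here
`Y(v,x) = ∑ₙ vₙ x^(-n-1) ∈ Hom(V, V((x)))` and `vₙ = ncoeff (Y v) n`. -/
structure IsWeakQuantumVertexAlgebra (Y : V →ₗ[ℂ] VertexOperator ℂ V) (vac : V) : Prop where
  /-- `Y(vac, x) = 1`. -/
  vacuum : ∀ n : ℤ, ncoeff (Y vac) n = if n = -1 then LinearMap.id else 0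
  /-- `Y(v, x) vac ∈ V[[x]]`. -/
  creation_regular : ∀ (v : V) (n : ℤ), 0 ≤ n → ncoeff (Y v) n vac = 0
  /-- The constant term of `Y(v, x) vac` is `v`. -/
  creation : ∀ v : V, ncoeff (Y v) (-1) vac = v
  /-- For all `u, v` there is `∑ᵢ v⁽ⁱ⁾ ⊗ u⁽ⁱ⁾ ⊗ fᵢ(x) ∈ V ⊗ V ⊗ ℂ((x))` with
  `x₀⁻¹ δ((x₁-x₂)/x₀) Y(u,x₁) Y(v,x₂)
    - x₀⁻¹ δ((x₂-x₁)/(-x₀)) ∑ᵢ fᵢ(-x₀) Y(v⁽ⁱ⁾,x₂) Y(u⁽ⁱ⁾,x₁)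
    = x₂⁻¹ δ((x₁-x₀)/x₂) Y(Y(u,x₀)v,x₂)`. -/
  jacobi : ∀ u v : V, ∃ (r : ℕ) (v' u' : Fin r → V) (f : Fin r → LaurentSeries ℂ),
    ∀ (w : V) (n p q : ℤ),
      jacobiLeft Y u v w n p q - ∑ i, jacobiRight (f i) Y (v' i) (u' i) w n p q =
        jacobiIterate Y u v w n p q

end WeakQuantumVertexAlgebra

/-! ### Induced modules -/

section Induced

attribute [local instance 100] LieRing.ofAssociativeRing

variable {L : Type*} [LieRing L] [LieAlgebra ℂ L] (H : LieSubalgebra ℂ L)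
  {M : Type*} [AddCommGroup M] [Module ℂ M] (ρ : H →ₗ⁅ℂ⁆ Module.End ℂ M)

/-- The induced module `U(L) ⊗_{U(H)} M` of the representation `ρ` of the subalgebra `H` on `M`: the
quotient of the `U(L)`-module `U(L) ⊗_ℂ M` by the submodule generated by all `h ⊗ m - 1 ⊗ ρ(h) m`
(equivalently, spanned by all `x h ⊗ m - x ⊗ ρ(h) m` with `x ∈ U(L)`). -/
abbrev InducedModule : Type _ :=
  (UniversalEnvelopingAlgebra ℂ L ⊗[ℂ] M) ⧸
    Submodule.span (UniversalEnvelopingAlgebra ℂ L)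
      {z | ∃ (h : H) (m : M), z =
        (UniversalEnvelopingAlgebra.ι ℂ (h : L)) ⊗ₜ[ℂ] m -
          (1 : UniversalEnvelopingAlgebra ℂ L) ⊗ₜ[ℂ] (ρ h m)}

/-- The element `1 ⊗ m` of the induced module. -/
def InducedModule.mk (m : M) : InducedModule H ρ :=
  Submodule.Quotient.mk ((1 : UniversalEnvelopingAlgebra ℂ L) ⊗ₜ[ℂ] m)

/-- The operator by which an element of `L` acts on the induced module. -/
def InducedModule.act (y : L) : Module.End ℂ (InducedModule H ρ) :=
  Algebra.lsmul ℂ ℂ (InducedModule H ρ) (UniversalEnvelopingAlgebra.ι ℂ y)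

theorem InducedModule.act_apply (y : L) (z : InducedModule H ρ) :
    InducedModule.act H ρ y z = UniversalEnvelopingAlgebra.ι ℂ y • z :=
  rfl

end Induced

/-! ### The affine Lie algebra and its subalgebras -/

section Affine

variable {E : Type*} [LieRing E] [LieAlgebra ℂ E] {Φ : LinearMap.BilinForm ℂ E}
  (hΦ : Φ.lieInvariant E) (hs : Φ.IsSymm)

theorem lieInvariant_neg (hΦ : Φ.lieInvariant E) : (-Φ).lieInvariant E :=
  fun x y z => by simp [hΦ x y z]

theorem isSymm_neg (hs : Φ.IsSymm) : (-Φ).IsSymm :=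
  ⟨fun x y => by simp [hs.eq x y]⟩

/-- The affine Lie algebra `E ⊗ ℂ[t,t⁻¹] ⊕ ℂ c` of a Lie algebra with a symmetric invariant
bilinear form, with bracket
`[x ⊗ t^m, y ⊗ t^n] = [x,y] ⊗ t^(m+n) + m Φ(x,y) δ_{m+n,0} c` and `c` central (see
`lie_cur_cur`). The form is negated because the library's cocycle for the form `Ψ` takes the
value `n Ψ(x,y) δ_{m+n,0} = -m Ψ(x,y) δ_{m+n,0}` on this pair. -/
abbrev Affine : Type _ :=
  LieAlgebra.ofTwoCocycle (LieAlgebra.LoopAlgebra.twoCocycleOfBilinear ℂ ℤ E (-Φ)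
    (lieInvariant_neg hΦ) (isSymm_neg hs))

/-- The element `x ⊗ t^n` of the affine Lie algebra. -/
def cur (x : E) (n : ℤ) : Affine hΦ hs :=
  LieAlgebra.ofProd _ (AddMonoidAlgebra.single n (1 : ℂ) ⊗ₜ[ℂ] x, 0)

/-- The central element `c` of the affine Lie algebra. -/
def cen : Affine hΦ hs :=
  LieAlgebra.ofProd _ (0, (TrivialLieModule.equiv ℂ _ ℂ).symm 1)

/-- The coefficient of `c`, with respect to `E ⊗ ℂ[t,t⁻¹] ⊕ ℂ c`. -/
def cenCoeff : Affine hΦ hs →ₗ[ℂ] ℂ where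
  toFun x := TrivialLieModule.equiv ℂ _ ℂ ((LieAlgebra.ofProd _).symm x).2
  map_add' _ _ := by simp
  map_smul' _ _ := by simp

theorem lie_cur_cur (x y : E) (m n : ℤ) :
    ⁅cur hΦ hs x m, cur hΦ hs y n⁆ =
      cur hΦ hs ⁅x, y⁆ (m + n) + (if m + n = 0 then (m : ℂ) * Φ x y else 0) • cen hΦ hs := by
  rw [LieAlgebra.bracket_ofTwoCocycle]
  unfold cur cen
  rw [← LieAlgebra.of_smul, ← LieAlgebra.of_add]
  congr 1
  ext1
  · rw [Prod.fst_add, Prod.smul_fst, smul_zero, add_zero]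
    change ⁅AddMonoidAlgebra.single m (1 : ℂ) ⊗ₜ[ℂ] x, AddMonoidAlgebra.single n (1 : ℂ) ⊗ₜ[ℂ] y⁆ =
      AddMonoidAlgebra.single (m + n) (1 : ℂ) ⊗ₜ[ℂ] ⁅x, y⁆
    rw [LieAlgebra.ExtendScalars.bracket_tmul, AddMonoidAlgebra.single_mul_single, one_mul]
  · apply (TrivialLieModule.equiv ℂ (LieAlgebra.loopAlgebra ℂ ℤ E) ℂ).injective
    simp only [Equiv.symm_apply_apply, Prod.snd_add, Prod.smul_snd, trivial_lie_zero, sub_zero,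
      add_zero, zero_add, map_smul, LinearEquiv.apply_symm_apply, smul_eq_mul, mul_one]
    change LieAlgebra.LoopAlgebra.residuePairing ℂ ℤ E (-Φ) (AddMonoidAlgebra.single m 1 ⊗ₜ[ℂ] x)
      (AddMonoidAlgebra.single n 1 ⊗ₜ[ℂ] y) = _
    rw [LieAlgebra.LoopAlgebra.residuePairing_apply_apply,
      LieAlgebra.LoopAlgebra.toFinsupp_single_tmul, LieAlgebra.LoopAlgebra.toFinsupp_single_tmul,
      Finsupp.sum_single_index (by simp)]
    split_ifs with h
    · obtain rfl : m = -n := by lia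
      simp
    · rw [Finsupp.single_eq_of_ne (by lia)]
      simp

theorem lie_cen (z : Affine hΦ hs) : ⁅z, cen hΦ hs⁆ = 0 := by
  rw [LieAlgebra.bracket_ofTwoCocycle, ← LieAlgebra.of_zero]
  unfold cen
  congr 1
  ext1 <;> simp [trivial_lie_zero]

theorem cenCoeff_cur (x : E) (n : ℤ) : cenCoeff hΦ hs (cur hΦ hs x n) = 0 := by
  simp [cenCoeff, cur]

theorem cenCoeff_cen : cenCoeff hΦ hs (cen hΦ hs) = 1 := by
  simp [cenCoeff, cen]

/-- A subspace spanned by a set that is closed under brackets up to the span is a subalgebra. -/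
def spanSubalgebra {L : Type*} [LieRing L] [LieAlgebra ℂ L] (S : Set L)
    (h : ∀ x ∈ S, ∀ y ∈ S, ⁅x, y⁆ ∈ Submodule.span ℂ S) : LieSubalgebra ℂ L where
  toSubmodule := Submodule.span ℂ S
  lie_mem' := by
    intro x y hx hy
    change x ∈ Submodule.span ℂ S at hx
    change y ∈ Submodule.span ℂ S at hy
    change ⁅x, y⁆ ∈ Submodule.span ℂ S
    induction hx using Submodule.span_induction with
    | mem x hx =>
      induction hy using Submodule.span_induction with
      | mem y hy => exact h x hx y hy
      | zero => simp
      | add a b _ _ ha hb => rw [lie_add]; exact add_mem ha hb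
      | smul r a _ ha => rw [lie_smul]; exact Submodule.smul_mem _ _ ha
    | zero => simp
    | add a b _ _ ha hb => rw [add_lie]; exact add_mem ha hb
    | smul r a _ ha => rw [smul_lie]; exact Submodule.smul_mem _ _ ha

variable (K : LieIdeal ℂ E) (g : LieSubalgebra ℂ E)

/-- The elements `u ⊗ t^n` (`u ∈ K`, `n ∈ ℤ`), `c`, and `a ⊗ t^n` (`a ∈ g`, `n < 0`). -/
def curlyLGen : Set (Affine hΦ hs) :=
  {z | ∃ u ∈ K, ∃ n : ℤ, z = cur hΦ hs u n} ∪ {cen hΦ hs} ∪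
    {z | ∃ a ∈ g, ∃ n : ℤ, n < 0 ∧ z = cur hΦ hs a n}

/-- The elements `u ⊗ t^n` (`u ∈ K`, `n ≥ 0`) and `c`. -/
def polyPartGen : Set (Affine hΦ hs) :=
  {z | ∃ u ∈ K, ∃ n : ℤ, 0 ≤ n ∧ z = cur hΦ hs u n} ∪ {cen hΦ hs}

/-- The subalgebra `𝓛 = K ⊗ ℂ[t,t⁻¹] ⊕ ℂ c ⊕ g ⊗ t⁻¹ℂ[t⁻¹]` of the affine Lie algebra. -/
def curlyL : LieSubalgebra ℂ (Affine hΦ hs) :=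
  spanSubalgebra (curlyLGen hΦ hs K g)
    (by
      have hc : ∀ r : ℂ, r • cen hΦ hs ∈ Submodule.span ℂ (curlyLGen hΦ hs K g) := fun r =>
        Submodule.smul_mem _ _ (Submodule.subset_span (Or.inl (Or.inr rfl)))
      have hK : ∀ u ∈ K, ∀ n : ℤ,
          cur hΦ hs u n ∈ Submodule.span ℂ (curlyLGen hΦ hs K g) := fun u hu n =>
        Submodule.subset_span (Or.inl (Or.inl ⟨u, hu, n, rfl⟩))
      rintro x ((⟨u, hu, m, rfl⟩ | rfl) | ⟨a, ha, m, hm, rfl⟩) y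
        ((⟨v, hv, n, rfl⟩ | rfl) | ⟨b, hb, n, hn, rfl⟩)
      · rw [lie_cur_cur]
        exact add_mem (hK _ (lie_mem_right ℂ E K _ _ hv) _) (hc _)
      · rw [lie_cen]; exact zero_mem _
      · rw [lie_cur_cur]
        exact add_mem (hK _ (lie_mem_left ℂ E K _ _ hu) _) (hc _)
      · rw [← lie_skew, lie_cen]; simp
      · rw [lie_cen]; exact zero_mem _
      · rw [← lie_skew, lie_cen]; simp
      · rw [lie_cur_cur]
        exact add_mem (hK _ (lie_mem_right ℂ E K _ _ hv) _) (hc _)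
      · rw [lie_cen]; exact zero_mem _
      · rw [lie_cur_cur]
        exact add_mem (Submodule.subset_span
          (Or.inr ⟨⁅a, b⁆, g.lie_mem ha hb, m + n, by lia, rfl⟩)) (hc _))

theorem cur_mem_curlyL_of_mem_ideal {u : E} (hu : u ∈ K) (n : ℤ) :
    cur hΦ hs u n ∈ curlyL hΦ hs K g :=
  show _ ∈ Submodule.span ℂ _ from Submodule.subset_span (Or.inl (Or.inl ⟨u, hu, n, rfl⟩))

theorem cur_mem_curlyL_of_mem_subalgebra {a : E} (ha : a ∈ g) {n : ℤ} (hn : n < 0) :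
    cur hΦ hs a n ∈ curlyL hΦ hs K g :=
  show _ ∈ Submodule.span ℂ _ from Submodule.subset_span (Or.inr ⟨a, ha, n, hn, rfl⟩)

/-- The subalgebra `K[t] ⊕ ℂ c` of the affine Lie algebra. -/
def polyPart : LieSubalgebra ℂ (Affine hΦ hs) :=
  spanSubalgebra (polyPartGen hΦ hs K)
    (by
      rintro x (⟨u, hu, m, hm, rfl⟩ | rfl) y (⟨v, hv, n, hn, rfl⟩ | rfl)
      · rw [lie_cur_cur]
        exact add_mem (Submodule.subset_span
          (Or.inl ⟨⁅u, v⁆, lie_mem_right ℂ E K _ _ hv, m + n, by lia, rfl⟩))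
          (Submodule.smul_mem _ _ (Submodule.subset_span (Or.inr rfl)))
      · rw [lie_cen]; exact zero_mem _
      · rw [← lie_skew, lie_cen]; simp
      · rw [lie_cen]; exact zero_mem _)

theorem cenCoeff_lie_of_mem_polyPart {x y : Affine hΦ hs} (hx : x ∈ polyPart hΦ hs K)
    (hy : y ∈ polyPart hΦ hs K) : cenCoeff hΦ hs ⁅x, y⁆ = 0 := by
  change x ∈ Submodule.span ℂ _ at hx
  change y ∈ Submodule.span ℂ _ at hy
  induction hx using Submodule.span_induction with
  | mem x hx =>
    induction hy using Submodule.span_induction with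
    | mem y hy =>
      rcases hx with ⟨u, hu, m, hm, rfl⟩ | rfl
      · rcases hy with ⟨v, hv, n, hn, rfl⟩ | rfl
        · rw [lie_cur_cur, map_add, cenCoeff_cur, map_smul, cenCoeff_cen]
          split_ifs with h
          · obtain rfl : m = 0 := by lia
            simp
          · simp
        · rw [lie_cen, map_zero]
      · rw [← lie_skew, lie_cen]; simp
    | zero => simp
    | add a b _ _ ha hb => rw [lie_add, map_add, ha, hb, add_zero]
    | smul r a _ ha => rw [lie_smul, map_smul, ha, smul_zero]
  | zero => simp
  | add a b _ _ ha hb => rw [add_lie, map_add, ha, hb, add_zero]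
  | smul r a _ ha => rw [smul_lie, map_smul, ha, smul_zero]

/-- `K[t] ⊕ ℂ c` as a subalgebra of `𝓛`. -/
def polyPartL : LieSubalgebra ℂ (curlyL hΦ hs K g) :=
  (polyPart hΦ hs K).comap (curlyL hΦ hs K g).incl

attribute [local instance 100] LieRing.ofAssociativeRing

/-- The one-dimensional representation `ℂ_ℓ` of `K[t] ⊕ ℂ c`: `K[t]` acts as zero and `c` acts as
the scalar `ℓ`. -/
def levelRep (ℓ : ℂ) : polyPartL hΦ hs K g →ₗ⁅ℂ⁆ Module.End ℂ ℂ where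
  toFun x := (ℓ * cenCoeff hΦ hs x) • LinearMap.id
  map_add' x y := by simp [mul_add, add_smul]
  map_smul' r x := by simp [smul_smul, mul_left_comm]
  map_lie' {x y} := by
    have h : cenCoeff hΦ hs ((⁅x, y⁆ : polyPartL hΦ hs K g) : curlyL hΦ hs K g) = 0 :=
      cenCoeff_lie_of_mem_polyPart hΦ hs K x.2 y.2
    rw [h]
    ext
    simp [LieRing.of_associative_ring_bracket, mul_comm, mul_left_comm]

/-- The induced `𝓛`-module `V_𝓛(ℓ,0) = U(𝓛) ⊗_{U(K[t] ⊕ ℂ c)} ℂ_ℓ`. -/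
abbrev VacuumModule (ℓ : ℂ) : Type _ :=
  InducedModule (polyPartL hΦ hs K g) (levelRep hΦ hs K g ℓ)

/-- The vector `1 ⊗ 1` of `V_𝓛(ℓ,0)`. -/
def vacuumVector (ℓ : ℂ) : VacuumModule hΦ hs K g ℓ :=
  InducedModule.mk (polyPartL hΦ hs K g) (levelRep hΦ hs K g ℓ) 1

/-- The operator `u(n)` of `u ⊗ t^n ∈ 𝓛` on `V_𝓛(ℓ,0)`, for `u ∈ K` and `n ∈ ℤ`. -/
def opK (ℓ : ℂ) (u : K) (n : ℤ) : Module.End ℂ (VacuumModule hΦ hs K g ℓ) :=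
  InducedModule.act _ _ ⟨cur hΦ hs u n, cur_mem_curlyL_of_mem_ideal hΦ hs K g u.2 n⟩

/-- The operator `a(-n)` of `a ⊗ t^(-n) ∈ 𝓛` on `V_𝓛(ℓ,0)`, for `a ∈ g` and `n ≥ 1`. -/
def opG (ℓ : ℂ) (a : g) (n : ℕ) (hn : 1 ≤ n) : Module.End ℂ (VacuumModule hΦ hs K g ℓ) :=
  InducedModule.act _ _ ⟨cur hΦ hs a (-n),
    cur_mem_curlyL_of_mem_subalgebra hΦ hs K g a.2 (by lia)⟩

end Affine

/-! ### The bilinear form of a semidirect product -/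

section Form

variable {E : Type*} [LieRing E] [LieAlgebra ℂ E] {K : LieIdeal ℂ E} {g : LieSubalgebra ℂ E}

/-- For `E = K ⊕ g`, the bilinear form `⟨u + a, v + b⟩ = ⟨u, v⟩` (`u, v ∈ K`, `a, b ∈ g`) on `E`
that extends the bilinear form `B` on `K`. -/
def extendForm (hKg : IsCompl K.toSubmodule g.toSubmodule) (B : LinearMap.BilinForm ℂ K) :
    LinearMap.BilinForm ℂ E :=
  B.compl₁₂ (K.toSubmodule.projectionOnto g.toSubmodule hKg)
    (K.toSubmodule.projectionOnto g.toSubmodule hKg)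

theorem extendForm_add_add (hKg : IsCompl K.toSubmodule g.toSubmodule)
    (B : LinearMap.BilinForm ℂ K) (u v : K) (a b : g) :
    extendForm hKg B (u + a) (v + b) = B u v := by
  have h : ∀ (w : K) (c : g),
      K.toSubmodule.projectionOnto g.toSubmodule hKg ((w : E) + c) = w := fun w c => by
    rw [map_add, Submodule.projectionOnto_apply_right hKg c, add_zero]
    exact Submodule.projectionOnto_apply_left hKg w
  change B (K.toSubmodule.projectionOnto g.toSubmodule hKg ((u : E) + a))
    (K.toSubmodule.projectionOnto g.toSubmodule hKg ((v : E) + b)) = B u v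
  rw [h, h]

theorem extendForm_isSymm (hKg : IsCompl K.toSubmodule g.toSubmodule)
    {B : LinearMap.BilinForm ℂ K} (hB : B.IsSymm) : (extendForm hKg B).IsSymm :=
  ⟨fun _ _ => hB.eq _ _⟩

end Form

end SemidirectVertex

end

open SemidirectVertex

/-! The strategy is to let 𝓛 act on a space of fields on V = V_𝓛(ℓ,0) and to obtain Y as a
homomorphism of 𝓛-modules. On a field φ, u(n) acts as the n-th product with u(x), and a(-m) acts as
the residue in z of (z - x)^(-m) a(z)⁺ φ(x). The currents of K are mutually local, so the fields
they generate from the identity are local to them (`IsIdealField.isLocal`). After multiplication by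
half currents of g only weak associativity (`IsProduct`) is carried along. It still determines the
products (`IsProduct.eq`), and it survives multiplication by a(z)⁺ up to a correction involving
[a,u](x) (`IsProduct.lmul`). Hence the products satisfy the relations of 𝓛 (`kprod_kprod`,
`kprod_gprod`, `gprod_gprod`); no central term involves g, because g lies in the radical of the
form. The universal property of the induced module then gives v ↦ Y(v,x) (`exists_stateField`).

For the Jacobi identity, the product minus the iterate must be a combination of exchanged products
Y(v',x₂)Y(u',x₁) with powers of x₁ - x₂ as coefficients (`assocDefect_mem`). For vectors generated
by K this is locality (`IsIdealVector.products`). All other vectors arise from these by half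
currents of g (`StateMap.induct`), so it remains to see that the span of exchanged products is
stable under half currents in either variable. The delicate case is an action in x₁ that has to pass
another half current in x₂: the commutator carries (z - x₁)^(-m) (z - x₂)^(-m'), which partial
fractions reduce to actions in one variable times negative powers of x₁ - x₂ (`mixAct_pascal`,
`seqAct_left_prodB_mem`).

Identities between formal expansions are checked on Pascal systems T n p q, which stand for the
coefficients of t₁^p t₂^q (t₁ - t₂)^n: with a suitable truncation, such a system is determined by
the slice n = 0 or p = 0.

Uniqueness holds because every Jacobi identity of this shape implies weak associativity. The
products with the generating fields are then forced, and V is generated from the vacuum. -/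

noncomputable section
namespace SemidirectVertex

/-! ### Pascal systems and the three expansions of powers of t₁ - t₂ -/

section Pascal

variable {M M' : Type*} [AddCommGroup M] [AddCommGroup M']

/-- The coefficient of `x^(n-i) y^i` in `(x - y)^n`. -/
def signedChoose (n : ℤ) (i : ℕ) : ℤ := (-1) ^ i * Ring.choose n i

@[simp] theorem signedChoose_zero_right (n : ℤ) : signedChoose n 0 = 1 := by simp [signedChoose]

@[simp] theorem signedChoose_zero_succ (i : ℕ) : signedChoose 0 (i + 1) = 0 := by
  simp [signedChoose]

theorem signedChoose_succ_succ (n : ℤ) (i : ℕ) :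
    signedChoose (n + 1) (i + 1) = signedChoose n (i + 1) - signedChoose n i := by
  simp only [signedChoose, Ring.choose_succ_succ, pow_succ]; ring

theorem choose_mul_choose_sub (x : ℤ) (i j : ℕ) :
    Ring.choose x i * Ring.choose (x - i) j = (i + j).choose i * Ring.choose x (i + j) := by
  have := Ring.choose_smul_choose x (Nat.le_add_right i j)
  rw [Nat.add_sub_cancel_left, nsmul_eq_mul] at this
  exact this.symm

theorem choose_mul_choose_sub_comm (x : ℤ) (i j : ℕ) :
    Ring.choose x i * Ring.choose (x - i) j = Ring.choose x j * Ring.choose (x - j) i := by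
  rw [choose_mul_choose_sub, choose_mul_choose_sub, Nat.add_comm j i, Nat.choose_symm_add]

/-- Upper negation of binomial coefficients. It turns the coefficient in `jacobiIterate` into the
C(p,i) of `expandMid`. -/
theorem signedChoose_sub_one (n : ℤ) (i : ℕ) :
    (-1) ^ i * Ring.choose ((i : ℤ) - n - 1) i = Ring.choose n i := by
  have h : (i : ℤ) - n - 1 = -n + i - 1 := by ring
  have h2 := Ring.choose_neg (-n) i
  rw [neg_neg, ← h] at h2
  rw [h2, Int.negOnePow_def, zpow_natCast, Units.smul_def]
  simp

/-- The systems of coefficients `⟨f, t₁^p t₂^q (t₁ - t₂)^n⟩` of a functional `f`. -/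
def IsPascal (T : ℤ → ℤ → ℤ → M) : Prop :=
  ∀ n p q, T (n + 1) p q = T n (p + 1) q - T n p (q + 1)

namespace IsPascal

variable {T S : ℤ → ℤ → ℤ → M}

theorem sub (hT : IsPascal T) (hS : IsPascal S) : IsPascal fun n p q => T n p q - S n p q := by
  intro n p q; simp only [hT n p q, hS n p q]; abel

theorem map (hT : IsPascal T) {F : Type*} [FunLike F M M'] [AddMonoidHomClass F M M'] (f : F) :
    IsPascal fun n p q => f (T n p q) := by
  intro n p q; simp only [hT n p q, map_sub]

theorem sum {ι : Type*} (s : Finset ι) {U : ι → ℤ → ℤ → ℤ → M} (h : ∀ i ∈ s, IsPascal (U i)) :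
    IsPascal fun n p q => ∑ i ∈ s, U i n p q := by
  intro n p q
  simp only
  rw [← Finset.sum_sub_distrib]
  exact Finset.sum_congr rfl fun i hi => h i hi n p q

theorem shift (hT : IsPascal T) (a b c : ℤ) :
    IsPascal fun n p q => T (n + a) (p + b) (q + c) := by
  intro n p q
  simp only
  rw [show n + 1 + a = n + a + 1 by ring, show p + 1 + b = p + b + 1 by ring,
    show q + 1 + c = q + c + 1 by ring, hT]

/-- The form of the relation with `t₁` and `t₂` exchanged. -/
theorem swap [Module ℂ M] (hT : IsPascal T) :
    IsPascal fun n p q => ((-1 : ℂ) ^ n) • T n q p := by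
  intro n p q
  simp only [hT n q p, zpow_add_one₀ (by norm_num : (-1 : ℂ) ≠ 0), ← smul_sub]
  rw [mul_neg_one, neg_smul, ← smul_neg, neg_sub]

theorem eq_zero_of_nonneg (hT : IsPascal T) (h0 : ∀ p q, T 0 p q = 0) (n : ℕ) (p q : ℤ) :
    T n p q = 0 := by
  induction n generalizing p q with
  | zero => exact h0 p q
  | succ n ih => push_cast; rw [hT, ih, ih, sub_zero]

/-- Multiplication by t₁ - t₂ is injective on systems truncated in t₂: if the slice n + 1 vanishes,
the slice n is unchanged under (p, q) ↦ (p - 1, q + 1), and iterating this moves q into the range of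
vanishing. The bound must therefore be uniform in p. -/
theorem eq_zero_of_right (hT : IsPascal T) (h0 : ∀ p q, T 0 p q = 0)
    (hb : ∃ N : ℤ, ∀ n p q, N ≤ q → T n p q = 0) (n p q : ℤ) : T n p q = 0 := by
  obtain ⟨N, hN⟩ := hb
  have neg : ∀ (k : ℕ) (p q : ℤ), T (-k) p q = 0 := by
    intro k
    induction k with
    | zero => simpa using h0
    | succ k ih =>
      intro p q
      have step : ∀ p q, T (-((k + 1 : ℕ) : ℤ)) p q = T (-((k + 1 : ℕ) : ℤ)) (p - 1) (q + 1) := by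
        intro p q
        have := hT (-((k + 1 : ℕ) : ℤ)) (p - 1) q
        rw [show -((k + 1 : ℕ) : ℤ) + 1 = -k by push_cast; ring, ih, sub_add_cancel] at this
        exact sub_eq_zero.mp this.symm
      have many : ∀ s : ℕ, T (-((k + 1 : ℕ) : ℤ)) p q =
          T (-((k + 1 : ℕ) : ℤ)) (p - s) (q + s) := by
        intro s
        induction s with
        | zero => simp
        | succ s ihs => rw [ihs, step]; congr 1 <;> (push_cast; ring)
      rw [many (N - q).toNat]
      exact hN _ _ _ (by have := Int.self_le_toNat (N - q); lia)
  rcases Int.eq_nat_or_neg n with ⟨k, rfl | rfl⟩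
  · exact hT.eq_zero_of_nonneg h0 k p q
  · exact neg k p q

theorem eq_zero_of_left (hT : IsPascal T) (h0 : ∀ p q, T 0 p q = 0)
    (hb : ∃ N : ℤ, ∀ n p q, N ≤ p → T n p q = 0) (n p q : ℤ) : T n p q = 0 := by
  obtain ⟨N, hN⟩ := hb
  have neg : ∀ (k : ℕ) (p q : ℤ), T (-k) p q = 0 := by
    intro k
    induction k with
    | zero => simpa using h0
    | succ k ih =>
      intro p q
      have step : ∀ p q, T (-((k + 1 : ℕ) : ℤ)) p q = T (-((k + 1 : ℕ) : ℤ)) (p + 1) (q - 1) := by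
        intro p q
        have := hT (-((k + 1 : ℕ) : ℤ)) p (q - 1)
        rw [show -((k + 1 : ℕ) : ℤ) + 1 = -k by push_cast; ring, ih, sub_add_cancel] at this
        exact (sub_eq_zero.mp this.symm).symm
      have many : ∀ s : ℕ, T (-((k + 1 : ℕ) : ℤ)) p q =
          T (-((k + 1 : ℕ) : ℤ)) (p + s) (q - s) := by
        intro s
        induction s with
        | zero => simp
        | succ s ihs => rw [ihs, step]; congr 1 <;> (push_cast; ring)
      rw [many (N - p).toNat]
      exact hN _ _ _ (by have := Int.self_le_toNat (N - p); lia)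
  rcases Int.eq_nat_or_neg n with ⟨k, rfl | rfl⟩
  · exact hT.eq_zero_of_nonneg h0 k p q
  · exact neg k p q

/-- Here t₁ plays the part that t₁ - t₂ plays in `eq_zero_of_right`. For negative p, once the slice
p + 1 vanishes, raising n while lowering q only changes the sign, and n eventually passes the bound.
-/
theorem eq_zero_of_middle (hT : IsPascal T) (h0 : ∀ n q, T n 0 q = 0)
    (hb : ∃ N : ℤ, ∀ n p q, N ≤ n → T n p q = 0) (n p q : ℤ) : T n p q = 0 := by
  obtain ⟨N, hN⟩ := hb
  rcases Int.eq_nat_or_neg p with ⟨k, rfl | rfl⟩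
  · induction k generalizing n q with
    | zero => exact h0 n q
    | succ k ih =>
      have := hT n k q
      rw [ih, ih, sub_zero] at this
      push_cast; exact this.symm
  · induction k generalizing n q with
    | zero => simpa using h0 n q
    | succ k ih =>
      have step : ∀ n q, T n (-((k + 1 : ℕ) : ℤ)) q =
          - T (n + 1) (-((k + 1 : ℕ) : ℤ)) (q - 1) := by
        intro n q
        have := hT n (-((k + 1 : ℕ) : ℤ)) (q - 1)
        rw [show -((k + 1 : ℕ) : ℤ) + 1 = -k by push_cast; ring, ih, sub_add_cancel,
          zero_sub] at this
        rw [this, neg_neg]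
      have many : ∀ (s : ℕ) (n q : ℤ), N ≤ n + s → T n (-((k + 1 : ℕ) : ℤ)) q = 0 := by
        intro s
        induction s with
        | zero => intro n q h; exact hN _ _ _ (by simpa using h)
        | succ s ihs =>
          intro n q h
          rw [step, ihs _ _ (by push_cast at h; lia), neg_zero]
      exact many (N - n).toNat n q (by have := Int.self_le_toNat (N - n); lia)

theorem eq_of_right (hT : IsPascal T) (hS : IsPascal S) (h0 : ∀ p q, T 0 p q = S 0 p q)
    (hbT : ∃ N : ℤ, ∀ n p q, N ≤ q → T n p q = 0)
    (hbS : ∃ N : ℤ, ∀ n p q, N ≤ q → S n p q = 0) (n p q : ℤ) : T n p q = S n p q := by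
  obtain ⟨N, hN⟩ := hbT
  obtain ⟨N', hN'⟩ := hbS
  refine sub_eq_zero.mp ((hT.sub hS).eq_zero_of_right (fun p q => by simp [h0])
    ⟨max N N', fun n p q h => ?_⟩ n p q)
  rw [hN _ _ _ (by lia), hN' _ _ _ (by lia), sub_zero]

theorem eq_of_left (hT : IsPascal T) (hS : IsPascal S) (h0 : ∀ p q, T 0 p q = S 0 p q)
    (hbT : ∃ N : ℤ, ∀ n p q, N ≤ p → T n p q = 0)
    (hbS : ∃ N : ℤ, ∀ n p q, N ≤ p → S n p q = 0) (n p q : ℤ) : T n p q = S n p q := by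
  obtain ⟨N, hN⟩ := hbT
  obtain ⟨N', hN'⟩ := hbS
  refine sub_eq_zero.mp ((hT.sub hS).eq_zero_of_left (fun p q => by simp [h0])
    ⟨max N N', fun n p q h => ?_⟩ n p q)
  rw [hN _ _ _ (by lia), hN' _ _ _ (by lia), sub_zero]

theorem eq_of_middle (hT : IsPascal T) (hS : IsPascal S) (h0 : ∀ n q, T n 0 q = S n 0 q)
    (hbT : ∃ N : ℤ, ∀ n p q, N ≤ n → T n p q = 0)
    (hbS : ∃ N : ℤ, ∀ n p q, N ≤ n → S n p q = 0) (n p q : ℤ) : T n p q = S n p q := by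
  obtain ⟨N, hN⟩ := hbT
  obtain ⟨N', hN'⟩ := hbS
  refine sub_eq_zero.mp ((hT.sub hS).eq_zero_of_middle (fun p q => by simp [h0])
    ⟨max N N', fun n p q h => ?_⟩ n p q)
  rw [hN _ _ _ (by lia), hN' _ _ _ (by lia), sub_zero]

end IsPascal

/-- `∑ᵢ (-1)^i C(n,i) G(p+n-i, q+i)`, the expansion of `(t₁ - t₂)^n` for `|t₁| > |t₂|`
applied to the double sequence `G`. -/
def expand (G : ℤ → ℤ → M) (n p q : ℤ) : M :=
  ∑ᶠ i : ℕ, signedChoose n i • G (p + n - i) (q + i)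

/-- `∑ᵢ C(p,i) G(n+i, p+q-i)`, the expansion of `t₁^p = (t₂ + (t₁ - t₂))^p` for
`|t₁ - t₂| < |t₂|`. -/
def expandMid (G : ℤ → ℤ → M) (n p q : ℤ) : M :=
  ∑ᶠ i : ℕ, Ring.choose p i • G (n + i) (p + q - i)

/-- Vanishing for large second index, uniformly in the first. -/
def BddRight (G : ℤ → ℤ → M) : Prop := ∃ N : ℤ, ∀ p q, N ≤ q → G p q = 0

/-- Vanishing for large first index, uniformly in the second. -/
def BddLeft (G : ℤ → ℤ → M) : Prop := ∃ N : ℤ, ∀ p q, N ≤ p → G p q = 0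

theorem expand_eq_sum {G : ℤ → ℤ → M} {n p q : ℤ} (k : ℕ)
    (h : ∀ i : ℕ, k ≤ i → G (p + n - i) (q + i) = 0) :
    expand G n p q = ∑ i ∈ Finset.range k, signedChoose n i • G (p + n - i) (q + i) := by
  apply finsum_eq_sum_of_support_subset
  intro i hi
  simp only [Finset.coe_range, Set.mem_Iio]
  by_contra hk
  exact hi (by simp only; rw [h i (by lia), smul_zero])

theorem BddRight.exists_nat {G : ℤ → ℤ → M} (h : BddRight G) (q : ℤ) :
    ∃ k : ℕ, ∀ l : ℕ, k ≤ l → ∀ p, G p (q + l) = 0 := by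
  obtain ⟨N, hN⟩ := h
  exact ⟨(N - q).toNat, fun l hl p => hN _ _ (by lia)⟩

theorem BddLeft.exists_nat {G : ℤ → ℤ → M} (h : BddLeft G) (p : ℤ) :
    ∃ k : ℕ, ∀ l : ℕ, k ≤ l → ∀ q, G (p + l) q = 0 := by
  obtain ⟨N, hN⟩ := h
  exact ⟨(N - p).toNat, fun l hl q => hN _ _ (by lia)⟩

theorem expand_zero (G : ℤ → ℤ → M) (p q : ℤ) : expand G 0 p q = G p q := by
  unfold expand
  rw [finsum_eq_single _ 0]
  · simp
  · intro i hi
    obtain ⟨j, rfl⟩ := Nat.exists_eq_succ_of_ne_zero hi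
    simp

theorem expand_bdd {G : ℤ → ℤ → M} {N : ℤ} (h : ∀ p q, N ≤ q → G p q = 0) {n p q : ℤ}
    (hq : N ≤ q) : expand G n p q = 0 := by
  rw [expand_eq_sum 0 (fun i _ => h _ _ (by lia))]; simp

theorem isPascal_expand {G : ℤ → ℤ → M} (h : BddRight G) : IsPascal (expand G) := by
  intro n p q
  obtain ⟨k, hk⟩ := h.exists_nat q
  -- The expansion that starts at q + 1 gets one term fewer: its i-th term has the same argument as
  -- the (i+1)-st terms of the other two.
  rw [expand_eq_sum (k + 1) (fun i hi => hk i (by lia) _),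
    expand_eq_sum (k + 1) (fun i hi => hk i (by lia) _),
    expand_eq_sum k (fun i hi => by
      have := hk (i + 1) (by lia) (p + n - i)
      rw [← this]; congr 1; push_cast; ring),
    Finset.sum_range_succ', Finset.sum_range_succ']
  simp only [signedChoose_zero_right, signedChoose_succ_succ, sub_smul, Finset.sum_sub_distrib]
  have e1 : ∀ i : ℕ, G (p + (n + 1) - ((i + 1 : ℕ) : ℤ)) (q + ((i + 1 : ℕ) : ℤ)) =
      G (p + n - i) (q + 1 + i) := fun i => by congr 1 <;> (push_cast; ring)
  have e2 : ∀ i : ℕ, G (p + 1 + n - ((i + 1 : ℕ) : ℤ)) (q + ((i + 1 : ℕ) : ℤ)) =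
      G (p + n - i) (q + 1 + i) := fun i => by congr 1 <;> (push_cast; ring)
  simp only [e1, e2]
  rw [show p + (n + 1) = p + 1 + n by ring]
  abel

theorem map_expand {G : ℤ → ℤ → M} (h : BddRight G) {F : Type*} [FunLike F M M']
    [AddMonoidHomClass F M M'] (f : F) (n p q : ℤ) :
    f (expand G n p q) = expand (fun p q => f (G p q)) n p q := by
  obtain ⟨k, hk⟩ := h.exists_nat q
  rw [expand_eq_sum k (fun i hi => hk i hi _),
    expand_eq_sum k (fun i hi => by rw [hk i hi, map_zero]), map_sum]
  simp only [map_zsmul]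

theorem expand_add {G H : ℤ → ℤ → M} (hG : BddRight G) (hH : BddRight H) (n p q : ℤ) :
    expand (fun p q => G p q + H p q) n p q = expand G n p q + expand H n p q := by
  obtain ⟨k, hk⟩ := hG.exists_nat q
  obtain ⟨l, hl⟩ := hH.exists_nat q
  rw [expand_eq_sum (max k l) (fun i hi => hk i (by lia) _),
    expand_eq_sum (max k l) (fun i hi => hl i (by lia) _),
    expand_eq_sum (max k l) (fun i hi => by rw [hk i (by lia), hl i (by lia), add_zero]),
    ← Finset.sum_add_distrib]
  simp only [smul_add]

theorem expand_shift (G : ℤ → ℤ → M) (a b n p q : ℤ) :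
    expand (fun p q => G (p + a) (q + b)) n p q = expand G n (p + a) (q + b) := by
  unfold expand
  refine finsum_congr fun i => ?_
  beta_reduce
  rw [show p + n - (i : ℤ) + a = p + a + n - i by ring, show q + (i : ℤ) + b = q + b + i by ring]

theorem expand_eq_zero_of_left {G : ℤ → ℤ → M} (hR : BddRight G)
    (hL : ∀ q, ∃ N : ℤ, ∀ p, N ≤ p → G p q = 0) (n q : ℤ) :
    ∃ N : ℤ, ∀ p, N ≤ p → expand G n p q = 0 := by
  obtain ⟨k, hk⟩ := hR.exists_nat q
  choose N hN using hL
  -- Only finitely many second indices q + i occur. The sum of absolute values is a common upper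
  -- bound for their truncation bounds, and k - n absorbs the index shift n - i.
  refine ⟨∑ i ∈ Finset.range k, |N (q + i)| + k - n, fun p hp => ?_⟩
  rw [expand_eq_sum k (fun i hi => hk i hi _)]
  refine Finset.sum_eq_zero fun i hi => ?_
  rw [hN, smul_zero]
  have h1 : |N (q + i)| ≤ ∑ i ∈ Finset.range k, |N (q + i)| :=
    Finset.single_le_sum (f := fun i : ℕ => |N (q + i)|) (fun _ _ => abs_nonneg _) hi
  have h2 := le_abs_self (N (q + i))
  have h3 := Finset.mem_range.mp hi
  lia

theorem expandMid_eq_sum {G : ℤ → ℤ → M} {n p q : ℤ} (k : ℕ)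
    (h : ∀ i : ℕ, k ≤ i → G (n + i) (p + q - i) = 0) :
    expandMid G n p q = ∑ i ∈ Finset.range k, Ring.choose p i • G (n + i) (p + q - i) := by
  apply finsum_eq_sum_of_support_subset
  intro i hi
  simp only [Finset.coe_range, Set.mem_Iio]
  by_contra hk
  exact hi (by simp only; rw [h i (by lia), smul_zero])

theorem expandMid_zero (G : ℤ → ℤ → M) (n q : ℤ) : expandMid G n 0 q = G n q := by
  unfold expandMid
  rw [finsum_eq_single _ 0]
  · simp
  · intro i hi
    obtain ⟨j, rfl⟩ := Nat.exists_eq_succ_of_ne_zero hi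
    simp

theorem expandMid_bdd {G : ℤ → ℤ → M} {N : ℤ} (h : ∀ p q, N ≤ p → G p q = 0) {n p q : ℤ}
    (hn : N ≤ n) : expandMid G n p q = 0 := by
  rw [expandMid_eq_sum 0 (fun i _ => h _ _ (by lia))]; simp

theorem isPascal_expandMid {G : ℤ → ℤ → M} (h : BddLeft G) : IsPascal (expandMid G) := by
  intro n p q
  obtain ⟨k, hk⟩ := h.exists_nat n
  rw [expandMid_eq_sum (k + 1) (fun i hi => hk i (by lia) _),
    expandMid_eq_sum (p := p) (k + 1) (fun i hi => hk i (by lia) _),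
    expandMid_eq_sum k (fun i hi => by
      have := hk (i + 1) (by lia) (p + q - i)
      rw [← this]; congr 1; push_cast; ring),
    Finset.sum_range_succ', Finset.sum_range_succ']
  simp only [Ring.choose_zero_right, Ring.choose_succ_succ, add_smul, Finset.sum_add_distrib]
  have e1 : ∀ i : ℕ, G (n + ((i + 1 : ℕ) : ℤ)) (p + 1 + q - ((i + 1 : ℕ) : ℤ)) =
      G (n + 1 + i) (p + q - i) := fun i => by congr 1 <;> (push_cast; ring)
  have e2 : ∀ i : ℕ, G (n + ((i + 1 : ℕ) : ℤ)) (p + (q + 1) - ((i + 1 : ℕ) : ℤ)) =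
      G (n + 1 + i) (p + q - i) := fun i => by congr 1 <;> (push_cast; ring)
  simp only [e1, e2]
  rw [show p + 1 + q = p + (q + 1) by ring]
  abel

theorem map_expandMid {G : ℤ → ℤ → M} (h : BddLeft G) {F : Type*} [FunLike F M M']
    [AddMonoidHomClass F M M'] (f : F) (n p q : ℤ) :
    f (expandMid G n p q) = expandMid (fun p q => f (G p q)) n p q := by
  obtain ⟨k, hk⟩ := h.exists_nat n
  rw [expandMid_eq_sum k (fun i hi => hk i hi _),
    expandMid_eq_sum k (fun i hi => by rw [hk i hi, map_zero]), map_sum]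
  simp only [map_zsmul]

theorem expandMid_add {G H : ℤ → ℤ → M} (hG : BddLeft G) (hH : BddLeft H) (n p q : ℤ) :
    expandMid (fun p q => G p q + H p q) n p q = expandMid G n p q + expandMid H n p q := by
  obtain ⟨k, hk⟩ := hG.exists_nat n
  obtain ⟨l, hl⟩ := hH.exists_nat n
  rw [expandMid_eq_sum (max k l) (fun i hi => hk i (by lia) _),
    expandMid_eq_sum (max k l) (fun i hi => hl i (by lia) _),
    expandMid_eq_sum (max k l) (fun i hi => by rw [hk i (by lia), hl i (by lia), add_zero]),
    ← Finset.sum_add_distrib]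
  simp only [smul_add]

theorem expandMid_shift (G : ℤ → ℤ → M) (a n p q : ℤ) :
    expandMid (fun n q => G (n + a) q) n p q = expandMid G (n + a) p q := by
  unfold expandMid
  refine finsum_congr fun i => ?_
  beta_reduce
  rw [show n + (i : ℤ) + a = n + a + i by ring]

/-- For fixed `n`, `p` only finitely many terms of the expansion occur. -/
theorem expandMid_eq_zero_of_right {G : ℤ → ℤ → M} (hL : BddLeft G)
    (hR : ∀ n, ∃ N : ℤ, ∀ q, N ≤ q → G n q = 0) (n : ℤ) :
    ∃ N : ℤ, ∀ p q, N ≤ p + q → expandMid G n p q = 0 := by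
  obtain ⟨k, hk⟩ := hL.exists_nat n
  choose N hN using hR
  refine ⟨∑ i ∈ Finset.range k, |N (n + i)| + k, fun p q hp => ?_⟩
  rw [expandMid_eq_sum k (fun i hi => hk i hi _)]
  refine Finset.sum_eq_zero fun i hi => ?_
  rw [hN, smul_zero]
  have h1 : |N (n + i)| ≤ ∑ i ∈ Finset.range k, |N (n + i)| :=
    Finset.single_le_sum (f := fun i : ℕ => |N (n + i)|) (fun _ _ => abs_nonneg _) hi
  have h2 := le_abs_self (N (n + i))
  have h3 := Finset.mem_range.mp hi
  lia

end Pascal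
end SemidirectVertex
end

noncomputable section
namespace SemidirectVertex

/-! ### Fields, their ordered products and residue products -/

section Fields

variable (V : Type*) [AddCommGroup V] [Module ℂ V]

/-- The subspace of the sequences of operators that eventually annihilate each vector. -/
def fieldSubmodule : Submodule ℂ (ℤ → Module.End ℂ V) where
  carrier := {α | ∀ w, ∃ N : ℤ, ∀ n, N ≤ n → α n w = 0}
  add_mem' {α β} hα hβ w := by
    obtain ⟨N, hN⟩ := hα w
    obtain ⟨M, hM⟩ := hβ w
    exact ⟨max N M, fun n hn => by simp [hN n (by lia), hM n (by lia)]⟩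
  zero_mem' w := ⟨0, fun n _ => by simp⟩
  smul_mem' c α hα w := by
    obtain ⟨N, hN⟩ := hα w
    exact ⟨N, fun n hn => by simp [hN n hn]⟩

/-- The type `Hom(V, V((x)))` of fields on `V`, given by their modes. -/
structure Fld where
  /-- The modes of the field. -/
  mode : ℤ → Module.End ℂ V
  /-- The modes annihilate each vector eventually. -/
  trunc : ∀ w, ∃ N : ℤ, ∀ n, N ≤ n → mode n w = 0

variable {V}

namespace Fld

/-- Fields as a subspace of the sequences of operators. -/
def equivSubmodule : Fld V ≃ fieldSubmodule V where
  toFun α := ⟨α.1, α.2⟩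
  invFun α := ⟨α.1, α.2⟩

instance : AddCommGroup (Fld V) := equivSubmodule.addCommGroup

instance : Module ℂ (Fld V) := equivSubmodule.module ℂ

@[ext] theorem ext' {α β : Fld V} (h : ∀ n w, α.1 n w = β.1 n w) : α = β :=
  equivSubmodule.injective (Subtype.ext (funext fun n => LinearMap.ext fun w => h n w))

@[simp] theorem add_apply (α β : Fld V) (n : ℤ) (w : V) :
    (α + β).1 n w = α.1 n w + β.1 n w := rfl
@[simp] theorem sub_apply (α β : Fld V) (n : ℤ) (w : V) :
    (α - β).1 n w = α.1 n w - β.1 n w := rfl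
@[simp] theorem smul_apply (c : ℂ) (α : Fld V) (n : ℤ) (w : V) :
    (c • α).1 n w = c • α.1 n w := rfl
@[simp] theorem zsmul_apply (c : ℤ) (α : Fld V) (n : ℤ) (w : V) :
    (c • α).1 n w = c • α.1 n w := rfl
@[simp] theorem zero_apply (n : ℤ) (w : V) : (0 : Fld V).1 n w = 0 := rfl
/-- A mode, applied to a vector, as a linear function of the field. -/
def evalAt (n : ℤ) (w : V) : Fld V →ₗ[ℂ] V where
  toFun α := α.1 n w
  map_add' _ _ := rfl
  map_smul' _ _ := rfl

@[simp] theorem sum_apply {ι : Type*} (s : Finset ι) (f : ι → Fld V) (n : ℤ) (w : V) :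
    (∑ i ∈ s, f i).1 n w = ∑ i ∈ s, (f i).1 n w :=
  map_sum (evalAt n w) f s

/-- The identity field. -/
def one : Fld V :=
  ⟨fun n => if n = -1 then LinearMap.id else 0, fun w => ⟨0, fun n hn => by
    rw [if_neg (by lia)]; rfl⟩⟩

theorem one_apply (n : ℤ) (w : V) : (one : Fld V).1 n w = if n = -1 then w else 0 := by
  simp only [one]; split_ifs <;> rfl

/-- Multiplication by `x^j`. -/
def shift (j : ℤ) : Fld V →ₗ[ℂ] Fld V where
  toFun α := ⟨fun n => α.1 (n + j), fun w => by
    obtain ⟨N, hN⟩ := α.2 w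
    exact ⟨N - j, fun n hn => hN _ (by lia)⟩⟩
  map_add' _ _ := rfl
  map_smul' _ _ := rfl

@[simp] theorem shift_apply (j : ℤ) (α : Fld V) (n : ℤ) (w : V) :
    (shift j α).1 n w = α.1 (n + j) w := rfl

/-- Composition with an operator on the left. -/
def lcomp (f : Module.End ℂ V) : Fld V →ₗ[ℂ] Fld V where
  toFun α := ⟨fun n => f ∘ₗ α.1 n, fun w => by
    obtain ⟨N, hN⟩ := α.2 w
    exact ⟨N, fun n hn => by simp [hN n hn]⟩⟩
  map_add' α β := ext' fun n w => map_add f (α.1 n w) (β.1 n w)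
  map_smul' c α := ext' fun n w => map_smul f c (α.1 n w)

@[simp] theorem lcomp_apply (f : Module.End ℂ V) (α : Fld V) (n : ℤ) (w : V) :
    (lcomp f α).1 n w = f (α.1 n w) := rfl

/-- Composition with an operator on the right. -/
def rcomp (f : Module.End ℂ V) : Fld V →ₗ[ℂ] Fld V where
  toFun α := ⟨fun n => α.1 n ∘ₗ f, fun w => α.2 (f w)⟩
  map_add' _ _ := rfl
  map_smul' _ _ := rfl

@[simp] theorem rcomp_apply (f : Module.End ℂ V) (α : Fld V) (n : ℤ) (w : V) :
    (rcomp f α).1 n w = α.1 n (f w) := rfl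

theorem bddRight_comp (α β : Fld V) (w : V) : BddRight fun p q => α.1 p (β.1 q w) := by
  obtain ⟨N, hN⟩ := β.2 w
  exact ⟨N, fun p q hq => by beta_reduce; rw [hN q hq, map_zero]⟩

/-- The coefficients of `(x₁ - x₂)^n α(x₁) β(x₂) w`, expanded for `|x₁| > |x₂|`. -/
def prodA (α β : Fld V) (w : V) : ℤ → ℤ → ℤ → V :=
  expand fun p q => α.1 p (β.1 q w)

/-- The coefficients of `(x₁ - x₂)^n β(x₂) α(x₁) w`, expanded for `|x₂| > |x₁|`. -/
def prodB (β α : Fld V) (w : V) (n p q : ℤ) : V :=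
  ((-1 : ℂ) ^ n) • prodA β α w n q p

variable (α β φ : Fld V) (w : V)

theorem isPascal_prodA : IsPascal (prodA α β w) := isPascal_expand (bddRight_comp α β w)

theorem isPascal_prodB : IsPascal (prodB β α w) := (isPascal_prodA β α w).swap

@[simp] theorem prodA_zero (p q : ℤ) : prodA α β w 0 p q = α.1 p (β.1 q w) := expand_zero _ _ _

@[simp] theorem prodB_zero (p q : ℤ) : prodB β α w 0 p q = β.1 q (α.1 p w) := by simp [prodB]

theorem prodA_bdd : ∃ N : ℤ, ∀ n p q, N ≤ q → prodA α β w n p q = 0 := by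
  obtain ⟨N, hN⟩ := bddRight_comp α β w
  exact ⟨N, fun n p q hq => expand_bdd hN hq⟩

theorem prodB_bdd : ∃ N : ℤ, ∀ n p q, N ≤ p → prodB β α w n p q = 0 := by
  obtain ⟨N, hN⟩ := prodA_bdd β α w
  exact ⟨N, fun n p q hq => by rw [prodB, hN _ _ _ hq, smul_zero]⟩

theorem prodA_eq_zero_of_left (n q : ℤ) : ∃ N : ℤ, ∀ p, N ≤ p → prodA α β w n p q = 0 :=
  expand_eq_zero_of_left (bddRight_comp α β w) (fun q => α.2 (β.1 q w)) n q

theorem prodB_eq_zero_of_right (n p : ℤ) : ∃ N : ℤ, ∀ q, N ≤ q → prodB β α w n p q = 0 := by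
  obtain ⟨N, hN⟩ := prodA_eq_zero_of_left β α w n p
  exact ⟨N, fun q hq => by rw [prodB, hN _ hq, smul_zero]⟩

theorem prodA_add (w' : V) (n p q : ℤ) :
    prodA α β (w + w') n p q = prodA α β w n p q + prodA α β w' n p q := by
  unfold prodA
  rw [← expand_add (bddRight_comp α β w) (bddRight_comp α β w')]
  simp only [map_add]

theorem map_prodA (f : Module.End ℂ V) (n p q : ℤ) :
    f (prodA α β w n p q) = prodA (lcomp f α) β w n p q :=
  map_expand (bddRight_comp α β w) f n p q

theorem prodA_smul (c : ℂ) (n p q : ℤ) : prodA α β (c • w) n p q = c • prodA α β w n p q := by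
  have := map_expand (bddRight_comp α β w) (LinearMap.lsmul ℂ V c) n p q
  simp only [LinearMap.lsmul_apply] at this
  unfold prodA
  rw [this]
  simp only [map_smul]

theorem prodA_add_left (α' : Fld V) (n p q : ℤ) :
    prodA (α + α') β w n p q = prodA α β w n p q + prodA α' β w n p q := by
  unfold prodA
  rw [← expand_add (bddRight_comp α β w) (bddRight_comp α' β w)]
  simp only [add_apply]

theorem prodA_add_right (β' : Fld V) (n p q : ℤ) :
    prodA α (β + β') w n p q = prodA α β w n p q + prodA α β' w n p q := by
  unfold prodA
  rw [← expand_add (bddRight_comp α β w) (bddRight_comp α β' w)]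
  simp only [add_apply, map_add]

theorem prodA_smul_left (c : ℂ) (n p q : ℤ) :
    prodA (c • α) β w n p q = c • prodA α β w n p q := by
  have := map_prodA α β w (c • LinearMap.id) n p q
  rw [LinearMap.smul_apply, LinearMap.id_apply] at this
  rw [this]
  rfl

theorem prodA_smul_right (c : ℂ) (n p q : ℤ) :
    prodA α (c • β) w n p q = c • prodA α β w n p q := by
  rw [← prodA_smul]
  unfold prodA
  simp only [smul_apply, map_smul]

/-- The residue of `x₁^p (x₁ - x)^n α(x₁) β(x)`, expanded for `|x₁| > |x|`. -/
def lmul (n p : ℤ) : Fld V →ₗ[ℂ] Fld V →ₗ[ℂ] Fld V :=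
  LinearMap.mk₂ ℂ
    (fun α β => ⟨fun q =>
      { toFun := fun w => prodA α β w n p q
        map_add' := fun w w' => prodA_add α β w w' n p q
        map_smul' := fun c w => prodA_smul α β w c n p q },
      fun w => (prodA_bdd α β w).imp fun _ hN q hq => hN n p q hq⟩)
    (fun _ _ _ => ext' fun q w => prodA_add_left _ _ w _ n p q)
    (fun _ _ _ => ext' fun q w => prodA_smul_left _ _ w _ n p q)
    (fun _ _ _ => ext' fun q w => prodA_add_right _ _ w _ n p q)
    (fun _ _ _ => ext' fun q w => prodA_smul_right _ _ w _ n p q)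

/-- The residue of `x₁^p (x₁ - x)^n β(x) α(x₁)`, expanded for `|x| > |x₁|`. -/
def rmul (n p : ℤ) : Fld V →ₗ[ℂ] Fld V →ₗ[ℂ] Fld V :=
  LinearMap.mk₂ ℂ
    (fun α β => ⟨fun q =>
      { toFun := fun w => prodB β α w n p q
        map_add' := fun w w' => by simp only [prodB, prodA_add, smul_add]
        map_smul' := fun c w => by
          simp only [prodB, prodA_smul, RingHom.id_apply, smul_comm c] },
      fun w => prodB_eq_zero_of_right α β w n p⟩)
    (fun α α' β => ext' fun q w => by
      change prodB β (α + α') w n p q = prodB β α w n p q + prodB β α' w n p q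
      simp only [prodB, prodA_add_right, smul_add])
    (fun c α β => ext' fun q w => by
      change prodB β (c • α) w n p q = c • prodB β α w n p q
      simp only [prodB, prodA_smul_right, smul_comm c])
    (fun α β β' => ext' fun q w => by
      change prodB (β + β') α w n p q = prodB β α w n p q + prodB β' α w n p q
      simp only [prodB, prodA_add_left, smul_add])
    (fun c α β => ext' fun q w => by
      change prodB (c • β) α w n p q = c • prodB β α w n p q
      simp only [prodB, prodA_smul_left, smul_comm c])

@[simp] theorem lmul_apply (n p q : ℤ) : (lmul n p α β).1 q w = prodA α β w n p q := rfl

@[simp] theorem rmul_apply (n p q : ℤ) : (rmul n p α β).1 q w = prodB β α w n p q := rfl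

/-- The residue product of fields, weighted by `x₁^p`. -/
def res (n p : ℤ) : Fld V →ₗ[ℂ] Fld V →ₗ[ℂ] Fld V :=
  lmul (V := V) n p - rmul (V := V) n p

theorem res_eq (n p : ℤ) : res n p α β = lmul n p α β - rmul n p α β := rfl

@[simp] theorem res_apply (n p q : ℤ) :
    (res n p α β).1 q w = prodA α β w n p q - prodB β α w n p q := rfl

section Composition

variable (f : Module.End ℂ V) (n p j : ℤ)

theorem lmul_zero_left : lmul 0 p α β = lcomp (α.1 p) β := by ext q w; simp

theorem rmul_zero_left : rmul 0 p α β = rcomp (α.1 p) β := by ext q w; simp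

theorem lcomp_lmul : lcomp f (lmul n p α φ) = lmul n p (lcomp f α) φ := by
  ext q w; exact map_prodA α φ w f n p q

theorem lmul_lcomp : lmul n p α (lcomp f φ) = lmul n p (rcomp f α) φ := rfl

theorem lcomp_rmul : lcomp f (rmul n p α φ) = rmul n p α (lcomp f φ) := by
  ext q w
  simp only [lcomp_apply, rmul_apply, prodB, map_smul, map_prodA]

theorem rcomp_lmul : rcomp f (lmul n p α φ) = lmul n p α (rcomp f φ) := rfl

theorem rcomp_rmul : rcomp f (rmul n p α φ) = rmul n p (rcomp f α) φ := rfl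

theorem rmul_rcomp : rmul n p α (rcomp f φ) = rmul n p (lcomp f α) φ := rfl

theorem lmul_shift_left : lmul n p (shift j α) φ = lmul n (p + j) α φ := by
  ext q w
  have := expand_shift (fun p q => α.1 p (φ.1 q w)) j 0 n p q
  simp only [add_zero] at this
  exact this

theorem lmul_shift_right : lmul n p α (shift j φ) = shift j (lmul n p α φ) := by
  ext q w
  have := expand_shift (fun p q => α.1 p (φ.1 q w)) 0 j n p q
  simp only [add_zero] at this
  exact this

theorem rmul_shift_left : rmul n p (shift j α) φ = rmul n (p + j) α φ := by
  ext q w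
  have := expand_shift (fun q p => φ.1 q (α.1 p w)) 0 j n q p
  simp only [add_zero] at this
  exact congrArg (fun z => ((-1 : ℂ) ^ n) • z) this

theorem rmul_shift_right : rmul n p α (shift j φ) = shift j (rmul n p α φ) := by
  ext q w
  have := expand_shift (fun q p => φ.1 q (α.1 p w)) j 0 n q p
  simp only [add_zero] at this
  exact congrArg (fun z => ((-1 : ℂ) ^ n) • z) this

theorem res_shift_left : res n p (shift j α) φ = res n (p + j) α φ := by
  rw [res_eq, res_eq, lmul_shift_left, rmul_shift_left]

theorem res_shift_right : res n p α (shift j φ) = shift j (res n p α φ) := by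
  rw [res_eq, res_eq, lmul_shift_right, rmul_shift_right, map_sub]

end Composition

/-! ### Pascal families of fields and Taylor coefficients -/

/-- Families of fields that are Pascal systems in the two parameters and the exponent of `x`. -/
def PascalFamily (Φ : ℤ → ℤ → Fld V) : Prop :=
  ∀ m r, Φ (m + 1) r = Φ m (r + 1) - shift 1 (Φ m r)

theorem PascalFamily.isPascal {Φ : ℤ → ℤ → Fld V} (h : PascalFamily Φ) :
    IsPascal fun m r q => (Φ m r).1 q w := by
  intro m r q
  simp only [h m r, sub_apply, shift_apply]

theorem PascalFamily.map {Φ : ℤ → ℤ → Fld V} (h : PascalFamily Φ) (F : Fld V →ₗ[ℂ] Fld V)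
    (hF : ∀ ξ, F (shift 1 ξ) = shift 1 (F ξ)) : PascalFamily fun m r => F (Φ m r) := by
  intro m r
  simp only [h m r, map_sub, hF]

theorem PascalFamily.sub {Φ Ψ : ℤ → ℤ → Fld V} (h : PascalFamily Φ) (h' : PascalFamily Ψ) :
    PascalFamily fun m r => Φ m r - Ψ m r := by
  intro m r
  simp only [h m r, h' m r, map_sub]
  abel

theorem PascalFamily.sum {ι : Type*} (s : Finset ι) {Φ : ι → ℤ → ℤ → Fld V}
    (h : ∀ i ∈ s, PascalFamily (Φ i)) : PascalFamily fun m r => ∑ i ∈ s, Φ i m r := by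
  intro m r
  simp only [map_sum]
  rw [← Finset.sum_sub_distrib]
  exact Finset.sum_congr rfl fun i hi => h i hi m r

theorem pascalFamily_lmul : PascalFamily fun m r => lmul m r α φ := fun m r => by
  ext q w; exact isPascal_prodA α φ w m r q

theorem pascalFamily_rmul : PascalFamily fun m r => rmul m r α φ := fun m r => by
  ext q w; exact isPascal_prodB α φ w m r q

theorem pascalFamily_res : PascalFamily fun m r => res m r α φ :=
  (pascalFamily_lmul α φ).sub (pascalFamily_rmul α φ)

/-- The `i`-th Taylor coefficient of `t^r (t - x)^m` at `t = s`, paired with a family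
representing the functional `s^p (s - x)^n ↦ Ψ n p`. -/
def taylor (Ψ : ℤ → ℤ → Fld V) (n p : ℤ) (i : ℕ) (m r : ℤ) : Fld V :=
  ∑ x ∈ Finset.HasAntidiagonal.antidiagonal i,
    (Ring.choose r x.1 * Ring.choose m x.2) • Ψ (n + m - x.2) (p + r - x.1)

theorem taylor_zero_left (Ψ : ℤ → ℤ → Fld V) (n p : ℤ) (i : ℕ) (r : ℤ) :
    taylor Ψ n p i 0 r = Ring.choose r i • Ψ n (p + r - i) := by
  unfold taylor
  rw [Finset.sum_eq_single (i, 0)]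
  · simp
  · rintro ⟨a, b⟩ hab hne
    obtain rfl | hb := Nat.eq_zero_or_pos b
    · simp only [Finset.HasAntidiagonal.mem_antidiagonal, add_zero] at hab
      exact absurd (by rw [hab]) hne
    · simp only [Ring.choose_zero_pos ℤ hb, mul_zero, zero_smul]
  · simp

theorem taylor_zero_right (Ψ : ℤ → ℤ → Fld V) (n p : ℤ) (i : ℕ) (m : ℤ) :
    taylor Ψ n p i m 0 = Ring.choose m i • Ψ (n + m - i) p := by
  unfold taylor
  rw [Finset.sum_eq_single (0, i)]
  · simp
  · rintro ⟨a, b⟩ hab hne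
    obtain rfl | hb := Nat.eq_zero_or_pos a
    · simp only [Finset.HasAntidiagonal.mem_antidiagonal, zero_add] at hab
      exact absurd (by rw [hab]) hne
    · simp only [Ring.choose_zero_pos ℤ hb, zero_mul, zero_smul]
  · simp

/-- An extra factor t - x or t contributes one further sum, by Pascal's rule in the corresponding
binomial coefficient. Both factors have derivative 1, so the two further sums coincide and cancel;
the rest is the relation for Ψ. -/
theorem pascalFamily_taylor {Ψ : ℤ → ℤ → Fld V} (h : PascalFamily Ψ) (n p : ℤ) (i : ℕ) :
    PascalFamily (taylor Ψ n p i) := by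
  intro m r
  have key : ∀ x : ℕ × ℕ, Ψ (n + (m + 1) - x.2) (p + r - x.1) =
      Ψ (n + m - x.2) (p + (r + 1) - x.1) - shift 1 (Ψ (n + m - x.2) (p + r - x.1)) := by
    intro x
    rw [show n + (m + 1) - (x.2 : ℤ) = n + m - x.2 + 1 by ring, h,
      show p + r - (x.1 : ℤ) + 1 = p + (r + 1) - x.1 by ring]
  have main : ∀ k : ℕ, ∑ x ∈ Finset.HasAntidiagonal.antidiagonal k, (Ring.choose r x.1 * Ring.choose m x.2) •
      Ψ (n + (m + 1) - x.2) (p + r - x.1) = ∑ x ∈ Finset.HasAntidiagonal.antidiagonal k,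
      (Ring.choose r x.1 * Ring.choose m x.2) • Ψ (n + m - x.2) (p + (r + 1) - x.1) -
      shift 1 (taylor Ψ n p k m r) := by
    intro k
    simp only [taylor, map_sum, key, smul_sub, Finset.sum_sub_distrib, map_zsmul]
  cases i with
  | zero => simpa [taylor] using main 0
  | succ k =>
    have e1 : taylor Ψ n p (k + 1) (m + 1) r = ∑ x ∈ Finset.HasAntidiagonal.antidiagonal (k + 1),
        (Ring.choose r x.1 * Ring.choose m x.2) • Ψ (n + (m + 1) - x.2) (p + r - x.1) +
        ∑ x ∈ Finset.HasAntidiagonal.antidiagonal k,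
        (Ring.choose r x.1 * Ring.choose m x.2) • Ψ (n + m - x.2) (p + r - x.1) := by
      unfold taylor
      rw [Finset.Nat.sum_antidiagonal_succ', Finset.Nat.sum_antidiagonal_succ', add_assoc,
        ← Finset.sum_add_distrib]
      congr 1
      · simp
      · refine Finset.sum_congr rfl fun x _ => ?_
        simp only [Ring.choose_succ_succ]
        rw [show n + (m + 1) - ((x.2 + 1 : ℕ) : ℤ) = n + m - x.2 by push_cast; ring, ← add_smul]
        congr 1; ring
    have e2 : taylor Ψ n p (k + 1) m (r + 1) = ∑ x ∈ Finset.HasAntidiagonal.antidiagonal (k + 1),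
        (Ring.choose r x.1 * Ring.choose m x.2) • Ψ (n + m - x.2) (p + (r + 1) - x.1) +
        ∑ x ∈ Finset.HasAntidiagonal.antidiagonal k,
        (Ring.choose r x.1 * Ring.choose m x.2) • Ψ (n + m - x.2) (p + r - x.1) := by
      unfold taylor
      rw [Finset.Nat.sum_antidiagonal_succ, Finset.Nat.sum_antidiagonal_succ, add_assoc,
        ← Finset.sum_add_distrib]
      congr 1
      · simp
      · refine Finset.sum_congr rfl fun x _ => ?_
        simp only [Ring.choose_succ_succ]
        rw [show p + (r + 1) - ((x.1 + 1 : ℕ) : ℤ) = p + r - x.1 by push_cast; ring, ← add_smul]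
        congr 1; ring
    rw [e1, e2, main]
    abel

end Fld

end Fields
end SemidirectVertex
end

/-! ### Commutator formula for residue products, the identity field, derivatives -/

noncomputable section
namespace SemidirectVertex
namespace Fld

variable {V : Type*} [AddCommGroup V] [Module ℂ V]

/-- Uniform vanishing for large powers of `x⁻¹`. -/
def BddModes {I : Type*} (Φ : I → Fld V) : Prop :=
  ∀ w, ∃ N : ℤ, ∀ i q, N ≤ q → (Φ i).1 q w = 0

/-- Vanishing of the family for large parameter, uniformly in the modes. -/
def BddParam (Φ : ℤ → ℤ → Fld V) : Prop :=
  ∀ w, ∃ N : ℤ, ∀ m r q, N ≤ r → (Φ m r).1 q w = 0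

variable (α β φ : Fld V)

theorem bddModes_lmul : BddModes fun i : ℤ × ℤ => lmul i.1 i.2 α φ := fun w => by
  obtain ⟨N, hN⟩ := prodA_bdd α φ w
  exact ⟨N, fun i q hq => hN i.1 i.2 q hq⟩

theorem bddParam_rmul : BddParam fun m r => rmul m r α φ := fun w => by
  obtain ⟨N, hN⟩ := prodB_bdd α φ w
  exact ⟨N, fun m r q hq => hN m r q hq⟩

variable {φ}

theorem BddModes.sub {I : Type*} {Φ Ψ : I → Fld V} (h : BddModes Φ) (h' : BddModes Ψ) :
    BddModes fun i => Φ i - Ψ i := fun w => by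
  obtain ⟨N, hN⟩ := h w
  obtain ⟨N', hN'⟩ := h' w
  exact ⟨max N N', fun i q hq => by
    simp only [sub_apply]; rw [hN i q (by lia), hN' i q (by lia), sub_zero]⟩

theorem BddParam.sub {Φ Ψ : ℤ → ℤ → Fld V} (h : BddParam Φ) (h' : BddParam Ψ) :
    BddParam fun m r => Φ m r - Ψ m r := fun w => by
  obtain ⟨N, hN⟩ := h w
  obtain ⟨N', hN'⟩ := h' w
  exact ⟨max N N', fun m r q hq => by
    simp only [sub_apply]; rw [hN m r q (by lia), hN' m r q (by lia), sub_zero]⟩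

theorem BddModes.sum {I ι : Type*} (s : Finset ι) {Φ : ι → I → Fld V}
    (h : ∀ j ∈ s, BddModes (Φ j)) : BddModes fun i => ∑ j ∈ s, Φ j i := by
  classical
  induction s using Finset.induction_on with
  | empty => exact fun w => ⟨0, fun i q _ => by simp⟩
  | insert a s ha ih =>
    intro w
    obtain ⟨N, hN⟩ := h a (Finset.mem_insert_self _ _) w
    obtain ⟨N', hN'⟩ := ih (fun j hj => h j (Finset.mem_insert_of_mem hj)) w
    exact ⟨max N N', fun i q hq => by
      beta_reduce
      rw [Finset.sum_insert ha, add_apply, hN i q (by lia), hN' i q (by lia), add_zero]⟩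

theorem BddParam.sum {ι : Type*} (s : Finset ι) {Φ : ι → ℤ → ℤ → Fld V}
    (h : ∀ j ∈ s, BddParam (Φ j)) : BddParam fun m r => ∑ j ∈ s, Φ j m r := by
  classical
  induction s using Finset.induction_on with
  | empty => exact fun w => ⟨0, fun m r q _ => by simp⟩
  | insert a s ha ih =>
    intro w
    obtain ⟨N, hN⟩ := h a (Finset.mem_insert_self _ _) w
    obtain ⟨N', hN'⟩ := ih (fun j hj => h j (Finset.mem_insert_of_mem hj)) w
    exact ⟨max N N', fun m r q hq => by
      beta_reduce
      rw [Finset.sum_insert ha, add_apply, hN m r q (by lia), hN' m r q (by lia), add_zero]⟩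

theorem BddModes.lmul {I : Type*} {Φ : I → Fld V} (h : BddModes Φ) (n p : ℤ) :
    BddModes fun i => lmul n p α (Φ i) := fun w => by
  obtain ⟨N, hN⟩ := h w
  refine ⟨N, fun i q hq => ?_⟩
  change expand (fun p q => α.1 p ((Φ i).1 q w)) n p q = 0
  exact expand_bdd (N := N) (fun p q hq => by rw [hN i q hq, map_zero]) hq

/-- Treating the family as one double sequence with values in `I → V` makes the bound from
`expand_eq_zero_of_left` uniform in the index. -/
theorem BddModes.rmul {I : Type*} {Φ : I → Fld V} (h : BddModes Φ) (n p : ℤ) :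
    BddModes fun i => rmul n p α (Φ i) := fun w => by
  let G : ℤ → ℤ → I → V := fun q p i => (Φ i).1 q (α.1 p w)
  have hG : BddRight G := by
    obtain ⟨N, hN⟩ := α.2 w
    exact ⟨N, fun q p hp => funext fun i => by simp only [G, hN p hp, map_zero, Pi.zero_apply]⟩
  obtain ⟨N, hN⟩ := expand_eq_zero_of_left hG
    (fun p => (h (α.1 p w)).imp fun N hN q hq => funext fun i => hN i q hq) n p
  refine ⟨N, fun i q hq => ?_⟩
  have := map_expand hG (Pi.evalAddMonoidHom (fun _ : I => V) i) n q p
  rw [hN q hq, map_zero] at this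
  change ((-1 : ℂ) ^ n) • expand (fun q p => (Φ i).1 q (α.1 p w)) n q p = 0
  rw [show expand (fun q p => (Φ i).1 q (α.1 p w)) n q p = 0 from this.symm, smul_zero]

theorem BddParam.lmul {Φ : ℤ → ℤ → Fld V} (h : BddParam Φ) (n p : ℤ) :
    BddParam fun m r => lmul n p α (Φ m r) := fun w => by
  obtain ⟨N, hN⟩ := h w
  refine ⟨N, fun m r q hr => ?_⟩
  change expand (fun p q => α.1 p ((Φ m r).1 q w)) n p q = 0
  rw [expand_eq_sum 0 (fun i _ => by rw [hN m r _ hr, map_zero])]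
  simp

theorem BddParam.rmul {Φ : ℤ → ℤ → Fld V} (h : BddParam Φ) (n p : ℤ) :
    BddParam fun m r => rmul n p α (Φ m r) := fun w => by
  obtain ⟨k, hk⟩ : ∃ k : ℕ, ∀ i : ℕ, k ≤ i → α.1 (p + i) w = 0 := by
    obtain ⟨N, hN⟩ := α.2 w
    exact ⟨(N - p).toNat, fun i hi => hN _ (by lia)⟩
  choose N hN using fun i : ℕ => h (α.1 (p + i) w)
  refine ⟨∑ i ∈ Finset.range k, |N i|, fun m r q hr => ?_⟩
  change ((-1 : ℂ) ^ n) • expand (fun q p => (Φ m r).1 q (α.1 p w)) n q p = 0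
  rw [expand_eq_sum k (fun i hi => by rw [hk i hi, map_zero]), Finset.sum_eq_zero, smul_zero]
  intro i hi
  rw [hN, smul_zero]
  have h1 : |N i| ≤ ∑ i ∈ Finset.range k, |N i| :=
    Finset.single_le_sum (f := fun i : ℕ => |N i|) (fun _ _ => abs_nonneg _) hi
  have h2 := le_abs_self (N i)
  lia

theorem BddModes.res {I : Type*} {Φ : I → Fld V} (h : BddModes Φ) (n p : ℤ) :
    BddModes fun i => res n p α (Φ i) := (h.lmul α n p).sub (h.rmul α n p)

theorem BddParam.res {Φ : ℤ → ℤ → Fld V} (h : BddParam Φ) (n p : ℤ) :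
    BddParam fun m r => res n p α (Φ m r) := (h.lmul α n p).sub (h.rmul α n p)

theorem BddModes.taylor {Ψ : ℤ → ℤ → Fld V} (h : BddModes fun i : ℤ × ℤ => Ψ i.1 i.2)
    (n p : ℤ) (i : ℕ) : BddModes fun j : ℤ × ℤ => taylor Ψ n p i j.1 j.2 := by
  refine BddModes.sum _ fun x _ w => ?_
  obtain ⟨N, hN⟩ := h w
  exact ⟨N, fun j q hq => by
    rw [zsmul_apply, hN (n + j.1 - x.2, p + j.2 - x.1) q hq, smul_zero]⟩

theorem BddParam.taylor {Ψ : ℤ → ℤ → Fld V} (h : BddParam Ψ) (n p : ℤ) (i : ℕ) :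
    BddParam (taylor Ψ n p i) := by
  refine BddParam.sum _ fun x _ w => ?_
  obtain ⟨N, hN⟩ := h w
  exact ⟨N - p + x.1, fun m r q hq => by rw [zsmul_apply, hN _ _ _ (by lia), smul_zero]⟩

theorem PascalFamily.eq_of_bddModes {Φ Ψ : ℤ → ℤ → Fld V} (h : PascalFamily Φ)
    (h' : PascalFamily Ψ) (h0 : ∀ r, Φ 0 r = Ψ 0 r)
    (hb : BddModes fun i : ℤ × ℤ => Φ i.1 i.2) (hb' : BddModes fun i : ℤ × ℤ => Ψ i.1 i.2)
    (m r : ℤ) : Φ m r = Ψ m r := by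
  ext q w
  exact IsPascal.eq_of_right (h.isPascal w) (h'.isPascal w)
    (fun p q => by simp only [h0])
    ((hb w).imp fun N hN n p q hq => hN (n, p) q hq)
    ((hb' w).imp fun N hN n p q hq => hN (n, p) q hq) m r q

theorem PascalFamily.eq_of_bddParam {Φ Ψ : ℤ → ℤ → Fld V} (h : PascalFamily Φ)
    (h' : PascalFamily Ψ) (h0 : ∀ r, Φ 0 r = Ψ 0 r) (hb : BddParam Φ) (hb' : BddParam Ψ)
    (m r : ℤ) : Φ m r = Ψ m r := by
  ext q w
  exact IsPascal.eq_of_left (h.isPascal w) (h'.isPascal w)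
    (fun p q => by simp only [h0]) (hb w) (hb' w) m r q

/-- The commutation relation `[κ(r), α(x)] = ∑ᵢ C(r,i) x^(r-i) αᵢ(x)` of a field with the modes of
another one. -/
def CommModes (κ α : Fld V) (N : ℕ) (αs : ℕ → Fld V) : Prop :=
  ∀ r : ℤ, lcomp (κ.1 r) α - rcomp (κ.1 r) α =
    ∑ i ∈ Finset.range N, Ring.choose r i • shift (r - i) (αs i)

variable {κ α} {N : ℕ} {αs : ℕ → Fld V}

/-- Both sides are Pascal families in m and r with uniformly bounded modes, so m = 0 suffices. There
the left product with κ is composition with the mode κ(r), and the hypothesis applies. -/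
theorem CommModes.lmul_res (h : CommModes κ α N αs) (φ : Fld V) (m r n p : ℤ) :
    lmul m r κ (res n p α φ) - res n p α (lmul m r κ φ) =
      ∑ i ∈ Finset.range N, taylor (fun n p => lmul n p (αs i) φ) n p i m r := by
  refine PascalFamily.eq_of_bddModes
    ((pascalFamily_lmul κ _).sub ((pascalFamily_lmul κ φ).map (Fld.res n p α)
      fun ξ => res_shift_right α ξ n p 1))
    (PascalFamily.sum _ fun i _ => pascalFamily_taylor (pascalFamily_lmul (αs i) φ) n p i)
    (fun r => ?_) ((bddModes_lmul κ _).sub ((bddModes_lmul κ φ).res α n p))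
    (BddModes.sum _ fun i _ => (bddModes_lmul (αs i) φ).taylor n p i) m r
  simp only [taylor_zero_left, lmul_zero_left, res_eq, map_sub, lcomp_lmul, lmul_lcomp, lcomp_rmul]
  -- The terms with φ to the left of α cancel, since there κ(r) already stands next to φ; what
  -- remains is the commutator of κ(r) with α.
  rw [sub_sub_sub_cancel_right, ← LinearMap.sub_apply, ← map_sub, h r, map_sum,
    LinearMap.sum_apply]
  refine Finset.sum_congr rfl fun i _ => ?_
  rw [map_zsmul, LinearMap.smul_apply, lmul_shift_left, add_sub_assoc]

/-- With κ on the right, the products vanish for large r uniformly in the other indices, so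
uniqueness comes from truncation in the parameter. -/
theorem CommModes.rmul_res (h : CommModes κ α N αs) (φ : Fld V) (m r n p : ℤ) :
    rmul m r κ (res n p α φ) - res n p α (rmul m r κ φ) =
      ∑ i ∈ Finset.range N, taylor (fun n p => rmul n p (αs i) φ) n p i m r := by
  refine PascalFamily.eq_of_bddParam
    ((pascalFamily_rmul κ _).sub ((pascalFamily_rmul κ φ).map (Fld.res n p α)
      fun ξ => res_shift_right α ξ n p 1))
    (PascalFamily.sum _ fun i _ => pascalFamily_taylor (pascalFamily_rmul (αs i) φ) n p i)
    (fun r => ?_) ((bddParam_rmul κ _).sub ((bddParam_rmul κ φ).res α n p))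
    (BddParam.sum _ fun i _ => (bddParam_rmul (αs i) φ).taylor n p i) m r
  simp only [taylor_zero_left, rmul_zero_left, res_eq, map_sub, rcomp_lmul, rcomp_rmul, rmul_rcomp]
  rw [sub_sub_sub_cancel_left, ← LinearMap.sub_apply, ← map_sub, h r, map_sum,
    LinearMap.sum_apply]
  refine Finset.sum_congr rfl fun i _ => ?_
  rw [map_zsmul, LinearMap.smul_apply, rmul_shift_left, add_sub_assoc]

/-- The Borcherds commutator formula for residue products. It needs only the commutator of κ with α;
no locality with φ enters, and the weight p is preserved. -/
theorem CommModes.res_res (h : CommModes κ α N αs) (φ : Fld V) (m n p : ℤ) :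
    res m 0 κ (res n p α φ) - res n p α (res m 0 κ φ) =
      ∑ i ∈ Finset.range N, Ring.choose m i • res (n + m - i) p (αs i) φ := by
  have h1 := h.lmul_res φ m 0 n p
  have h2 := h.rmul_res φ m 0 n p
  simp only [taylor_zero_right] at h1 h2
  rw [res_eq κ, res_eq κ, map_sub, sub_sub_sub_comm, h1, h2, ← Finset.sum_sub_distrib]
  simp only [← smul_sub, ← res_eq]

/-! ### The identity field -/

/-- For n ≥ 0 the factor (x₁ - x)^n is a polynomial, so its two expansions agree, and the identity
commutes with every field. -/
theorem res_one (n p : ℤ) (hn : 0 ≤ n) : res n p one φ = 0 := by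
  obtain ⟨k, rfl⟩ := Int.eq_ofNat_of_zero_le hn
  ext q w
  refine IsPascal.eq_zero_of_nonneg (T := fun n p q => (res n p one φ).1 q w)
    ((pascalFamily_res one φ).isPascal w) (fun p q => ?_) k p q
  simp only [res_apply, prodA_zero, prodB_zero, one_apply]
  split_ifs <;> simp

theorem res_one_right (n p : ℤ) (hn : 0 ≤ n) : res n p φ one = 0 := by
  obtain ⟨k, rfl⟩ := Int.eq_ofNat_of_zero_le hn
  ext q w
  refine IsPascal.eq_zero_of_nonneg (T := fun n p q => (res n p φ one).1 q w)
    ((pascalFamily_res φ one).isPascal w) (fun p q => ?_) k p q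
  simp only [res_apply, prodA_zero, prodB_zero, one_apply]
  split_ifs <;> simp

theorem prodA_one (w : V) (n q : ℤ) (hn : n < 0) :
    prodA one φ w n 0 q = if n = -1 then φ.1 q w else 0 := by
  unfold prodA
  rw [expand_eq_sum 1 (fun i hi => by rw [one_apply, if_neg (by lia)])]
  simp only [Finset.range_one, Finset.sum_singleton, signedChoose_zero_right, one_smul, one_apply]
  simp

theorem prodB_one (w : V) (n q : ℤ) : prodB φ one w n 0 q = 0 := by
  unfold prodB prodA
  rw [expand_eq_sum 0 (fun i hi => by rw [one_apply, if_neg (by lia), map_zero])]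
  simp

theorem res_one_zero (n : ℤ) : res n 0 one φ = if n = -1 then φ else 0 := by
  rcases lt_or_ge n 0 with hn | hn
  · ext q w
    rw [res_apply, prodA_one w n q hn, prodB_one, sub_zero]
    split_ifs <;> rfl
  · rw [res_one n 0 hn, if_neg (by lia)]

/-- The two expansions of (x₁ - x)⁻¹ recover complementary halves of φ: the modes with q < 0 come
from `prodA`, those with q ≥ 0 from `prodB`. -/
theorem res_neg_one_right : res (-1) 0 φ one = φ := by
  ext q w
  rw [res_apply, prodB]
  unfold prodA
  rcases lt_or_ge q 0 with hq | hq
  · have h2 : expand (fun q p => (one : Fld V).1 q (φ.1 p w)) (-1) q 0 = 0 := by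
      rw [expand_eq_sum 0 (fun i hi => by rw [one_apply, if_neg (by lia)])]
      simp
    rw [h2, smul_zero, sub_zero]
    have h1 : expand (fun p q => φ.1 p ((one : Fld V).1 q w)) (-1) 0 q =
        signedChoose (-1) (-1 - q).toNat • φ.1 q w := by
      unfold expand
      rw [finsum_eq_single _ (-1 - q).toNat]
      · beta_reduce
        rw [one_apply, if_pos (by lia)]
        congr 3; lia
      · intro i hi
        beta_reduce
        rw [one_apply, if_neg (by lia), map_zero, smul_zero]
    have h3 : signedChoose (-1) (-1 - q).toNat = 1 := by
      have := signedChoose_sub_one (-1) (-1 - q).toNat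
      rw [sub_neg_eq_add, add_sub_cancel_right, Ring.choose_natCast, Nat.choose_self] at this
      rw [signedChoose, ← this]
      rw [Nat.cast_one, mul_one, ← mul_pow]; simp
    rw [h1, h3, one_smul]
  · have h1 : expand (fun p q => φ.1 p ((one : Fld V).1 q w)) (-1) 0 q = 0 := by
      rw [expand_eq_sum 0 (fun i hi => by rw [one_apply, if_neg (by lia), map_zero])]
      simp
    have h2 : expand (fun q p => (one : Fld V).1 q (φ.1 p w)) (-1) q 0 = φ.1 q w := by
      unfold expand
      rw [finsum_eq_single _ q.toNat]
      · have h3 : signedChoose (-1) q.toNat = 1 := by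
          have := signedChoose_sub_one (-1) q.toNat
          rw [sub_neg_eq_add, add_sub_cancel_right, Ring.choose_natCast, Nat.choose_self] at this
          rw [signedChoose, ← this]
          rw [Nat.cast_one, mul_one, ← mul_pow]; simp
        beta_reduce
        rw [one_apply, if_pos (by lia), h3, one_smul]
        congr 2; lia
      · intro i hi
        beta_reduce
        rw [one_apply, if_neg (by lia), smul_zero]
    rw [h1, h2]; simp

/-! ### The derivative -/

/-- The derivative of a field. -/
def deriv : Fld V →ₗ[ℂ] Fld V where
  toFun α := ⟨fun n => (-n) • α.1 (n - 1), fun w => by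
    obtain ⟨N, hN⟩ := α.2 w
    exact ⟨N + 1, fun n hn => by
      change (-n) • α.1 (n - 1) w = 0
      rw [hN _ (by lia), smul_zero]⟩⟩
  map_add' α β := ext' fun n w => smul_add (-n) (α.1 (n - 1) w) (β.1 (n - 1) w)
  map_smul' c α := ext' fun n w => smul_comm (-n) c (α.1 (n - 1) w)

@[simp] theorem deriv_apply (α : Fld V) (n : ℤ) (w : V) :
    (deriv α).1 n w = (-n) • α.1 (n - 1) w := rfl

/-- Integration by parts in x₂ against x₂^q (x₁ - x₂)^n. The claim is immediate at n = 0, and both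
sides are Pascal systems truncated in q. -/
theorem prodA_deriv_right (α φ : Fld V) (w : V) (n p q : ℤ) :
    prodA α (deriv φ) w n p q =
      (-q) • prodA α φ w n p (q - 1) + n • prodA α φ w (n - 1) p q := by
  refine IsPascal.eq_of_right (isPascal_prodA α (deriv φ) w)
    (S := fun n p q => (-q) • prodA α φ w n p (q - 1) + n • prodA α φ w (n - 1) p q) ?_ ?_
    (prodA_bdd _ _ _) ?_ n p q
  · intro n p q
    have h1 := isPascal_prodA α φ w n p (q - 1)
    have h2 := isPascal_prodA α φ w (n - 1) p q
    rw [sub_add_cancel] at h1 h2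
    simp only [add_sub_cancel_right, h1, h2]
    module
  · intro p q; simp
  · obtain ⟨N, hN⟩ := prodA_bdd α φ w
    exact ⟨N + 1, fun n p q hq => by simp only [hN n p (q - 1) (by lia), hN (n - 1) p q (by lia),
      smul_zero, add_zero]⟩

theorem prodA_deriv_left (α φ : Fld V) (w : V) (n p q : ℤ) :
    prodA (deriv α) φ w n p q =
      (-p) • prodA α φ w n (p - 1) q - n • prodA α φ w (n - 1) p q := by
  refine IsPascal.eq_of_right (isPascal_prodA (deriv α) φ w)
    (S := fun n p q => (-p) • prodA α φ w n (p - 1) q - n • prodA α φ w (n - 1) p q) ?_ ?_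
    (prodA_bdd _ _ _) ?_ n p q
  · intro n p q
    have h1 := isPascal_prodA α φ w n (p - 1) q
    have h2 := isPascal_prodA α φ w (n - 1) p q
    rw [sub_add_cancel] at h1 h2
    simp only [add_sub_cancel_right, h1, h2]
    module
  · intro p q; simp
  · obtain ⟨N, hN⟩ := prodA_bdd α φ w
    exact ⟨N, fun n p q hq => by simp only [hN n (p - 1) q (by lia), hN (n - 1) p q (by lia),
      smul_zero, sub_zero]⟩

theorem prodB_deriv_right (φ α : Fld V) (w : V) (n p q : ℤ) :
    prodB φ (deriv α) w n p q =
      (-p) • prodB φ α w n (p - 1) q - n • prodB φ α w (n - 1) p q := by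
  simp only [prodB, prodA_deriv_right, zpow_sub_one₀ (by norm_num : (-1 : ℂ) ≠ 0)]
  rw [show ((-1 : ℂ))⁻¹ = -1 by norm_num]
  module

theorem prodB_deriv_left (φ α : Fld V) (w : V) (n p q : ℤ) :
    prodB (deriv φ) α w n p q =
      (-q) • prodB φ α w n p (q - 1) + n • prodB φ α w (n - 1) p q := by
  simp only [prodB, prodA_deriv_left, zpow_sub_one₀ (by norm_num : (-1 : ℂ) ≠ 0)]
  rw [show ((-1 : ℂ))⁻¹ = -1 by norm_num]
  module

theorem deriv_res (α φ : Fld V) (n : ℤ) :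
    deriv (res n 0 α φ) = res n 0 α (deriv φ) - n • res (n - 1) 0 α φ := by
  ext q w
  simp only [deriv_apply, res_apply, sub_apply, zsmul_apply, prodA_deriv_right, prodB_deriv_left]
  module

theorem res_deriv_left (α φ : Fld V) (n : ℤ) :
    res n 0 (deriv α) φ = (-n) • res (n - 1) 0 α φ := by
  ext q w
  simp only [res_apply, zsmul_apply, prodA_deriv_left, prodB_deriv_right]
  module

end Fld
end SemidirectVertex
end

noncomputable section
namespace SemidirectVertex
namespace Fld

variable {V : Type*} [AddCommGroup V] [Module ℂ V]

/-! ### Associativity of pairs of fields -/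

/-- The coefficients of `x₁^p x₂^q x₀^n` paired with `∑ₙ γₙ(x₂) x₀^(-n-1) w`, where
`x₁ = x₂ + x₀` is expanded for `|x₀| < |x₂|`. -/
def prodC (γ : ℤ → Fld V) (w : V) : ℤ → ℤ → ℤ → V :=
  expandMid fun n q => (γ n).1 q w

/-- Vanishing of a sequence of fields at all large indices. -/
def SeqTrunc (γ : ℤ → Fld V) : Prop := ∃ N : ℤ, ∀ n, N ≤ n → γ n = 0

namespace SeqTrunc

variable {γ γ' : ℤ → Fld V}

theorem add (h : SeqTrunc γ) (h' : SeqTrunc γ') : SeqTrunc fun n => γ n + γ' n := by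
  obtain ⟨N, hN⟩ := h
  obtain ⟨N', hN'⟩ := h'
  exact ⟨max N N', fun n hn => by simp only [hN n (by lia), hN' n (by lia), add_zero]⟩

theorem map (h : SeqTrunc γ) (f : Fld V →ₗ[ℂ] Fld V) : SeqTrunc fun n => f (γ n) := by
  obtain ⟨N, hN⟩ := h
  exact ⟨N, fun n hn => by simp only [hN n hn, map_zero]⟩

theorem smul (h : SeqTrunc γ) (c : ℂ) : SeqTrunc fun n => c • γ n := by
  obtain ⟨N, hN⟩ := h
  exact ⟨N, fun n hn => by simp only [hN n hn, smul_zero]⟩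

theorem comp_add (h : SeqTrunc γ) (j : ℤ) : SeqTrunc fun n => γ (n + j) := by
  obtain ⟨N, hN⟩ := h
  exact ⟨N - j, fun n hn => hN _ (by lia)⟩

theorem bddLeft (h : SeqTrunc γ) (w : V) : BddLeft fun n q => (γ n).1 q w := by
  obtain ⟨N, hN⟩ := h
  exact ⟨N, fun n q hn => by simp only [hN n hn]; rfl⟩

end SeqTrunc

variable {α β φ : Fld V} {γ γ' : ℤ → Fld V}

theorem isPascal_prodC (h : SeqTrunc γ) (w : V) : IsPascal (prodC γ w) :=
  isPascal_expandMid (h.bddLeft w)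

@[simp] theorem prodC_zero (γ : ℤ → Fld V) (w : V) (n q : ℤ) :
    prodC γ w n 0 q = (γ n).1 q w := expandMid_zero _ _ _

theorem prodC_bdd (h : SeqTrunc γ) (w : V) :
    ∃ N : ℤ, ∀ n p q, N ≤ n → prodC γ w n p q = 0 := by
  obtain ⟨N, hN⟩ := h.bddLeft w
  exact ⟨N, fun n p q hn => expandMid_bdd hN hn⟩

theorem prodC_eq_zero (h : SeqTrunc γ) (w : V) (n : ℤ) :
    ∃ N : ℤ, ∀ p q, N ≤ p + q → prodC γ w n p q = 0 :=
  expandMid_eq_zero_of_right (h.bddLeft w) (fun n => (γ n).2 w) n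

theorem prodC_add (h : SeqTrunc γ) (h' : SeqTrunc γ') (w : V) (n p q : ℤ) :
    prodC (fun n => γ n + γ' n) w n p q = prodC γ w n p q + prodC γ' w n p q :=
  expandMid_add (h.bddLeft w) (h'.bddLeft w) n p q

theorem prodC_smul (h : SeqTrunc γ) (c : ℂ) (w : V) (n p q : ℤ) :
    prodC (fun n => c • γ n) w n p q = c • prodC γ w n p q :=
  (map_expandMid (h.bddLeft w) (LinearMap.lsmul ℂ V c) n p q).symm

theorem prodC_comp_add (γ : ℤ → Fld V) (j : ℤ) (w : V) (n p q : ℤ) :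
    prodC (fun n => γ (n + j)) w n p q = prodC γ w (n + j) p q :=
  expandMid_shift (fun n q => (γ n).1 q w) j n p q

/-- Mutual locality, in the form of truncation of all residue products. -/
def IsLocal (α φ : Fld V) : Prop := ∃ N : ℤ, ∀ n p, N ≤ n → res n p α φ = 0

theorem IsLocal.seqTrunc (h : IsLocal α φ) : SeqTrunc fun n => res n 0 α φ :=
  h.imp fun _ hN n hn => hN n 0 hn

/-- At p = 0 the two sides agree by the definition of the n-th product. Locality gives vanishing for
large n, uniformly in p and q, so `eq_of_middle` applies. -/
theorem IsLocal.jacobi (h : IsLocal α φ) (w : V) (n p q : ℤ) :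
    prodA α φ w n p q - prodB φ α w n p q = prodC (fun n => res n 0 α φ) w n p q := by
  refine IsPascal.eq_of_middle ((isPascal_prodA α φ w).sub (isPascal_prodB α φ w))
    (isPascal_prodC h.seqTrunc w) (fun n q => ?_) ?_ (prodC_bdd h.seqTrunc w) n p q
  · rw [prodC_zero]; rfl
  · obtain ⟨N, hN⟩ := h
    exact ⟨N, fun n p q hn => congrArg (fun ξ : Fld V => ξ.1 q w) (hN n p hn)⟩

/-- The commutator formula is the Jacobi identity at n = 0. -/
theorem IsLocal.commModes (h : IsLocal α φ) :
    ∃ N, CommModes α φ N fun i => res i 0 α φ := by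
  obtain ⟨N, hN⟩ := h.seqTrunc
  refine ⟨N.toNat, fun r => ?_⟩
  ext q w
  have := h.jacobi w 0 r q
  rw [prodA_zero, prodB_zero] at this
  simp only [sub_apply, lcomp_apply, rcomp_apply, this, sum_apply, zsmul_apply, shift_apply]
  unfold prodC
  rw [expandMid_eq_sum N.toNat (fun i hi => by rw [hN _ (by lia)]; rfl)]
  refine Finset.sum_congr rfl fun i _ => ?_
  rw [zero_add, show r + q - (i : ℤ) = q + (r - i) by ring]

/-- Weak associativity: `γₙ` is the `n`-th product of the field `α` with `φ`. -/
def IsProduct (α φ : Fld V) (γ : ℤ → Fld V) : Prop :=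
  SeqTrunc γ ∧ ∀ w, ∃ l : ℤ, ∀ n p q, l ≤ p → prodA α φ w n p q = prodC γ w n p q

/-- For large p the oppositely ordered product vanishes on w, and the Jacobi identity loses its
middle term. -/
theorem IsLocal.isProduct (h : IsLocal α φ) : IsProduct α φ fun n => res n 0 α φ := by
  refine ⟨h.seqTrunc, fun w => ?_⟩
  obtain ⟨N, hN⟩ := prodB_bdd α φ w
  exact ⟨N, fun n p q hp => by rw [← h.jacobi w n p q, hN n p q hp, sub_zero]⟩

/-- Descending induction on n: in the expansion of `prodC` the term i = 0 is γₙ, and all other terms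
involve γₙ₊ᵢ with i > 0, which are already known. -/
theorem IsProduct.eq (h : IsProduct α φ γ) (h' : IsProduct α φ γ') : γ = γ' := by
  obtain ⟨N, hN⟩ := h.1
  obtain ⟨N', hN'⟩ := h'.1
  have key : ∀ k : ℕ, ∀ n, max N N' ≤ n + k → γ n = γ' n := by
    intro k
    induction k with
    | zero => intro n hn; rw [hN n (by lia), hN' n (by lia)]
    | succ k ih =>
      intro n hn
      ext q w
      obtain ⟨l, hl⟩ := h.2 w
      obtain ⟨l', hl'⟩ := h'.2 w
      -- The first exponent is large enough for both relations, and the second is adjusted so that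
      -- the leading term is exactly the mode q.
      have e := (hl n (max l l') (q - max l l') (by lia)).symm.trans
        (hl' n (max l l') (q - max l l') (by lia))
      have aux : prodC γ w n (max l l') (q - max l l') - (γ n).1 q w =
          prodC γ' w n (max l l') (q - max l l') - (γ' n).1 q w := by
        unfold prodC
        rw [expandMid_eq_sum ((max N N' - n).toNat + 1) (fun i hi => by
            rw [hN _ (by lia)]; rfl),
          expandMid_eq_sum ((max N N' - n).toNat + 1) (fun i hi => by
            rw [hN' _ (by lia)]; rfl), Finset.sum_range_succ', Finset.sum_range_succ']
        simp only [Ring.choose_zero_right, one_smul, Nat.cast_zero, add_zero, sub_zero,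
          add_sub_cancel, add_sub_cancel_right]
        refine Finset.sum_congr rfl fun i _ => ?_
        rw [ih (n + ((i + 1 : ℕ) : ℤ)) (by push_cast at *; lia)]
      rw [e] at aux
      exact sub_right_injective aux
  funext n
  exact key (max N N' - n).toNat n (by lia)

theorem IsProduct.add {φ' : Fld V} (h : IsProduct α φ γ) (h' : IsProduct α φ' γ') :
    IsProduct α (φ + φ') fun n => γ n + γ' n := by
  refine ⟨h.1.add h'.1, fun w => ?_⟩
  obtain ⟨l, hl⟩ := h.2 w
  obtain ⟨l', hl'⟩ := h'.2 w
  exact ⟨max l l', fun n p q hp => by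
    rw [prodA_add_right, prodC_add h.1 h'.1, hl n p q (by lia), hl' n p q (by lia)]⟩

theorem IsProduct.add_left {α' : Fld V} (h : IsProduct α φ γ) (h' : IsProduct α' φ γ') :
    IsProduct (α + α') φ fun n => γ n + γ' n := by
  refine ⟨h.1.add h'.1, fun w => ?_⟩
  obtain ⟨l, hl⟩ := h.2 w
  obtain ⟨l', hl'⟩ := h'.2 w
  exact ⟨max l l', fun n p q hp => by
    rw [prodA_add_left, prodC_add h.1 h'.1, hl n p q (by lia), hl' n p q (by lia)]⟩

theorem IsProduct.smul (h : IsProduct α φ γ) (c : ℂ) : IsProduct α (c • φ) fun n => c • γ n := by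
  refine ⟨h.1.smul c, fun w => ?_⟩
  obtain ⟨l, hl⟩ := h.2 w
  exact ⟨l, fun n p q hp => by rw [prodA_smul_right, prodC_smul h.1, hl n p q hp]⟩

theorem IsProduct.smul_left (h : IsProduct α φ γ) (c : ℂ) :
    IsProduct (c • α) φ fun n => c • γ n := by
  refine ⟨h.1.smul c, fun w => ?_⟩
  obtain ⟨l, hl⟩ := h.2 w
  exact ⟨l, fun n p q hp => by rw [prodA_smul_left, prodC_smul h.1, hl n p q hp]⟩

/-! ### Left multiplication by the derivatives of a field -/

/-- Vanishing of a sequence of vectors at all large indices. -/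
def EvZero (S : ℤ → V) : Prop := ∃ N : ℤ, ∀ q, N ≤ q → S q = 0

theorem EvZero.bddRight {S : ℤ → V} (h : EvZero S) (η : Fld V) :
    BddRight fun r q => η.1 r (S q) := by
  obtain ⟨N, hN⟩ := h
  exact ⟨N, fun r q hq => by simp only [hN q hq, map_zero]⟩

/-- The coefficients of the product of `Res_z (z - x)^(-m) η(z)` with the series `S(x)`. -/
def seqAct (η : Fld V) (m : ℤ) (S : ℤ → V) (q : ℤ) : V :=
  expand (fun r q => η.1 r (S q)) (-m) 0 q

theorem lmul_eq_seqAct (η φ : Fld V) (m q : ℤ) (w : V) :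
    (lmul (-m) 0 η φ).1 q w = seqAct η m (fun q => φ.1 q w) q := rfl

section SeqAct

variable (η : Fld V) (m : ℤ) {S S' : ℤ → V}

theorem seqAct_eq_sum {q : ℤ} (k : ℕ) (h : ∀ i : ℕ, k ≤ i → S (q + i) = 0) :
    seqAct η m S q = ∑ i ∈ Finset.range k, signedChoose (-m) i • η.1 (-m - i) (S (q + i)) := by
  unfold seqAct
  rw [expand_eq_sum k (fun i hi => by rw [h i hi, map_zero])]
  simp only [zero_add]

theorem seqAct_eq_zero {N : ℤ} (h : ∀ q, N ≤ q → S q = 0) {q : ℤ} (hq : N ≤ q) :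
    seqAct η m S q = 0 := by
  rw [seqAct_eq_sum η m 0 (fun i _ => h _ (by lia))]; simp

theorem seqAct_add (h : EvZero S) (h' : EvZero S') (q : ℤ) :
    seqAct η m (fun q => S q + S' q) q = seqAct η m S q + seqAct η m S' q := by
  unfold seqAct
  rw [← expand_add (h.bddRight η) (h'.bddRight η)]
  simp only [map_add]

theorem EvZero.smul (h : EvZero S) (c : ℂ) : EvZero fun q => c • S q := by
  obtain ⟨N, hN⟩ := h
  exact ⟨N, fun q hq => by simp only [hN q hq, smul_zero]⟩

theorem EvZero.add (h : EvZero S) (h' : EvZero S') : EvZero fun q => S q + S' q := by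
  obtain ⟨N, hN⟩ := h
  obtain ⟨N', hN'⟩ := h'
  exact ⟨max N N', fun n hn => by simp only [hN n (by lia), hN' n (by lia), add_zero]⟩

theorem EvZero.comp_add (h : EvZero S) (j : ℤ) : EvZero fun q => S (q + j) := by
  obtain ⟨N, hN⟩ := h
  exact ⟨N - j, fun q hq => hN _ (by lia)⟩

theorem seqAct_smul (h : EvZero S) (c : ℂ) (q : ℤ) :
    seqAct η m (fun q => c • S q) q = c • seqAct η m S q := by
  have := map_expand (h.bddRight η) (LinearMap.lsmul ℂ V c) (-m) 0 q
  unfold seqAct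
  simp only [map_smul]
  exact this.symm

theorem seqAct_sub (h : EvZero S) (h' : EvZero S') (q : ℤ) :
    seqAct η m (fun q => S q - S' q) q = seqAct η m S q - seqAct η m S' q := by
  have e : (fun q => S q - S' q) = fun q => S q + (-1 : ℂ) • S' q := by
    funext q; rw [neg_one_smul, sub_eq_add_neg]
  rw [e, seqAct_add η m h (h'.smul _), seqAct_smul η m h', neg_one_smul, sub_eq_add_neg]

theorem seqAct_comp_add (S : ℤ → V) (j q : ℤ) :
    seqAct η m (fun q => S (q + j)) q = seqAct η m S (q + j) := by
  have := expand_shift (fun r q => η.1 r (S q)) 0 j (-m) 0 q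
  simp only [add_zero] at this
  exact this

theorem isPascal_seqAct_right {T : ℤ → ℤ → ℤ → V} (hT : IsPascal T)
    (hb : ∀ n p, EvZero (T n p)) : IsPascal fun n p q => seqAct η m (T n p) q := by
  intro n p q
  beta_reduce
  rw [← seqAct_comp_add, ← seqAct_sub η m (hb _ _) ((hb _ _).comp_add 1)]
  congr 1
  funext q
  exact hT n p q

theorem isPascal_seqAct_middle {T : ℤ → ℤ → ℤ → V} (hT : IsPascal T)
    (hb : ∀ n q, EvZero fun p => T n p q) :
    IsPascal fun n p q => seqAct η m (fun p => T n p q) p := by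
  intro n p q
  beta_reduce
  rw [← seqAct_comp_add η m (fun p => T n p q), ← seqAct_sub η m ((hb n q).comp_add 1) (hb _ _)]
  congr 1
  funext p
  exact hT n p q

end SeqAct

theorem evZero_prodA (α φ : Fld V) (w : V) (n p : ℤ) : EvZero (prodA α φ w n p) :=
  (prodA_bdd α φ w).imp fun _ hN q hq => hN n p q hq

theorem evZero_prodA_left (α φ : Fld V) (w : V) (n q : ℤ) : EvZero fun p => prodA α φ w n p q :=
  prodA_eq_zero_of_left α φ w n q

theorem evZero_prodB (φ α : Fld V) (w : V) (n p : ℤ) : EvZero (prodB φ α w n p) :=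
  prodB_eq_zero_of_right α φ w n p

theorem evZero_prodB_left (φ α : Fld V) (w : V) (n q : ℤ) : EvZero fun p => prodB φ α w n p q :=
  (prodB_bdd α φ w).imp fun _ hN p hp => hN n p q hp

theorem evZero_prodC (h : SeqTrunc γ) (w : V) (n p : ℤ) : EvZero (prodC γ w n p) := by
  obtain ⟨N, hN⟩ := prodC_eq_zero h w n
  exact ⟨N - p, fun q hq => hN p q (by lia)⟩

theorem evZero_prodC_left (h : SeqTrunc γ) (w : V) (n q : ℤ) :
    EvZero fun p => prodC γ w n p q := by
  obtain ⟨N, hN⟩ := prodC_eq_zero h w n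
  exact ⟨N - q, fun p hq => hN p q (by lia)⟩

/-- The relation `[η(r), α(x)] = ∑ᵢ C(r,i) x^(r-i) αᵢ(x)` for the negative modes of `η`. -/
def CommNeg (η α : Fld V) (N : ℕ) (αs : ℕ → Fld V) : Prop :=
  ∀ r : ℤ, r < 0 → lcomp (η.1 r) α - rcomp (η.1 r) α =
    ∑ i ∈ Finset.range N, Ring.choose r i • shift (r - i) (αs i)

theorem CommNeg.apply {η : Fld V} {N : ℕ} {αs : ℕ → Fld V} (h : CommNeg η α N αs) {r : ℤ}
    (hr : r < 0) (q : ℤ) (w : V) : η.1 r (α.1 q w) - α.1 q (η.1 r w) =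
      ∑ i ∈ Finset.range N, Ring.choose r i • (αs i).1 (q + (r - i)) w := by
  have := congrArg (fun ξ : Fld V => ξ.1 q w) (h r hr)
  simpa using this

theorem signedChoose_mul_choose (m : ℤ) (i j : ℕ) :
    signedChoose m i * Ring.choose (m - i) j = Ring.choose m j * signedChoose (m - j) i := by
  unfold signedChoose
  rw [mul_assoc, choose_mul_choose_sub_comm]; ring

variable {η : Fld V} {N : ℕ} {αs : ℕ → Fld V} {m : ℤ}

/-- Moving the modes of η to the left past α produces corrections with the factor (x₁ - x₂)^(-m-j).
It suffices to compare at n = 0, where the commutators resum by `signedChoose_mul_choose`. Since m >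
0, only negative modes of η occur, which is all that `CommNeg` controls. -/
theorem CommNeg.prodA_lmul (h : CommNeg η α N αs) (hm : 0 < m) (φ : Fld V) (w : V)
    (n p q : ℤ) : prodA α (lmul (-m) 0 η φ) w n p q = seqAct η m (prodA α φ w n p) q -
      ∑ j ∈ Finset.range N, Ring.choose (-m) j • prodA (αs j) φ w (n - m - j) p q := by
  refine IsPascal.eq_of_right (isPascal_prodA _ _ _)
    (S := fun n p q => seqAct η m (prodA α φ w n p) q -
      ∑ j ∈ Finset.range N, Ring.choose (-m) j • prodA (αs j) φ w (n - m - j) p q)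
    ((isPascal_seqAct_right η m (isPascal_prodA α φ w) (evZero_prodA α φ w)).sub
      (IsPascal.sum _ fun j _ => ?_)) (fun p q => ?_) (prodA_bdd _ _ _) ?_ n p q
  · have := ((isPascal_prodA (αs j) φ w).shift (-m - j) 0 0).map
      (DistribSMul.toAddMonoidHom V (Ring.choose (-m) j))
    simp only [add_zero, ← add_sub_assoc, ← sub_eq_add_neg] at this
    exact this
  · obtain ⟨k, hk⟩ : ∃ k : ℕ, ∀ i : ℕ, k ≤ i → φ.1 (q + i) w = 0 := by
      obtain ⟨N, hN⟩ := φ.2 w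
      exact ⟨(N - q).toNat, fun i hi => hN _ (by lia)⟩
    rw [prodA_zero, lmul_eq_seqAct, seqAct_eq_sum η m k hk,
      seqAct_eq_sum η m k (fun i hi => by rw [prodA_zero, hk i hi, map_zero]), map_sum]
    have e : ∀ j ∈ Finset.range N, Ring.choose (-m) j • prodA (αs j) φ w (0 - m - j) p q =
        ∑ i ∈ Finset.range k, signedChoose (-m) i • Ring.choose (-m - i) j •
          (αs j).1 (p + (-m - i - j)) (φ.1 (q + i) w) := by
      intro j _
      unfold prodA
      rw [expand_eq_sum k (fun i hi => by rw [hk i hi, map_zero]), Finset.smul_sum]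
      refine Finset.sum_congr rfl fun i _ => ?_
      rw [smul_smul, smul_smul, signedChoose_mul_choose, zero_sub,
        show p + (-m - (j : ℤ)) - i = p + (-m - i - j) by ring]
    rw [Finset.sum_congr rfl e, Finset.sum_comm, ← Finset.sum_sub_distrib]
    refine Finset.sum_congr rfl fun i _ => ?_
    rw [map_zsmul, prodA_zero, ← Finset.smul_sum, ← smul_sub, ← h.apply (by lia), sub_sub_cancel]
  · obtain ⟨N1, h1⟩ := prodA_bdd α φ w
    choose N2 h2 using fun j => prodA_bdd (αs j) φ w
    refine ⟨max N1 (∑ j ∈ Finset.range N, |N2 j|), fun n p q hq => ?_⟩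
    rw [seqAct_eq_zero η m (fun q hq => h1 n p q hq) (by lia : N1 ≤ q), Finset.sum_eq_zero,
      sub_zero]
    intro j hj
    have h3 : |N2 j| ≤ ∑ j ∈ Finset.range N, |N2 j| :=
      Finset.single_le_sum (f := fun i : ℕ => |N2 i|) (fun _ _ => abs_nonneg _) hj
    have h4 := le_abs_self (N2 j)
    rw [h2 j _ _ _ (by lia), smul_zero]

/-- No commutator appears, because η is already the leftmost factor. -/
theorem prodB_lmul_left (η β α : Fld V) (m : ℤ) (w : V) (n p q : ℤ) :
    prodB (lmul (-m) 0 η β) α w n p q = seqAct η m (prodB β α w n p) q := by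
  refine IsPascal.eq_of_left (isPascal_prodB _ _ _)
    (isPascal_seqAct_right η m (isPascal_prodB α β w) (evZero_prodB β α w))
    (fun p q => ?_) (prodB_bdd _ _ _) ?_ n p q
  · simp only [prodB_zero]
    rw [lmul_eq_seqAct]
    congr 1
    funext q
    simp
  · obtain ⟨N, hN⟩ := prodB_bdd α β w
    refine ⟨N, fun n p q hp => ?_⟩
    rw [seqAct_eq_sum η m 0 (fun i _ => hN _ _ _ hp)]
    simp

theorem prodC_lmul (h : SeqTrunc γ) (η : Fld V) (m : ℤ) (w : V) (n p q : ℤ) :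
    prodC (fun n => lmul (-m) 0 η (γ n)) w n p q = seqAct η m (prodC γ w n p) q := by
  have h' := h.map (lmul (-m) 0 η)
  refine IsPascal.eq_of_middle (isPascal_prodC h' w)
    (isPascal_seqAct_right η m (isPascal_prodC h w) (evZero_prodC h w))
    (fun n q => ?_) (prodC_bdd h' w) ?_ n p q
  · rw [prodC_zero, lmul_eq_seqAct]
    congr 1
    funext q
    simp
  · obtain ⟨N, hN⟩ := prodC_bdd h w
    refine ⟨N, fun n p q hp => ?_⟩
    rw [seqAct_eq_sum η m 0 (fun i _ => hN _ _ _ hp)]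
    simp

end Fld
end SemidirectVertex
end

noncomputable section
namespace SemidirectVertex

open Fld

/-! ### Products with fields that act by left multiplication -/

namespace Fld

variable {V : Type*} [AddCommGroup V] [Module ℂ V] {α φ : Fld V} {γ γ' : ℤ → Fld V}

theorem SeqTrunc.sub (h : SeqTrunc γ) (h' : SeqTrunc γ') : SeqTrunc fun n => γ n - γ' n := by
  obtain ⟨N, hN⟩ := h
  obtain ⟨N', hN'⟩ := h'
  exact ⟨max N N', fun n hn => by simp only [hN n (by lia), hN' n (by lia), sub_zero]⟩

theorem prodC_sub (h : SeqTrunc γ) (h' : SeqTrunc γ') (w : V) (n p q : ℤ) :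
    prodC (fun n => γ n - γ' n) w n p q = prodC γ w n p q - prodC γ' w n p q := by
  have e : (fun n => γ n - γ' n) = fun n => γ n + (-1 : ℂ) • γ' n := by
    funext n; rw [neg_one_smul, sub_eq_add_neg]
  rw [e, prodC_add h (h'.smul _), prodC_smul h', neg_one_smul, sub_eq_add_neg]

/-- Weak associativity passes through a half current: the product and the iterate acquire the same
correction (x₁ - x₂)^(-m) α'(x₁)φ(x₂), which in terms of products is a shift of γ' by m. -/
theorem IsProduct.lmul {η α' : Fld V} {m : ℤ} (hη : CommNeg η α 1 fun _ => α') (hm : 0 < m)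
    (h : IsProduct α φ γ) (h' : IsProduct α' φ γ') :
    IsProduct α (lmul (-m) 0 η φ) fun n => Fld.lmul (-m) 0 η (γ n) - γ' (n - m) := by
  have h1 := h.1.map (Fld.lmul (-m) 0 η)
  have h2 : SeqTrunc fun n => γ' (n - m) := h'.1.comp_add (-m)
  refine ⟨h1.sub h2, fun w => ?_⟩
  obtain ⟨l, hl⟩ := h.2 w
  obtain ⟨l', hl'⟩ := h'.2 w
  refine ⟨max l l', fun n p q hp => ?_⟩
  have h3 : prodC (fun n => γ' (n - m)) w n p q = prodC γ' w (n - m) p q :=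
    prodC_comp_add γ' (-m) w n p q
  have h4 : prodA α φ w n p = prodC γ w n p := funext fun q => hl n p q (by lia)
  rw [prodC_sub h1 h2, prodC_lmul h.1, h3, hη.prodA_lmul hm, h4]
  simp only [Finset.range_one, Finset.sum_singleton, Ring.choose_zero_right, one_smul,
    Nat.cast_zero, sub_zero]
  rw [hl' _ p q (by lia)]

theorem sum_signedChoose_mul (m m' : ℤ) (k : ℕ) :
    ∑ i ∈ Finset.range (k + 1), signedChoose m i * signedChoose m' (k - i) =
      signedChoose (m + m') k := by
  have h := Ring.add_choose_eq k (Commute.all m m')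
  rw [Finset.Nat.sum_antidiagonal_eq_sum_range_succ
    (f := fun i j => Ring.choose m i * Ring.choose m' j)] at h
  unfold signedChoose
  rw [h, Finset.mul_sum]
  refine Finset.sum_congr rfl fun i hi => ?_
  have : k = i + (k - i) := by have := Finset.mem_range.1 hi; lia
  rw [show (-1 : ℤ) ^ k = (-1) ^ i * (-1) ^ (k - i) by rw [← pow_add, ← this]]
  ring

theorem lmul_lmul_eq_sum (η ξ : Fld V) (m m' q : ℤ) (w : V) (k : ℕ)
    (hk : ∀ i : ℕ, k ≤ i → φ.1 (q + i) w = 0) :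
    (Fld.lmul m 0 η (Fld.lmul m' 0 ξ φ)).1 q w = ∑ j ∈ Finset.range k,
      ∑ i ∈ Finset.range (j + 1), (signedChoose m i * signedChoose m' (j - i)) •
        η.1 (m - i) (ξ.1 (m' - (j - i : ℕ)) (φ.1 (q + j) w)) := by
  have hξ : ∀ i : ℕ, (Fld.lmul m' 0 ξ φ).1 (q + i) w = ∑ j ∈ Finset.range (k - i),
      signedChoose m' j • ξ.1 (m' - j) (φ.1 (q + i + j) w) := by
    intro i
    rw [lmul_apply]
    unfold prodA
    rw [expand_eq_sum (k - i) (fun j hj => by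
      rw [add_assoc, ← Nat.cast_add, hk _ (by lia), map_zero])]
    simp only [zero_add]
  rw [Finset.sum_congr rfl fun j hj => Finset.sum_congr rfl fun i hi => by
    rw [show q + (j : ℤ) = q + i + (j - i : ℕ) by have := Finset.mem_range.1 hi; lia],
    Finset.sum_range_diag_flip k (fun i j => (signedChoose m i * signedChoose m' j) •
        η.1 (m - i) (ξ.1 (m' - j) (φ.1 (q + i + j) w))), lmul_apply]
  unfold prodA
  rw [expand_eq_sum k (fun i hi => by rw [hξ, show k - i = 0 by lia]; simp)]
  refine Finset.sum_congr rfl fun i _ => ?_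
  rw [hξ, map_sum, Finset.smul_sum, zero_add]
  refine Finset.sum_congr rfl fun j _ => ?_
  rw [map_zsmul, smul_smul]

/-- Collecting terms by the total shift j of the mode of φ, each commutator is the same mode m + m'
- j of ζ, and the coefficients add up by Vandermonde's identity. Negativity of m and m' keeps all
modes in the range of the hypothesis. -/
theorem lmul_lmul_sub_comm {η ξ ζ : Fld V}
    (h : ∀ m n : ℤ, m < 0 → n < 0 → ∀ w, η.1 m (ξ.1 n w) - ξ.1 n (η.1 m w) = ζ.1 (m + n) w)
    {m m' : ℤ} (hm : m < 0) (hm' : m' < 0) (φ : Fld V) :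
    Fld.lmul m 0 η (Fld.lmul m' 0 ξ φ) - Fld.lmul m' 0 ξ (Fld.lmul m 0 η φ) =
      Fld.lmul (m + m') 0 ζ φ := by
  ext q w
  obtain ⟨k, hk⟩ : ∃ k : ℕ, ∀ i : ℕ, k ≤ i → φ.1 (q + i) w = 0 := by
    obtain ⟨N, hN⟩ := φ.2 w
    exact ⟨(N - q).toNat, fun i hi => hN _ (by lia)⟩
  rw [sub_apply, lmul_lmul_eq_sum η ξ m m' q w k hk, lmul_lmul_eq_sum ξ η m' m q w k hk,
    ← Finset.sum_sub_distrib, lmul_apply]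
  unfold prodA
  rw [expand_eq_sum k (fun i hi => by rw [hk i hi, map_zero])]
  refine Finset.sum_congr rfl fun j _ => ?_
  -- Reversing the second sum pairs the same two modes in opposite orders.
  rw [← Finset.sum_range_reflect (fun i => (signedChoose m' i * signedChoose m (j - i)) •
    ξ.1 (m' - i) (η.1 (m - (j - i : ℕ)) (φ.1 (q + j) w))), ← Finset.sum_sub_distrib,
    ← sum_signedChoose_mul, Finset.sum_smul]
  refine Finset.sum_congr rfl fun i hi => ?_
  have hi' := Finset.mem_range.1 hi
  rw [show j + 1 - 1 - i = j - i by lia, show j - (j - i) = i by lia, mul_comm (signedChoose m' _),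
    ← smul_sub, h _ _ (by lia) (by lia), zero_add,
    show m - (i : ℤ) + (m' - (j - i : ℕ)) = m + m' - j by lia]

end Fld

/-! ### Fields generated by currents -/

variable {E : Type*} [LieRing E] [LieAlgebra ℂ E]

/-- Currents of an ideal `K`, and the negative halves of currents of a subalgebra `g`, as fields. -/
structure CurrentFields (K : LieIdeal ℂ E) (g : LieSubalgebra ℂ E) (V : Type*) [AddCommGroup V]
    [Module ℂ V] where
  /-- The fields of elements of the ideal. -/
  kfld : K →ₗ[ℂ] Fld V
  /-- The fields of elements of the subalgebra. -/
  gfld : g →ₗ[ℂ] Fld V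
  /-- The bilinear form. -/
  form : K → K → ℂ
  form_lie_left : ∀ (a : g) (u v : K), form ⁅(a : E), u⁆ v = 0
  form_lie_right : ∀ (a : g) (u v : K), form u ⁅(a : E), v⁆ = 0
  kfld_kfld : ∀ (u v : K) (m n : ℤ) (w : V),
    (kfld u).1 m ((kfld v).1 n w) - (kfld v).1 n ((kfld u).1 m w) =
      (kfld ⁅(u : E), v⁆).1 (m + n) w + (if m + n = 0 then (m : ℂ) * form u v else 0) • w
  gfld_kfld : ∀ (a : g) (u : K) (m n : ℤ) (w : V), m < 0 →
    (gfld a).1 m ((kfld u).1 n w) - (kfld u).1 n ((gfld a).1 m w) =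
      (kfld ⁅(a : E), u⁆).1 (m + n) w
  gfld_gfld : ∀ (a b : g) (m n : ℤ) (w : V), m < 0 → n < 0 →
    (gfld a).1 m ((gfld b).1 n w) - (gfld b).1 n ((gfld a).1 m w) = (gfld ⁅a, b⁆).1 (m + n) w
  gfld_nonneg : ∀ (a : g) (n : ℤ) (w : V), 0 ≤ n → (gfld a).1 n w = 0

namespace CurrentFields

variable {K : LieIdeal ℂ E} {g : LieSubalgebra ℂ E} {V : Type*} [AddCommGroup V] [Module ℂ V]
  (C : CurrentFields K g V)

/-- The central term r δ_{r+n,0} is the coefficient C(r,1) of x^(r-1) times the identity field, so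
two terms suffice. -/
theorem commModes_kfld (u v : K) : CommModes (C.kfld u) (C.kfld v) 2
    fun i => if i = 0 then C.kfld ⁅(u : E), v⁆ else C.form u v • one := by
  intro r
  ext n w
  simp only [Fld.sub_apply, lcomp_apply, rcomp_apply, C.kfld_kfld, Finset.sum_range_succ,
    Finset.range_zero, Finset.sum_empty, zero_add, Ring.choose_zero_right, one_smul,
    Ring.choose_one_right, Fld.add_apply, zsmul_apply, shift_apply, if_true, one_ne_zero, if_false,
    Fld.smul_apply, one_apply, Nat.cast_zero, Nat.cast_one, sub_zero]
  congr 1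
  · rw [add_comm r n]
  by_cases h : r + n = 0
  · rw [if_pos h, if_pos (by lia), mul_smul]
    exact Int.cast_smul_eq_zsmul ℂ r _
  · rw [if_neg h, if_neg (by lia)]; simp

theorem commNeg_kfld (a : g) (u : K) :
    CommNeg (C.gfld a) (C.kfld u) 1 fun _ => C.kfld ⁅(a : E), u⁆ := by
  intro r hr
  ext n w
  simp [C.gfld_kfld a u r n w hr, add_comm n r]

/-- A field obtained from the identity by the products with currents of the ideal. -/
inductive IsIdealField : Fld V → Prop
  | one : IsIdealField one
  | add {φ ψ : Fld V} : IsIdealField φ → IsIdealField ψ → IsIdealField (φ + ψ)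
  | smul (c : ℂ) {φ : Fld V} : IsIdealField φ → IsIdealField (c • φ)
  | res (u : K) (n : ℤ) {φ : Fld V} : IsIdealField φ → IsIdealField (res n 0 (C.kfld u) φ)

theorem res_res (u v : K) (φ : Fld V) (m n p : ℤ) :
    Fld.res m 0 (C.kfld u) (Fld.res n p (C.kfld v) φ) -
        Fld.res n p (C.kfld v) (Fld.res m 0 (C.kfld u) φ) =
      Fld.res (m + n) p (C.kfld ⁅(u : E), v⁆) φ +
        ((m : ℂ) * C.form u v) • Fld.res (m + n - 1) p one φ := by
  rw [(C.commModes_kfld u v).res_res]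
  simp only [Finset.sum_range_succ, Finset.range_zero, Finset.sum_empty, zero_add,
    Ring.choose_zero_right, one_smul, Ring.choose_one_right, if_true, one_ne_zero, if_false,
    Nat.cast_zero, Nat.cast_one, sub_zero, add_comm n m, map_smul, LinearMap.smul_apply]
  rw [mul_smul, Int.cast_smul_eq_zsmul ℂ m]

variable {C} in
-- This replaces Dong's lemma: in the commutator formula every term other than the product of u with
-- the new field vanishes for large index. All weights p are carried because `IsLocal` asks for
-- them.
theorem IsIdealField.isLocal {φ : Fld V} (h : C.IsIdealField φ) (u : K) :
    IsLocal (C.kfld u) φ := by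
  induction h generalizing u with
  | one => exact ⟨0, fun n p hn => res_one_right n p hn⟩
  | add _ _ ih ih' =>
    obtain ⟨N, hN⟩ := ih u
    obtain ⟨N', hN'⟩ := ih' u
    exact ⟨max N N', fun n p hn => by
      rw [map_add, hN n p (by lia), hN' n p (by lia), add_zero]⟩
  | smul c _ ih =>
    obtain ⟨N, hN⟩ := ih u
    exact ⟨N, fun n p hn => by rw [map_smul, hN n p hn, smul_zero]⟩
  | res v n _ ih =>
    obtain ⟨N, hN⟩ := ih u
    obtain ⟨N', hN'⟩ := ih ⁅(v : E), u⁆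
    refine ⟨max N (max (N' - n) (1 - n)), fun m p hm => ?_⟩
    have := C.res_res v u ‹_› n m p
    rwa [hN m p (by lia), map_zero, hN' _ p (by lia), res_one _ p (by lia), zero_sub,
      smul_zero, add_zero, neg_eq_zero] at this

/-- A field obtained from the identity by the products with currents: those of the ideal act first,
then the negative products with those of the subalgebra. -/
inductive IsCurrentField : Fld V → Prop
  | ofIdeal {φ : Fld V} : C.IsIdealField φ → IsCurrentField φ
  | add {φ ψ : Fld V} : IsCurrentField φ → IsCurrentField ψ → IsCurrentField (φ + ψ)
  | smul (c : ℂ) {φ : Fld V} : IsCurrentField φ → IsCurrentField (c • φ)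
  | act (a : g) (m : ℤ) (hm : 0 < m) {φ : Fld V} : IsCurrentField φ →
      IsCurrentField (lmul (-m) 0 (C.gfld a) φ)

/-- The space of fields generated from the identity by the products with currents. -/
def fieldSpace : Submodule ℂ (Fld V) where
  carrier := {φ | C.IsCurrentField φ}
  add_mem' := .add
  zero_mem' := by
    have := (IsCurrentField.ofIdeal (C := C) .one).smul 0
    rwa [zero_smul] at this
  smul_mem' c _ := .smul c

theorem mem_fieldSpace {φ : Fld V} : φ ∈ C.fieldSpace ↔ C.IsCurrentField φ := Iff.rfl

/-- Locality is available only at the base of the induction. A half current of `a` costs a product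
with ⁅a, u⁆, which lies in K again, so the induction runs over all u at once. -/
theorem exists_isProduct {φ : Fld V} (h : φ ∈ C.fieldSpace) (u : K) :
    ∃ γ, IsProduct (C.kfld u) φ γ ∧ ∀ n, γ n ∈ C.fieldSpace := by
  change C.IsCurrentField φ at h
  induction h generalizing u with
  | ofIdeal h => exact ⟨_, (h.isLocal u).isProduct, fun n => .ofIdeal (h.res u n)⟩
  | add _ _ ih ih' =>
    obtain ⟨γ, h, hγ⟩ := ih u
    obtain ⟨γ', h', hγ'⟩ := ih' u
    exact ⟨_, h.add h', fun n => add_mem (hγ n) (hγ' n)⟩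
  | smul c _ ih =>
    obtain ⟨γ, h, hγ⟩ := ih u
    exact ⟨_, h.smul c, fun n => Submodule.smul_mem _ c (hγ n)⟩
  | act a m hm _ ih =>
    obtain ⟨γ, h, hγ⟩ := ih u
    obtain ⟨γ', h', hγ'⟩ := ih ⁅(a : E), u⁆
    exact ⟨_, h.lmul (C.commNeg_kfld a u) hm h',
      fun n => sub_mem (IsCurrentField.act a m hm (hγ n)) (hγ' _)⟩

/-- The `n`-th product of the current of an element of the ideal with a field. -/
def kprod (n : ℤ) : K →ₗ[ℂ] C.fieldSpace →ₗ[ℂ] C.fieldSpace :=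
  LinearMap.mk₂ ℂ
    (fun u φ => ⟨(C.exists_isProduct φ.2 u).choose n, (C.exists_isProduct φ.2 u).choose_spec.2 n⟩)
    -- Bilinearity of the chosen products follows from their uniqueness.
    (fun u u' φ => Subtype.ext (congrFun
      ((C.exists_isProduct φ.2 (u + u')).choose_spec.1.eq (map_add C.kfld u u' ▸
        (C.exists_isProduct φ.2 u).choose_spec.1.add_left
          (C.exists_isProduct φ.2 u').choose_spec.1)) n))
    (fun c u φ => Subtype.ext (congrFun
      ((C.exists_isProduct φ.2 (c • u)).choose_spec.1.eq (map_smul C.kfld c u ▸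
        (C.exists_isProduct φ.2 u).choose_spec.1.smul_left c)) n))
    (fun u φ φ' => Subtype.ext (congrFun
      ((C.exists_isProduct (φ + φ').2 u).choose_spec.1.eq
        ((C.exists_isProduct φ.2 u).choose_spec.1.add
          (C.exists_isProduct φ'.2 u).choose_spec.1)) n))
    (fun c u φ => Subtype.ext (congrFun
      ((C.exists_isProduct (c • φ).2 u).choose_spec.1.eq
        ((C.exists_isProduct φ.2 u).choose_spec.1.smul c)) n))

theorem isProduct_kprod (u : K) (φ : C.fieldSpace) :
    IsProduct (C.kfld u) φ fun n => (C.kprod n u φ : Fld V) :=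
  (C.exists_isProduct φ.2 u).choose_spec.1

theorem kprod_eq {u : K} {φ : C.fieldSpace} {γ : ℤ → Fld V} (h : IsProduct (C.kfld u) φ γ)
    (n : ℤ) : (C.kprod n u φ : Fld V) = γ n :=
  congrFun ((C.isProduct_kprod u φ).eq h) n

/-- The `n`-th product of the current of an element of the subalgebra with a field, for `n < 0`. -/
def gprod (n : ℤ) : g →ₗ[ℂ] C.fieldSpace →ₗ[ℂ] C.fieldSpace :=
  if hn : n < 0 then
    LinearMap.mk₂ ℂ
      (fun a φ => ⟨lmul n 0 (C.gfld a) φ, by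
        have := IsCurrentField.act a (-n) (by lia) φ.2
        rwa [neg_neg] at this⟩)
      (fun a b φ => Subtype.ext (by simp))
      (fun c a φ => Subtype.ext (by simp))
      (fun a φ φ' => Subtype.ext (by simp))
      (fun c a φ => Subtype.ext (by simp))
  else 0

theorem coe_gprod {n : ℤ} (hn : n < 0) (a : g) (φ : C.fieldSpace) :
    (C.gprod n a φ : Fld V) = lmul n 0 (C.gfld a) φ := by
  rw [gprod, dif_pos hn]; rfl

theorem gprod_gprod (a b : g) {m n : ℤ} (hm : m < 0) (hn : n < 0) (φ : C.fieldSpace) :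
    C.gprod m a (C.gprod n b φ) - C.gprod n b (C.gprod m a φ) = C.gprod (m + n) ⁅a, b⁆ φ := by
  ext1
  rw [Submodule.coe_sub, C.coe_gprod hm, C.coe_gprod hn, C.coe_gprod hn, C.coe_gprod hm,
    C.coe_gprod (by lia),
    lmul_lmul_sub_comm (fun m n hm hn w => C.gfld_gfld a b m n w hm hn) hm hn]

theorem kprod_gprod (a : g) (u : K) {m : ℤ} (hm : m < 0) (n : ℤ) (φ : C.fieldSpace) :
    C.kprod n u (C.gprod m a φ) =
      C.gprod m a (C.kprod n u φ) - C.kprod (m + n) ⁅(a : E), u⁆ φ := by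
  obtain ⟨m, rfl⟩ : ∃ m', m = -m' := ⟨-m, by lia⟩
  have := (C.isProduct_kprod u φ).lmul (C.commNeg_kfld a u) (by lia : 0 < m)
    (C.isProduct_kprod ⁅(a : E), u⁆ φ)
  rw [← C.coe_gprod hm] at this
  ext1
  rw [C.kprod_eq this, Submodule.coe_sub, C.coe_gprod hm, show n - m = -m + n by ring]

theorem kprod_of_isIdealField {φ : Fld V} (h : C.IsIdealField φ) (u : K) (n : ℤ) :
    (C.kprod n u ⟨φ, C.mem_fieldSpace.2 (.ofIdeal h)⟩ : Fld V) = res n 0 (C.kfld u) φ :=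
  C.kprod_eq (φ := ⟨φ, C.mem_fieldSpace.2 (.ofIdeal h)⟩) (h.isLocal u).isProduct n

/-- On fields generated by K this is the commutator formula, where the identity field contributes
the central term. A half current of `a` is moved out with `kprod_gprod`; the extra terms combine by
the Jacobi identity in E, and their central parts vanish since the form is zero on ⁅a, K⁆. -/
theorem kprod_kprod (u v : K) (m n : ℤ) (φ : C.fieldSpace) :
    C.kprod m u (C.kprod n v φ) - C.kprod n v (C.kprod m u φ) = C.kprod (m + n) ⁅(u : E), v⁆ φ +
      (if m + n = 0 then (m : ℂ) * C.form u v else 0) • φ := by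
  obtain ⟨φ, h⟩ := φ
  have h' := C.mem_fieldSpace.1 h
  induction h' generalizing u v m n with
  | ofIdeal hi =>
    have e : ∀ (v : K) (n : ℤ), C.kprod n v ⟨_, h⟩ =
        ⟨_, C.mem_fieldSpace.2 (.ofIdeal (hi.res v n))⟩ :=
      fun v n => Subtype.ext (C.kprod_of_isIdealField hi v n)
    ext1
    rw [e, e, e, Submodule.coe_sub, Submodule.coe_add, Submodule.coe_smul,
      C.kprod_of_isIdealField (hi.res v n), C.kprod_of_isIdealField (hi.res u m), C.res_res,
      res_one_zero]
    congr 1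
    by_cases hmn : m + n = 0
    · rw [if_pos (by lia), if_pos hmn]
    · rw [if_neg (by lia), if_neg hmn, smul_zero, zero_smul]
  | @add φ ψ hφ hψ ih ih' =>
    rw [← mem_fieldSpace] at hφ hψ
    have e : (⟨φ + ψ, h⟩ : C.fieldSpace) = ⟨φ, hφ⟩ + ⟨ψ, hψ⟩ := rfl
    rw [e]
    simp only [map_add, smul_add]
    rw [add_sub_add_comm, ih, ih', add_add_add_comm]
  | @smul c φ hφ ih =>
    rw [← mem_fieldSpace] at hφ
    have e : (⟨c • φ, h⟩ : C.fieldSpace) = c • ⟨φ, hφ⟩ := rfl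
    rw [e]
    simp only [map_smul]
    rw [← smul_sub, ih, smul_add, smul_comm c]
  | @act a k hk φ hφ ih =>
    rw [← mem_fieldSpace] at hφ
    have hk' : -k < 0 := by lia
    have e : (⟨_, h⟩ : C.fieldSpace) = C.gprod (-k) a ⟨φ, hφ⟩ :=
      Subtype.ext (C.coe_gprod hk' a ⟨φ, hφ⟩).symm
    have i0 := ih u v m n hφ
    have i1 := ih ⁅(a : E), u⁆ v (-k + m) n hφ
    have i2 := ih u ⁅(a : E), v⁆ m (-k + n) hφ
    have j0 := congrArg (C.gprod (-k) a) i0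
    have hl : ⁅((⁅(a : E), u⁆ : K) : E), v⁆ + ⁅(u : E), ⁅(a : E), v⁆⁆ = ⁅(a : E), ⁅(u : E), v⁆⁆ :=
      (leibniz_lie (a : E) (u : E) v).symm
    rw [C.form_lie_left, mul_zero, ite_self, zero_smul, add_zero] at i1
    rw [C.form_lie_right, mul_zero, ite_self, zero_smul, add_zero] at i2
    rw [e, ← sub_eq_zero]
    simp only [C.kprod_gprod a _ hk', map_sub, map_add, map_smul] at j0 ⊢
    rw [← hl, map_add, LinearMap.add_apply]
    rw [show -k + m + n = -k + (m + n) by ring] at i1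
    rw [show m + (-k + n) = -k + (m + n) by ring] at i2
    rw [← i1, ← i2]
    rw [sub_eq_iff_eq_add] at j0
    rw [j0]
    abel

end CurrentFields
end SemidirectVertex
end

noncomputable section
namespace SemidirectVertex

open Fld

/-! ### The universal property of induced modules -/

namespace InducedModule

attribute [local instance 100] LieRing.ofAssociativeRing

variable {L : Type*} [LieRing L] [LieAlgebra ℂ L] {H : LieSubalgebra ℂ L}
  {M : Type*} [AddCommGroup M] [Module ℂ M] {ρ : H →ₗ⁅ℂ⁆ Module.End ℂ M}

theorem act_add (x y : L) (z : InducedModule H ρ) : act H ρ (x + y) z = act H ρ x z + act H ρ y z := by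
  rw [act_apply, map_add, add_smul]; rfl

theorem act_smul (c : ℂ) (x : L) (z : InducedModule H ρ) : act H ρ (c • x) z = c • act H ρ x z := by
  rw [act_apply, map_smul, smul_assoc]; rfl

theorem act_lie (x y : L) (z : InducedModule H ρ) :
    act H ρ ⁅x, y⁆ z = act H ρ x (act H ρ y z) - act H ρ y (act H ρ x z) := by
  rw [act_apply, LieHom.map_lie, LieRing.of_associative_ring_bracket, sub_smul, mul_smul, mul_smul]
  rfl

theorem act_mk (h : H) (m : M) : act H ρ h (mk H ρ m) = mk H ρ (ρ h m) := by
  rw [act_apply]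
  unfold mk
  rw [← Submodule.Quotient.mk_smul, Submodule.Quotient.eq, TensorProduct.smul_tmul', smul_eq_mul,
    mul_one]
  exact Submodule.subset_span ⟨h, m, rfl⟩

/-- The elements of U(L) that preserve p form a subalgebra S containing L, hence all of U(L). -/
theorem eq_top_of_act_mem (p : Submodule ℂ (InducedModule H ρ)) (hmk : ∀ m, mk H ρ m ∈ p)
    (hact : ∀ y z, z ∈ p → act H ρ y z ∈ p) : p = ⊤ := by
  let S : Subalgebra ℂ (UniversalEnvelopingAlgebra ℂ L) :=
    { carrier := {x | ∀ z ∈ p, x • z ∈ p}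
      mul_mem' := fun {x y} hx hy z hz => by rw [mul_smul]; exact hx _ (hy z hz)
      add_mem' := fun {x y} hx hy z hz => by rw [add_smul]; exact add_mem (hx z hz) (hy z hz)
      algebraMap_mem' := fun c z hz => by rw [algebraMap_smul]; exact p.smul_mem c hz }
  let j : L →ₗ⁅ℂ⁆ S :=
    { toFun := fun y => ⟨UniversalEnvelopingAlgebra.ι ℂ y, hact y⟩
      map_add' := fun x y => Subtype.ext (map_add _ x y)
      map_smul' := fun c x => Subtype.ext (map_smul _ c x)
      map_lie' := fun {x y} => Subtype.ext (LieHom.map_lie _ x y) }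
  -- Both homomorphisms restrict to the canonical map on L, so the identity of U(L) factors through
  -- S.
  have hS : S.val.comp (UniversalEnvelopingAlgebra.lift ℂ j) =
      AlgHom.id ℂ (UniversalEnvelopingAlgebra ℂ L) := by
    ext x
    change S.val (UniversalEnvelopingAlgebra.lift ℂ j (UniversalEnvelopingAlgebra.ι ℂ x)) = _
    rw [UniversalEnvelopingAlgebra.lift_ι_apply]
    rfl
  have hS' : ∀ x, x ∈ S := fun x => by
    have := AlgHom.congr_fun hS x
    rw [AlgHom.id_apply] at this
    rw [← this]
    exact (UniversalEnvelopingAlgebra.lift ℂ j x).2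
  rw [Submodule.eq_top_iff']
  intro z
  obtain ⟨z, rfl⟩ := Submodule.Quotient.mk_surjective _ z
  induction z using TensorProduct.induction_on with
  | zero => exact p.zero_mem
  | add x y hx hy => rw [Submodule.Quotient.mk_add]; exact add_mem hx hy
  | tmul x m =>
    have := hS' x _ (hmk m)
    unfold mk at this
    rwa [← Submodule.Quotient.mk_smul, TensorProduct.smul_tmul', smul_eq_mul, mul_one] at this

variable {N : Type*} [AddCommGroup N] [Module ℂ N] (σ : L →ₗ⁅ℂ⁆ Module.End ℂ N) (f : M →ₗ[ℂ] N)

/-- The linear map `x ⊗ m ↦ x f(m)` that precedes `lift`. -/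
def preLift : UniversalEnvelopingAlgebra ℂ L ⊗[ℂ] M →ₗ[ℂ] N :=
  TensorProduct.lift ((LinearMap.lcomp ℂ N f).comp
    (UniversalEnvelopingAlgebra.lift ℂ σ).toLinearMap)

theorem preLift_tmul (x : UniversalEnvelopingAlgebra ℂ L) (m : M) :
    preLift σ f (x ⊗ₜ m) = UniversalEnvelopingAlgebra.lift ℂ σ x (f m) := rfl

theorem preLift_smul (x : UniversalEnvelopingAlgebra ℂ L)
    (z : UniversalEnvelopingAlgebra ℂ L ⊗[ℂ] M) :
    preLift σ f (x • z) = UniversalEnvelopingAlgebra.lift ℂ σ x (preLift σ f z) := by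
  induction z using TensorProduct.induction_on with
  | zero => rw [smul_zero, map_zero, map_zero]
  | add y z hy hz => rw [smul_add, map_add, map_add, map_add, hy, hz]
  | tmul y m =>
    rw [TensorProduct.smul_tmul', preLift_tmul, preLift_tmul, smul_eq_mul, map_mul]; rfl

variable {f}

theorem preLift_eq_zero (hf : ∀ (h : H) m, σ h (f m) = f (ρ h m))
    {z : UniversalEnvelopingAlgebra ℂ L ⊗[ℂ] M}
    (hz : z ∈ Submodule.span (UniversalEnvelopingAlgebra ℂ L)
      {z | ∃ (h : H) (m : M), z = (UniversalEnvelopingAlgebra.ι ℂ (h : L)) ⊗ₜ[ℂ] m -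
          (1 : UniversalEnvelopingAlgebra ℂ L) ⊗ₜ[ℂ] (ρ h m)}) : preLift σ f z = 0 := by
  induction hz using Submodule.span_induction with
  | mem z hz =>
    obtain ⟨h, m, rfl⟩ := hz
    rw [map_sub, preLift_tmul, preLift_tmul, map_one, UniversalEnvelopingAlgebra.lift_ι_apply, hf]
    exact sub_self _
  | zero => exact map_zero _
  | add x y _ _ hx hy => rw [map_add, hx, hy, add_zero]
  | smul a x _ hx => rw [preLift_smul, hx, map_zero]

variable (hf : ∀ (h : H) m, σ h (f m) = f (ρ h m))

/-- The linear map from an induced module given by a homomorphism of modules of the subalgebra. -/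
def lift : InducedModule H ρ →ₗ[ℂ] N :=
  ((Submodule.span (UniversalEnvelopingAlgebra ℂ L)
      {z | ∃ (h : H) (m : M), z = (UniversalEnvelopingAlgebra.ι ℂ (h : L)) ⊗ₜ[ℂ] m -
          (1 : UniversalEnvelopingAlgebra ℂ L) ⊗ₜ[ℂ] (ρ h m)}).restrictScalars ℂ).liftQ
    (preLift σ f) (fun _ hz => preLift_eq_zero σ hf hz) ∘ₗ
    (Submodule.Quotient.restrictScalarsEquiv ℂ _).symm.toLinearMap

theorem lift_mk (m : M) : lift σ hf (mk H ρ m) = f m := by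
  change preLift σ f (1 ⊗ₜ m) = f m
  rw [preLift_tmul, map_one]; rfl

theorem lift_act (y : L) (z : InducedModule H ρ) : lift σ hf (act H ρ y z) = σ y (lift σ hf z) := by
  obtain ⟨z, rfl⟩ := Submodule.Quotient.mk_surjective _ z
  change preLift σ f (UniversalEnvelopingAlgebra.ι ℂ y • z) = σ y (preLift σ f z)
  rw [preLift_smul, UniversalEnvelopingAlgebra.lift_ι_apply]

end InducedModule
end SemidirectVertex
end

noncomputable section
namespace SemidirectVertex

open Fld

/-! ### The currents on the vacuum module -/

section VacuumModule

universe v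

variable {E : Type*} [LieRing E] [LieAlgebra ℂ E] {Φ : LinearMap.BilinForm ℂ E}
  (hΦ : Φ.lieInvariant E) (hs : Φ.IsSymm)

theorem cur_add (x y : E) (n : ℤ) : cur hΦ hs (x + y) n = cur hΦ hs x n + cur hΦ hs y n := by
  unfold cur
  rw [← LieAlgebra.of_add, TensorProduct.tmul_add, Prod.mk_add_mk, add_zero]

theorem cur_smul (c : ℂ) (x : E) (n : ℤ) : cur hΦ hs (c • x) n = c • cur hΦ hs x n := by
  unfold cur
  rw [← LieAlgebra.of_smul, TensorProduct.tmul_smul, Prod.smul_mk, smul_zero]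

variable (K : LieIdeal ℂ E) (g : LieSubalgebra ℂ E) (ℓ : ℂ)

theorem cen_mem_curlyL : cen hΦ hs ∈ curlyL hΦ hs K g :=
  show _ ∈ Submodule.span ℂ _ from Submodule.subset_span (Or.inl (Or.inr rfl))

/-- The universal property of the vacuum module. -/
structure VacuumRep (V : Type v) [AddCommGroup V] [Module ℂ V] where
  /-- The action. -/
  act : curlyL hΦ hs K g →ₗ[ℂ] Module.End ℂ V
  act_lie : ∀ x y z, act ⁅x, y⁆ z = act x (act y z) - act y (act x z)
  /-- The vacuum vector. -/
  vac : V
  act_vac : ∀ (x : Affine hΦ hs) (hx : x ∈ curlyL hΦ hs K g), x ∈ polyPart hΦ hs K →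
    act ⟨x, hx⟩ vac = (ℓ * cenCoeff hΦ hs x) • vac
  eq_top : ∀ p : Submodule ℂ V, vac ∈ p → (∀ y, ∀ z ∈ p, act y z ∈ p) → p = ⊤
  exists_lift : ∀ {N : Type v} [AddCommGroup N] [Module ℂ N]
    (σ : curlyL hΦ hs K g →ₗ[ℂ] Module.End ℂ N) (z : N),
    (∀ x y z, σ ⁅x, y⁆ z = σ x (σ y z) - σ y (σ x z)) →
    (∀ (x : Affine hΦ hs) (hx : x ∈ curlyL hΦ hs K g), x ∈ polyPart hΦ hs K →
      σ ⟨x, hx⟩ z = (ℓ * cenCoeff hΦ hs x) • z) →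
    ∃ f : V →ₗ[ℂ] N, f vac = z ∧ ∀ y v, f (act y v) = σ y (f v)

variable {hΦ hs K g ℓ} {V : Type v} [AddCommGroup V] [Module ℂ V]

namespace VacuumRep

variable (R : VacuumRep hΦ hs K g ℓ V)

/-- The operator `u(n)` on the vacuum module, for `u ∈ K`. -/
def opK (u : K) (n : ℤ) : Module.End ℂ V :=
  R.act ⟨cur hΦ hs u n, cur_mem_curlyL_of_mem_ideal hΦ hs K g u.2 n⟩

/-- The operator `a(n)` on the vacuum module, for `a ∈ g` and `n < 0`. -/
def opNeg (a : g) (n : ℤ) (hn : n < 0) : Module.End ℂ V :=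
  R.act ⟨cur hΦ hs a n, cur_mem_curlyL_of_mem_subalgebra hΦ hs K g a.2 hn⟩

/-- The operator by which the central element acts on the vacuum module. -/
def opCen : Module.End ℂ V :=
  R.act ⟨cen hΦ hs, cen_mem_curlyL hΦ hs K g⟩

variable (w : V)

theorem opK_opK_aux (u v : K) (m n : ℤ) :
    R.opK u m (R.opK v n w) - R.opK v n (R.opK u m w) =
      R.opK ⁅(u : E), v⁆ (m + n) w +
        (if m + n = 0 then (m : ℂ) * Φ u v else 0) • R.opCen w := by
  unfold opK opCen
  rw [← R.act_lie, ← LinearMap.smul_apply, ← map_smul, ← LinearMap.add_apply, ← map_add]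
  congr 2
  exact Subtype.ext (lie_cur_cur hΦ hs u v m n)

theorem opNeg_opK (hg : ∀ a ∈ g, ∀ x, Φ a x = 0) (a : g) (u : K) (m n : ℤ) (hm : m < 0) :
    R.opNeg a m hm (R.opK u n w) - R.opK u n (R.opNeg a m hm w) =
      R.opK ⁅(a : E), u⁆ (m + n) w := by
  unfold opK opNeg
  rw [← R.act_lie]
  congr 2
  refine Subtype.ext ((lie_cur_cur hΦ hs a u m n).trans ?_)
  rw [hg a a.2, mul_zero, ite_self, zero_smul, add_zero]
  rfl

theorem opNeg_opNeg (hg : ∀ a ∈ g, ∀ x, Φ a x = 0) (a b : g) (m n : ℤ) (hm : m < 0) (hn : n < 0) :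
    R.opNeg a m hm (R.opNeg b n hn w) - R.opNeg b n hn (R.opNeg a m hm w) =
      R.opNeg ⁅a, b⁆ (m + n) (by lia) w := by
  unfold opNeg
  rw [← R.act_lie]
  congr 2
  refine Subtype.ext ((lie_cur_cur hΦ hs a b m n).trans ?_)
  rw [hg a a.2, mul_zero, ite_self, zero_smul, add_zero]
  rfl

theorem opK_vac (u : K) (n : ℤ) (hn : 0 ≤ n) :
    R.opK u n (R.vac) = 0 := by
  have : cur hΦ hs (u : E) n ∈ polyPart hΦ hs K :=
    show _ ∈ Submodule.span ℂ _ from Submodule.subset_span (Or.inl ⟨u, u.2, n, hn, rfl⟩)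
  unfold opK
  rw [R.act_vac _ _ this, cenCoeff_cur, mul_zero, zero_smul]

/-- The vectors on which c acts as ℓ include the vacuum and are stable under 𝓛 because c is central.
-/
theorem opCen_apply : R.opCen w = ℓ • w := by
  have hc : cen hΦ hs ∈ polyPart hΦ hs K :=
    show _ ∈ Submodule.span ℂ _ from Submodule.subset_span (Or.inr rfl)
  have h : LinearMap.eqLocus R.opCen (ℓ • LinearMap.id) = ⊤ := by
    refine R.eq_top _ ?_ fun y z hz => ?_
    · rw [LinearMap.mem_eqLocus]
      unfold opCen
      rw [R.act_vac _ _ hc, cenCoeff_cen, mul_one]; rfl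
    · rw [LinearMap.mem_eqLocus] at hz ⊢
      have hy : ⁅y, (⟨cen hΦ hs, cen_mem_curlyL hΦ hs K g⟩ : curlyL hΦ hs K g)⁆ = 0 :=
        Subtype.ext (lie_cen hΦ hs y)
      have := R.act_lie y ⟨cen hΦ hs, cen_mem_curlyL hΦ hs K g⟩ z
      rw [hy, map_zero, LinearMap.zero_apply, eq_comm, sub_eq_zero] at this
      change _ = ℓ • z at hz
      exact this.symm.trans ((congrArg _ hz).trans (map_smul _ _ _))
  have h2 : w ∈ LinearMap.eqLocus R.opCen (ℓ • LinearMap.id) := by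
    rw [h]; exact Submodule.mem_top
  exact h2

theorem opK_opK (u v : K) (m n : ℤ) :
    R.opK u m (R.opK v n w) - R.opK v n (R.opK u m w) =
      R.opK ⁅(u : E), v⁆ (m + n) w +
        (if m + n = 0 then (m : ℂ) * (ℓ * Φ u v) else 0) • w := by
  rw [R.opK_opK_aux, R.opCen_apply, smul_smul]
  congr 2
  split_ifs <;> ring

theorem eq_top_of_mem (p : Submodule ℂ V) (hvac : R.vac ∈ p)
    (hK : ∀ (u : K) n, ∀ v ∈ p, R.opK u n v ∈ p)
    (hN : ∀ (a : g) n (hn : n < 0), ∀ v ∈ p, R.opNeg a n hn v ∈ p) : p = ⊤ := by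
  refine R.eq_top p hvac fun y z hz => ?_
  obtain ⟨y, hy⟩ := y
  have hy' : y ∈ Submodule.span ℂ (curlyLGen hΦ hs K g) := hy
  induction hy' using Submodule.span_induction with
  | mem y h =>
    rcases h with (⟨u, hu, n, rfl⟩ | rfl) | ⟨a, ha, n, hn, rfl⟩
    · exact hK ⟨u, hu⟩ n z hz
    · have := R.opCen_apply z
      unfold opCen at this
      rw [this]; exact p.smul_mem ℓ hz
    · exact hN ⟨a, ha⟩ n hn z hz
  | zero =>
    have : (⟨0, hy⟩ : curlyL hΦ hs K g) = 0 := rfl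
    rw [this, map_zero]; exact p.zero_mem
  | add x y hx' hy' ihx ihy =>
    exact (map_add R.act (⟨x, hx'⟩ : curlyL hΦ hs K g) ⟨y, hy'⟩) ▸ add_mem (ihx hx') (ihy hy')
  | smul c x hx ih =>
    exact (map_smul R.act c (⟨x, hx⟩ : curlyL hΦ hs K g)) ▸ p.smul_mem c (ih hx)

theorem induct {P : V → Prop}
    (vac : P (R.vac)) (add : ∀ v w, P v → P w → P (v + w))
    (smul : ∀ (c : ℂ) v, P v → P (c • v)) (ideal : ∀ (u : K) n v, P v → P (R.opK u n v))
    (neg : ∀ (a : g) n (hn : n < 0) v, P v → P (R.opNeg a n hn v)) (v) : P v := by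
  have := R.eq_top_of_mem
    { carrier := {v | P v}
      add_mem' := fun {v w} => add v w
      zero_mem' := by have := smul 0 _ vac; rwa [zero_smul] at this
      smul_mem' := smul } vac ideal neg
  have h2 : v ∈ (⊤ : Submodule ℂ V) := Submodule.mem_top
  rw [← this] at h2
  exact h2

/-- Commuting u(n) past a generator shifts the index by a fixed amount, and a central term occurs
for a single n only. -/
theorem opK_restricted (hg : ∀ a ∈ g, ∀ x, Φ a x = 0) (u : K) :
    ∃ N : ℤ, ∀ n, N ≤ n → R.opK u n w = 0 := by
  induction w using R.induct generalizing u with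
  | vac => exact ⟨0, fun n hn => R.opK_vac u n hn⟩
  | add v w hv hw =>
    obtain ⟨N, hN⟩ := hv u
    obtain ⟨N', hN'⟩ := hw u
    exact ⟨max N N', fun n hn => by rw [map_add, hN n (by lia), hN' n (by lia), add_zero]⟩
  | smul c v hv =>
    obtain ⟨N, hN⟩ := hv u
    exact ⟨N, fun n hn => by rw [map_smul, hN n (by lia), smul_zero]⟩
  | ideal v n w hw =>
    obtain ⟨N, hN⟩ := hw u
    obtain ⟨N', hN'⟩ := hw ⁅(u : E), v⁆
    refine ⟨max (max N (N' - n)) (1 - n), fun m hm => ?_⟩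
    have := R.opK_opK w u v m n
    rwa [hN m (by lia), map_zero, sub_zero, hN' _ (by lia), if_neg (by lia), zero_smul,
      add_zero] at this
  | neg a n hn w hw =>
    obtain ⟨N, hN⟩ := hw u
    obtain ⟨N', hN'⟩ := hw ⁅(a : E), u⁆
    refine ⟨max N (N' - n), fun m hm => ?_⟩
    have := R.opNeg_opK w hg a u n m hn
    rwa [hN m (by lia), map_zero, zero_sub, hN' _ (by lia), neg_eq_zero] at this

/-- The current of an element of the ideal. -/
def kcur (hg : ∀ a ∈ g, ∀ x, Φ a x = 0) : K →ₗ[ℂ] Fld V where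
  toFun u := ⟨R.opK u, fun w => R.opK_restricted w hg u⟩
  map_add' u v := by
    ext n w
    have : (⟨cur hΦ hs (u + v : K) n, cur_mem_curlyL_of_mem_ideal hΦ hs K g (u + v).2 n⟩ :
        curlyL hΦ hs K g) = ⟨cur hΦ hs u n, cur_mem_curlyL_of_mem_ideal hΦ hs K g u.2 n⟩ +
        ⟨cur hΦ hs v n, cur_mem_curlyL_of_mem_ideal hΦ hs K g v.2 n⟩ :=
      Subtype.ext (cur_add hΦ hs u v n)
    change R.act _ w = R.act _ w + R.act _ w
    rw [this, map_add]; rfl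
  map_smul' c u := by
    ext n w
    have : (⟨cur hΦ hs (c • u : K) n, cur_mem_curlyL_of_mem_ideal hΦ hs K g (c • u).2 n⟩ :
        curlyL hΦ hs K g) = c • ⟨cur hΦ hs u n, cur_mem_curlyL_of_mem_ideal hΦ hs K g u.2 n⟩ :=
      Subtype.ext (cur_smul hΦ hs c u n)
    change R.act _ w = c • R.act _ w
    rw [this, map_smul]; rfl

/-- The half of the current of an element of the subalgebra that acts on the vacuum module. -/
def gcur : g →ₗ[ℂ] Fld V where
  toFun a := ⟨fun n => if hn : n < 0 then R.opNeg a n hn else 0, fun w => ⟨0, fun n hn => by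
    rw [dif_neg (by lia)]; rfl⟩⟩
  map_add' a b := by
    ext n w
    rw [Fld.add_apply]
    by_cases hn : n < 0
    · simp only [dif_pos hn]
      have : (⟨cur hΦ hs (a + b : g) n, cur_mem_curlyL_of_mem_subalgebra hΦ hs K g (a + b).2 hn⟩ :
          curlyL hΦ hs K g) =
          ⟨cur hΦ hs a n, cur_mem_curlyL_of_mem_subalgebra hΦ hs K g a.2 hn⟩ +
          ⟨cur hΦ hs b n, cur_mem_curlyL_of_mem_subalgebra hΦ hs K g b.2 hn⟩ :=
        Subtype.ext (cur_add hΦ hs a b n)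
      unfold opNeg
      rw [this, map_add]; rfl
    · simp only [dif_neg hn, LinearMap.zero_apply, add_zero]
  map_smul' c a := by
    ext n w
    rw [RingHom.id_apply, Fld.smul_apply]
    by_cases hn : n < 0
    · simp only [dif_pos hn]
      have : (⟨cur hΦ hs (c • a : g) n, cur_mem_curlyL_of_mem_subalgebra hΦ hs K g (c • a).2 hn⟩ :
          curlyL hΦ hs K g) =
          c • ⟨cur hΦ hs a n, cur_mem_curlyL_of_mem_subalgebra hΦ hs K g a.2 hn⟩ :=
        Subtype.ext (cur_smul hΦ hs c a n)
      unfold opNeg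
      rw [this, map_smul]; rfl
    · simp only [dif_neg hn, LinearMap.zero_apply, smul_zero]

theorem gcur_of_neg (a : g) {n : ℤ} (hn : n < 0) :
    (R.gcur a).1 n = R.opNeg a n hn := dif_pos hn

/-- The currents on the vacuum module. -/
def currents (hg : ∀ a ∈ g, ∀ x, Φ a x = 0) :
    CurrentFields K g V where
  kfld := R.kcur hg
  gfld := R.gcur
  form u v := ℓ * Φ u v
  form_lie_left a u v := by
    -- Invariance moves the bracket to the other two arguments, which pairs `a` itself with an
    -- element of E, and `a` is in the radical.
    have h : Φ ⁅(a : E), (u : E)⁆ v = 0 := by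
      rw [← lie_skew, map_neg, LinearMap.neg_apply, hΦ, neg_neg, ← hs.eq, hs.eq _ (a : E),
        hg a a.2]
    exact (congrArg (ℓ * ·) h).trans (mul_zero ℓ)
  form_lie_right a u v := by
    have h : Φ u ⁅(a : E), (v : E)⁆ = 0 := by
      rw [← neg_eq_zero, ← hΦ, ← lie_skew, map_neg, LinearMap.neg_apply, hΦ, neg_neg,
        hg a a.2]
    exact (congrArg (ℓ * ·) h).trans (mul_zero ℓ)
  kfld_kfld u v m n w := R.opK_opK w u v m n
  gfld_kfld a u m n w hm := by
    rw [R.gcur_of_neg a hm]; exact R.opNeg_opK w hg a u m n hm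
  gfld_gfld a b m n w hm hn := by
    rw [R.gcur_of_neg a hm, R.gcur_of_neg b hn, R.gcur_of_neg _ (by lia)]
    exact R.opNeg_opNeg w hg a b m n hm hn
  gfld_nonneg a n w hn := by
    change (if hn : n < 0 then R.opNeg a n hn else 0) w = 0
    rw [dif_neg (by lia)]; rfl

end VacuumRep
end VacuumModule
end SemidirectVertex
end

noncomputable section
namespace SemidirectVertex

open Fld

/-! ### Vectors of the vacuum module as fields -/

section StateField

universe v

variable {E : Type*} [LieRing E] [LieAlgebra ℂ E] {Φ : LinearMap.BilinForm ℂ E}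
  (hΦ : Φ.lieInvariant E) (hs : Φ.IsSymm)

/-- The component in `E ⊗ ℂ[t,t⁻¹]` of an element of the affine Lie algebra. -/
def loopPart : Affine hΦ hs →ₗ[ℂ] ℤ →₀ E where
  toFun x := LieAlgebra.LoopAlgebra.toFinsupp ℂ ℤ E ((LieAlgebra.ofProd _).symm x).1
  map_add' _ _ := by simp
  map_smul' _ _ := by simp

theorem loopPart_cur (x : E) (n : ℤ) : loopPart hΦ hs (cur hΦ hs x n) = Finsupp.single n x :=
  LieAlgebra.LoopAlgebra.toFinsupp_single_tmul ..

theorem loopPart_cen : loopPart hΦ hs (cen hΦ hs) = 0 := by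
  simp [loopPart, cen]

variable {hΦ hs} {K : LieIdeal ℂ E} {g : LieSubalgebra ℂ E} {ℓ : ℂ}
  (hKg : IsCompl K.toSubmodule g.toSubmodule) (hg : ∀ a ∈ g, ∀ x, Φ a x = 0)

namespace CurrentFields

variable {V : Type*} [AddCommGroup V] [Module ℂ V] (C : CurrentFields K g V)

/-- The operators of elements of `E ⊗ ℂ[t,t⁻¹] ⊕ ℂ c` on fields. -/
def affineAct (ℓ : ℂ) : Affine hΦ hs →ₗ[ℂ] Module.End ℂ C.fieldSpace :=
  (Finsupp.lsum ℂ fun n => C.kprod n ∘ₗ K.toSubmodule.projectionOnto g.toSubmodule hKg +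
    C.gprod n ∘ₗ g.toSubmodule.projectionOnto K.toSubmodule hKg.symm) ∘ₗ loopPart hΦ hs +
  (cenCoeff hΦ hs).smulRight (ℓ • LinearMap.id)

theorem affineAct_ideal (u : K) (n : ℤ) (φ : C.fieldSpace) :
    C.affineAct hKg ℓ (cur hΦ hs u n) φ = C.kprod n u φ := by
  have h1 : K.toSubmodule.projectionOnto g.toSubmodule hKg (u : E) = u :=
    Submodule.projectionOnto_apply_left hKg u
  have h2 : g.toSubmodule.projectionOnto K.toSubmodule hKg.symm (u : E) = 0 :=
    Submodule.projectionOnto_apply_right hKg.symm u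
  rw [affineAct, LinearMap.add_apply, LinearMap.comp_apply, loopPart_cur, Finsupp.lsum_single,
    LinearMap.smulRight_apply, cenCoeff_cur, zero_smul, add_zero, LinearMap.add_apply,
    LinearMap.comp_apply, LinearMap.comp_apply, h1, h2, map_zero, add_zero]

theorem affineAct_subalgebra (a : g) (n : ℤ) (φ : C.fieldSpace) :
    C.affineAct hKg ℓ (cur hΦ hs a n) φ = C.gprod n a φ := by
  have h1 : K.toSubmodule.projectionOnto g.toSubmodule hKg (a : E) = 0 :=
    Submodule.projectionOnto_apply_right hKg a
  have h2 : g.toSubmodule.projectionOnto K.toSubmodule hKg.symm (a : E) = a :=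
    Submodule.projectionOnto_apply_left hKg.symm a
  rw [affineAct, LinearMap.add_apply, LinearMap.comp_apply, loopPart_cur, Finsupp.lsum_single,
    LinearMap.smulRight_apply, cenCoeff_cur, zero_smul, add_zero, LinearMap.add_apply,
    LinearMap.comp_apply, LinearMap.comp_apply, h1, h2, map_zero, zero_add]

theorem affineAct_cen (φ : C.fieldSpace) : C.affineAct hKg ℓ (cen hΦ hs) φ = ℓ • φ := by
  rw [affineAct, LinearMap.add_apply, LinearMap.comp_apply, loopPart_cen, map_zero, zero_add,
    LinearMap.smulRight_apply, cenCoeff_cen, one_smul]; rfl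

theorem affineAct_lie_cen (y : Affine hΦ hs) (φ : C.fieldSpace) :
    C.affineAct hKg ℓ ⁅y, cen hΦ hs⁆ φ =
      C.affineAct hKg ℓ y (C.affineAct hKg ℓ (cen hΦ hs) φ) -
        C.affineAct hKg ℓ (cen hΦ hs) (C.affineAct hKg ℓ y φ) := by
  rw [lie_cen, map_zero, LinearMap.zero_apply, affineAct_cen, affineAct_cen, map_smul, sub_self]

theorem affineAct_lie_ideal (hform : ∀ u v : K, C.form u v = ℓ * Φ u v) (u v : K) (m n : ℤ)
    (φ : C.fieldSpace) : C.affineAct hKg ℓ ⁅cur hΦ hs u m, cur hΦ hs v n⁆ φ =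
      C.affineAct hKg ℓ (cur hΦ hs u m) (C.affineAct hKg ℓ (cur hΦ hs v n) φ) -
        C.affineAct hKg ℓ (cur hΦ hs v n) (C.affineAct hKg ℓ (cur hΦ hs u m) φ) := by
  have h := C.kprod_kprod u v m n φ
  simp only [← C.affineAct_ideal (hΦ := hΦ) (hs := hs) (ℓ := ℓ) hKg] at h
  rw [h, lie_cur_cur, map_add, map_smul, LinearMap.add_apply, LinearMap.smul_apply, affineAct_cen,
    hform, smul_smul]
  congr 2
  split_ifs <;> ring

theorem affineAct_lie_subalgebra_ideal (hg : ∀ a ∈ g, ∀ x, Φ a x = 0) (a : g) (v : K) {m : ℤ}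
    (hm : m < 0) (n : ℤ) (φ : C.fieldSpace) :
    C.affineAct hKg ℓ ⁅cur hΦ hs a m, cur hΦ hs v n⁆ φ =
      C.affineAct hKg ℓ (cur hΦ hs a m) (C.affineAct hKg ℓ (cur hΦ hs v n) φ) -
        C.affineAct hKg ℓ (cur hΦ hs v n) (C.affineAct hKg ℓ (cur hΦ hs a m) φ) := by
  have h := C.kprod_gprod a v hm n φ
  simp only [← C.affineAct_ideal (hΦ := hΦ) (hs := hs) (ℓ := ℓ) hKg,
    ← C.affineAct_subalgebra (hΦ := hΦ) (hs := hs) (ℓ := ℓ) hKg] at h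
  rw [h, lie_cur_cur, hg a a.2, mul_zero, ite_self, zero_smul, add_zero, sub_sub_cancel]
  rfl

theorem affineAct_lie_subalgebra (hg : ∀ a ∈ g, ∀ x, Φ a x = 0) (a b : g) {m n : ℤ}
    (hm : m < 0) (hn : n < 0) (φ : C.fieldSpace) :
    C.affineAct hKg ℓ ⁅cur hΦ hs a m, cur hΦ hs b n⁆ φ =
      C.affineAct hKg ℓ (cur hΦ hs a m) (C.affineAct hKg ℓ (cur hΦ hs b n) φ) -
        C.affineAct hKg ℓ (cur hΦ hs b n) (C.affineAct hKg ℓ (cur hΦ hs a m) φ) := by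
  have h := C.gprod_gprod a b hm hn φ
  simp only [← C.affineAct_subalgebra (hΦ := hΦ) (hs := hs) (ℓ := ℓ) hKg] at h
  rw [h, lie_cur_cur, hg a a.2, mul_zero, ite_self, zero_smul, add_zero]
  rfl

theorem affineAct_lie_gen (hg : ∀ a ∈ g, ∀ x, Φ a x = 0)
    (hform : ∀ u v : K, C.form u v = ℓ * Φ u v) {x y : Affine hΦ hs}
    (hx : x ∈ curlyLGen hΦ hs K g) (hy : y ∈ curlyLGen hΦ hs K g) (φ : C.fieldSpace) :
    C.affineAct hKg ℓ ⁅x, y⁆ φ =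
      C.affineAct hKg ℓ x (C.affineAct hKg ℓ y φ) - C.affineAct hKg ℓ y (C.affineAct hKg ℓ x φ) := by
  rcases hx with (⟨u, hu, m, rfl⟩ | rfl) | ⟨a, ha, m, hm, rfl⟩
  · rcases hy with (⟨v, hv, n, rfl⟩ | rfl) | ⟨b, hb, n, hn, rfl⟩
    · exact C.affineAct_lie_ideal hKg hform ⟨u, hu⟩ ⟨v, hv⟩ m n φ
    · exact C.affineAct_lie_cen hKg _ φ
    · rw [← lie_skew, map_neg, LinearMap.neg_apply,
        C.affineAct_lie_subalgebra_ideal hKg hg ⟨b, hb⟩ ⟨u, hu⟩ hn m φ, neg_sub]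
  · rw [← lie_skew, map_neg, LinearMap.neg_apply, C.affineAct_lie_cen, neg_sub]
  · rcases hy with (⟨v, hv, n, rfl⟩ | rfl) | ⟨b, hb, n, hn, rfl⟩
    · exact C.affineAct_lie_subalgebra_ideal hKg hg ⟨a, ha⟩ ⟨v, hv⟩ hm n φ
    · exact C.affineAct_lie_cen hKg _ φ
    · exact C.affineAct_lie_subalgebra hKg hg ⟨a, ha⟩ ⟨b, hb⟩ hm hn φ

/-- `affineAct` is a linear map on the whole affine algebra, with placeholder values on the
nonnegative modes of `g`; compatibility with brackets is claimed on 𝓛 alone and is checked on its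
spanning set. -/
theorem affineAct_lie (hg : ∀ a ∈ g, ∀ x, Φ a x = 0)
    (hform : ∀ u v : K, C.form u v = ℓ * Φ u v) {x y : Affine hΦ hs}
    (hx : x ∈ curlyL hΦ hs K g) (hy : y ∈ curlyL hΦ hs K g) (φ : C.fieldSpace) :
    C.affineAct hKg ℓ ⁅x, y⁆ φ =
      C.affineAct hKg ℓ x (C.affineAct hKg ℓ y φ) - C.affineAct hKg ℓ y (C.affineAct hKg ℓ x φ) := by
  change x ∈ Submodule.span ℂ _ at hx
  change y ∈ Submodule.span ℂ _ at hy
  induction hx using Submodule.span_induction with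
  | mem x hx =>
    induction hy using Submodule.span_induction with
    | mem y hy => exact C.affineAct_lie_gen hKg hg hform hx hy φ
    | zero => simp
    | add a b _ _ ha hb =>
      rw [lie_add]
      simp only [map_add, LinearMap.add_apply]
      rw [ha, hb, add_sub_add_comm]
    | smul r a _ ha =>
      rw [lie_smul]
      simp only [map_smul, LinearMap.smul_apply]
      rw [ha, smul_sub]
  | zero => simp
  | add a b _ _ ha hb =>
    rw [add_lie]
    simp only [map_add, LinearMap.add_apply]
    rw [ha, hb, add_sub_add_comm]
  | smul r a _ ha =>
    rw [smul_lie]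
    simp only [map_smul, LinearMap.smul_apply]
    rw [ha, smul_sub]

/-- The identity, in the space of fields generated by currents. -/
def oneField : C.fieldSpace := ⟨Fld.one, C.mem_fieldSpace.2 (.ofIdeal .one)⟩

/-- The identity field behaves like the vacuum vector: nonnegative products of currents with it
vanish. This is the condition needed to map the induced module. -/
theorem affineAct_oneField {x : Affine hΦ hs} (hx : x ∈ polyPart hΦ hs K) :
    C.affineAct hKg ℓ x C.oneField = (ℓ * cenCoeff hΦ hs x) • C.oneField := by
  change x ∈ Submodule.span ℂ _ at hx
  induction hx using Submodule.span_induction with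
  | mem x hx =>
    rcases hx with ⟨u, hu, n, hn, rfl⟩ | rfl
    · lift u to K using hu
      rw [cenCoeff_cur, mul_zero, zero_smul, affineAct_ideal]
      exact Subtype.ext ((C.kprod_of_isIdealField .one u n).trans (res_one_right n 0 hn))
    · rw [cenCoeff_cen, mul_one, affineAct_cen]
  | zero => simp
  | add a b _ _ ha hb => rw [map_add, LinearMap.add_apply, ha, hb, map_add, mul_add, add_smul]
  | smul r a _ ha =>
    rw [map_smul, LinearMap.smul_apply, ha, map_smul, smul_smul, smul_eq_mul, mul_left_comm]

end CurrentFields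

namespace VacuumRep

variable {V : Type v} [AddCommGroup V] [Module ℂ V] (R : VacuumRep hΦ hs K g ℓ V)

/-- The field space is an 𝓛-module with a vacuum-like vector of level ℓ, so the universal property
supplies the state-field map together with its compatibility with all generators. -/
theorem exists_stateField (hKg : IsCompl K.toSubmodule g.toSubmodule)
    (hg : ∀ a ∈ g, ∀ x, Φ a x = 0) :
    ∃ f : V →ₗ[ℂ] (R.currents hg).fieldSpace,
    f R.vac = (R.currents hg).oneField ∧
    (∀ (u : K) n v, f (R.opK u n v) = (R.currents hg).kprod n u (f v)) ∧
    ∀ (a : g) n hn v, f (R.opNeg a n hn v) = (R.currents hg).gprod n a (f v) := by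
  obtain ⟨f, h1, h2⟩ := R.exists_lift
    ((R.currents hg).affineAct hKg ℓ ∘ₗ (curlyL hΦ hs K g).toSubmodule.subtype)
    (R.currents hg).oneField
    (fun x y z => (R.currents hg).affineAct_lie hKg hg (fun _ _ => rfl) x.2 y.2 z)
    (fun x _ hx => (R.currents hg).affineAct_oneField hKg hx)
  exact ⟨f, h1, fun u n v => (h2 _ v).trans ((R.currents hg).affineAct_ideal hKg u n (f v)),
    fun a n hn v => (h2 _ v).trans ((R.currents hg).affineAct_subalgebra hKg a n (f v))⟩

/-- The field of a vector of the vacuum module. -/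
def stateField : V →ₗ[ℂ] Fld V :=
  (R.currents hg).fieldSpace.subtype ∘ₗ (R.exists_stateField hKg hg).choose

theorem stateField_mem (v : V) : R.stateField hKg hg v ∈ (R.currents hg).fieldSpace :=
  ((R.exists_stateField hKg hg).choose v).2

theorem stateField_vac : R.stateField hKg hg R.vac = one :=
  congrArg Subtype.val (R.exists_stateField hKg hg).choose_spec.1

theorem stateField_opK (u : K) (n : ℤ) (v : V) :
    R.stateField hKg hg (R.opK u n v) =
      (R.currents hg).kprod n u ⟨_, R.stateField_mem hKg hg v⟩ :=
  congrArg Subtype.val ((R.exists_stateField hKg hg).choose_spec.2.1 u n v)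

theorem stateField_opNeg (a : g) {m : ℤ} (hm : 0 < m) (v : V) :
    R.stateField hKg hg (R.opNeg a (-m) (by lia) v) =
      lmul (-m) 0 (R.gcur a) (R.stateField hKg hg v) :=
  (congrArg Subtype.val ((R.exists_stateField hKg hg).choose_spec.2.2 a (-m) (by lia) v)).trans
    ((R.currents hg).coe_gprod (by lia) a _)

theorem isProduct_stateField (u : K) (v : V) :
    IsProduct (R.kcur hg u) (R.stateField hKg hg v)
      fun n => R.stateField hKg hg (R.opK u n v) := by
  simp only [stateField_opK]
  exact (R.currents hg).isProduct_kprod u ⟨_, R.stateField_mem hKg hg v⟩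

end VacuumRep
end StateField
end SemidirectVertex
end

noncomputable section
namespace SemidirectVertex

open Fld

/-! ### Abstract state-field correspondence -/

namespace Fld

variable {V : Type*} [AddCommGroup V] [Module ℂ V]

theorem CommModes.apply {κ α : Fld V} {N : ℕ} {αs : ℕ → Fld V}
    (h : CommModes κ α N αs) (r q : ℤ) (w : V) : κ.1 r (α.1 q w) - α.1 q (κ.1 r w) =
      ∑ i ∈ Finset.range N, Ring.choose r i • (αs i).1 (q + (r - i)) w := by
  have := congrArg (fun ξ : Fld V => ξ.1 q w) (h r)
  simpa using this

/-- The commutator with an operator is a derivation of every residue product. -/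
theorem lcomp_res_sub_rcomp_res (f : Module.End ℂ V) (n p : ℤ)
    (α φ : Fld V) : lcomp f (res n p α φ) - rcomp f (res n p α φ) =
      res n p (lcomp f α - rcomp f α) φ + res n p α (lcomp f φ - rcomp f φ) := by
  simp only [res_eq, map_sub, LinearMap.sub_apply, lcomp_lmul, lcomp_rmul, rcomp_lmul, rcomp_rmul,
    lmul_lcomp, rmul_rcomp]
  abel

/-- Expanding x₁^r = (x + (x₁ - x))^r expresses weighted residue products by unweighted ones. The
number of terms does not depend on r. -/
theorem IsLocal.res_eq_sum {α φ : Fld V} (h : IsLocal α φ) (n : ℤ) :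
    ∃ k : ℕ, ∀ N, k ≤ N → ∀ r, res n r α φ =
      ∑ j ∈ Finset.range N, Ring.choose r j • shift (r - j) (res (n + j) 0 α φ) := by
  have hl := h
  obtain ⟨M, hM⟩ := h
  refine ⟨(M - n).toNat, fun N hN r => ?_⟩
  ext q w
  rw [res_apply, hl.jacobi w n r q, sum_apply]
  unfold prodC
  rw [expandMid_eq_sum N (fun i hi => by beta_reduce; rw [hM _ _ (by lia)]; rfl)]
  refine Finset.sum_congr rfl fun i _ => ?_
  rw [Fld.zsmul_apply, shift_apply, show r + q - (i : ℤ) = q + (r - i) by ring]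

end Fld

variable {E : Type*} [LieRing E] [LieAlgebra ℂ E] {K : LieIdeal ℂ E} {g : LieSubalgebra ℂ E}
  {V : Type*} [AddCommGroup V] [Module ℂ V]

/-- A space generated from a vacuum vector by currents, with a linear map to fields that is
compatible with the products with currents. -/
structure StateMap (C : CurrentFields K g V) where
  /-- The vacuum vector. -/
  vac : V
  /-- The field of a vector. -/
  fld : V →ₗ[ℂ] Fld V
  eq_top : ∀ p : Submodule ℂ V, vac ∈ p → (∀ u n, ∀ v ∈ p, (C.kfld u).1 n v ∈ p) →
    (∀ a n, n < 0 → ∀ v ∈ p, (C.gfld a).1 n v ∈ p) → p = ⊤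
  kfld_vac : ∀ u n, 0 ≤ n → (C.kfld u).1 n vac = 0
  fld_vac : fld vac = one
  isProduct : ∀ u v, IsProduct (C.kfld u) (fld v) fun n => fld ((C.kfld u).1 n v)
  fld_gfld : ∀ a m v, 0 < m → fld ((C.gfld a).1 (-m) v) = lmul (-m) 0 (C.gfld a) (fld v)

namespace StateMap

variable {C : CurrentFields K g V} (S : StateMap C)

/-! ### Vectors generated by the ideal -/

/-- The vectors generated from the vacuum by the currents of the ideal. -/
inductive IsIdealVector : V → Prop
  | vac : IsIdealVector S.vac
  | add {v w : V} : IsIdealVector v → IsIdealVector w → IsIdealVector (v + w)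
  | smul (c : ℂ) {v : V} : IsIdealVector v → IsIdealVector (c • v)
  | mode (k : K) (n : ℤ) {v : V} : IsIdealVector v → IsIdealVector ((C.kfld k).1 n v)

/-- The space of the vectors generated from the vacuum by the currents of the ideal. -/
def idealSpace : Submodule ℂ V where
  carrier := {v | S.IsIdealVector v}
  add_mem' := .add
  zero_mem' := by
    have := (IsIdealVector.vac (S := S)).smul 0
    rwa [zero_smul] at this
  smul_mem' c _ := .smul c

/-- A Poincaré–Birkhoff–Witt ordering without bases: since [g, K] ⊆ K, modes of K can be moved to
the right, so vectors generated by K followed by negative modes of g span V. -/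
theorem induct {P : V → Prop} (ideal : ∀ v, S.IsIdealVector v → P v)
    (add : ∀ v w, P v → P w → P (v + w)) (smul : ∀ (c : ℂ) v, P v → P (c • v))
    (neg : ∀ (a : g) (m : ℤ), 0 < m → ∀ v, P v → P ((C.gfld a).1 (-m) v)) (v : V) : P v := by
  let p : Submodule ℂ V :=
    { carrier := {v | ∀ q : Submodule ℂ V, S.idealSpace ≤ q →
        (∀ (a : g) (m : ℤ), 0 < m → ∀ v ∈ q, (C.gfld a).1 (-m) v ∈ q) → v ∈ q}
      add_mem' := fun hv hw q h h' => add_mem (hv q h h') (hw q h h')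
      zero_mem' := fun q _ _ => q.zero_mem
      smul_mem' := fun c v hv q h h' => q.smul_mem c (hv q h h') }
  have hneg : ∀ (a : g) (m : ℤ), 0 < m → ∀ v ∈ p, (C.gfld a).1 (-m) v ∈ p :=
    fun a m hm v hv q h h' => h' a m hm v (hv q h h')
  have hp : p = ⊤ := by
    refine S.eq_top p (fun q h _ => h .vac) (fun u n v hv => ?_) fun a n hn v hv => ?_
    -- The vectors of `p` that all modes of K keep in `p`; the commutation relation makes this space
    -- stable under the modes of g.
    · let q : Submodule ℂ V :=
        { carrier := {v | v ∈ p ∧ ∀ (u : K) (n : ℤ), (C.kfld u).1 n v ∈ p}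
          add_mem' := fun {v w} hv hw => ⟨add_mem hv.1 hw.1, fun u n => by
            rw [map_add]; exact add_mem (hv.2 u n) (hw.2 u n)⟩
          zero_mem' := ⟨zero_mem _, fun u n => by rw [map_zero]; exact zero_mem _⟩
          smul_mem' := fun c v hv => ⟨p.smul_mem c hv.1, fun u n => by
            rw [map_smul]; exact p.smul_mem c (hv.2 u n)⟩ }
      refine (hv q (fun v hv => ⟨fun q h _ => h hv, fun u n q h _ => h (.mode u n hv)⟩)
        fun a m hm v hv => ⟨hneg a m hm v hv.1, fun u n => ?_⟩).2 u n
      have := C.gfld_kfld a u (-m) n v (by lia)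
      rw [sub_eq_iff_eq_add'] at this
      rw [← sub_eq_iff_eq_add.2 this]
      exact sub_mem (hneg a m hm _ (hv.2 u n)) (hv.2 _ _)
    · have := hneg a (-n) (by lia) v hv
      rwa [neg_neg] at this
  have hv : v ∈ p := by rw [hp]; exact Submodule.mem_top
  exact hv
    { carrier := {v | P v}
      add_mem' := fun {v w} => add v w
      zero_mem' := by have := smul 0 _ (ideal _ .vac); rwa [zero_smul] at this
      smul_mem' := smul } (fun v hv => ideal v hv) neg

variable {S}

theorem IsIdealVector.isIdealField_and {v : V} (h : S.IsIdealVector v) :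
    C.IsIdealField (S.fld v) ∧ ∀ u n, S.fld ((C.kfld u).1 n v) = res n 0 (C.kfld u) (S.fld v) := by
  have aux : ∀ v, C.IsIdealField (S.fld v) → ∀ u n,
      S.fld ((C.kfld u).1 n v) = res n 0 (C.kfld u) (S.fld v) := fun v hv u n =>
    congrFun ((S.isProduct u v).eq (hv.isLocal u).isProduct) n
  suffices C.IsIdealField (S.fld v) from ⟨this, aux v this⟩
  induction h with
  | vac => rw [S.fld_vac]; exact .one
  | add _ _ ih ih' => rw [map_add]; exact ih.add ih'
  | smul c _ ih => rw [map_smul]; exact ih.smul c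
  | mode k n _ ih => rw [aux _ ih]; exact ih.res k n

theorem IsIdealVector.isLocal {v : V} (h : S.IsIdealVector v) (u : K) :
    IsLocal (C.kfld u) (S.fld v) := h.isIdealField_and.1.isLocal u

theorem IsIdealVector.fld_mode {v : V} (h : S.IsIdealVector v) (u : K) (n : ℤ) :
    S.fld ((C.kfld u).1 n v) = res n 0 (C.kfld u) (S.fld v) := h.isIdealField_and.2 u n

variable (S)

/-! ### The creation property -/

theorem prodA_vac {φ : Fld V} (h : ∀ n, 0 ≤ n → φ.1 n S.vac = 0) (α : Fld V) (n p q : ℤ)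
    (hq : -1 ≤ q) : prodA α φ S.vac n p q = α.1 (p + n) (φ.1 q S.vac) := by
  unfold prodA
  rw [expand_eq_sum 1 (fun i hi => by rw [h _ (by lia), map_zero])]
  simp

/-- Only the leading term of the ordered product survives on the vacuum. For currents of K the
opposite order contributes nothing, since their nonnegative modes kill the vacuum. -/
theorem creation (v : V) : (∀ n, 0 ≤ n → (S.fld v).1 n S.vac = 0) ∧ (S.fld v).1 (-1) S.vac = v := by
  induction v using S.induct with
  | ideal v h =>
    induction h with
    | vac =>
      rw [S.fld_vac]
      exact ⟨fun n hn => by rw [one_apply, if_neg (by lia)], by rw [one_apply, if_pos rfl]⟩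
    | add _ _ ih ih' =>
      rw [map_add]
      exact ⟨fun n hn => by rw [Fld.add_apply, ih.1 n hn, ih'.1 n hn, add_zero],
        by rw [Fld.add_apply, ih.2, ih'.2]⟩
    | smul c _ ih =>
      rw [map_smul]
      exact ⟨fun n hn => by rw [Fld.smul_apply, ih.1 n hn, smul_zero],
        by rw [Fld.smul_apply, ih.2]⟩
    | @mode k m v hv ih =>
      rw [hv.fld_mode]
      have hB : ∀ q, prodB (S.fld v) (C.kfld k) S.vac m 0 q = 0 := fun q => by
        unfold prodB prodA
        rw [expand_eq_sum 0 (fun i hi => by rw [S.kfld_vac k _ (by lia), map_zero])]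
        simp
      refine ⟨fun n hn => ?_, ?_⟩
      · rw [res_apply, hB, S.prodA_vac ih.1 _ _ _ _ (by lia), ih.1 n hn, map_zero, sub_zero]
      · rw [res_apply, hB, S.prodA_vac ih.1 _ _ _ _ (by lia), ih.2, sub_zero, zero_add]
  | add v w ih ih' =>
    rw [map_add]
    exact ⟨fun n hn => by rw [Fld.add_apply, ih.1 n hn, ih'.1 n hn, add_zero],
      by rw [Fld.add_apply, ih.2, ih'.2]⟩
  | smul c v ih =>
    rw [map_smul]
    exact ⟨fun n hn => by rw [Fld.smul_apply, ih.1 n hn, smul_zero],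
      by rw [Fld.smul_apply, ih.2]⟩
  | neg a m hm v ih =>
    rw [S.fld_gfld a m v hm]
    refine ⟨fun n hn => ?_, ?_⟩
    · rw [lmul_apply, S.prodA_vac ih.1 _ _ _ _ (by lia), ih.1 n hn, map_zero]
    · rw [lmul_apply, S.prodA_vac ih.1 _ _ _ _ (by lia), ih.2, zero_add]

/-! ### Products of fields of vectors generated by the ideal -/

variable {S}

/-- The vector plays the role of the translate of u; the recursion is dictated by `deriv_res`. -/
theorem IsIdealVector.exists_deriv {u : V} (h : S.IsIdealVector u) :
    ∃ u', S.IsIdealVector u' ∧ S.fld u' = deriv (S.fld u) := by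
  induction h with
  | vac =>
    refine ⟨0, S.idealSpace.zero_mem, ?_⟩
    rw [map_zero, S.fld_vac]
    ext n w
    rw [Fld.zero_apply, deriv_apply, one_apply]
    by_cases hn : n = 0
    · simp [hn]
    · rw [if_neg (by lia), smul_zero]
  | add _ _ ih ih' =>
    obtain ⟨u, hu, e⟩ := ih
    obtain ⟨u', hu', e'⟩ := ih'
    exact ⟨u + u', hu.add hu', by rw [map_add, map_add, map_add, e, e']⟩
  | smul c _ ih =>
    obtain ⟨u, hu, e⟩ := ih
    exact ⟨c • u, hu.smul c, by rw [map_smul, map_smul, map_smul, e]⟩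
  | @mode k n v hv ih =>
    obtain ⟨u, hu, e⟩ := ih
    refine ⟨(C.kfld k).1 n u - n • (C.kfld k).1 (n - 1) v,
      S.idealSpace.sub_mem (hu.mode k n) (S.idealSpace.toAddSubgroup.zsmul_mem
        (hv.mode k (n - 1)) n), ?_⟩
    rw [map_sub, map_zsmul, hu.fld_mode, hv.fld_mode, hv.fld_mode, e, deriv_res]

/-- The product with index -1-k on the vacuum is the k-th derivative divided by k!. The induction
replaces u by its derivative and divides by k + 1. -/
theorem IsIdealVector.mode_vac {u : V} (h : S.IsIdealVector u) (n : ℤ) :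
    S.IsIdealVector ((S.fld u).1 n S.vac) ∧
      res n 0 (S.fld u) one = S.fld ((S.fld u).1 n S.vac) := by
  rcases le_or_gt 0 n with hn | hn
  · rw [(S.creation u).1 n hn, map_zero]
    exact ⟨S.idealSpace.zero_mem, res_one_right n 0 hn⟩
  · obtain ⟨k, rfl⟩ : ∃ k : ℕ, n = -1 - k := ⟨(-1 - n).toNat, by lia⟩
    clear hn
    induction k generalizing u with
    | zero =>
      rw [Nat.cast_zero, sub_zero, (S.creation u).2]
      exact ⟨h, res_neg_one_right⟩
    | succ k ih =>
      obtain ⟨u', hu', e⟩ := h.exists_deriv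
      obtain ⟨h1, h2⟩ := ih hu'
      have hk : ((k : ℂ) + 1) ≠ 0 := Nat.cast_add_one_ne_zero k
      rw [e, deriv_apply] at h1 h2
      rw [res_deriv_left] at h2
      rw [show -(-1 - (k : ℤ)) = ((k + 1 : ℕ) : ℤ) by push_cast; ring,
        show -1 - (k : ℤ) - 1 = -1 - (k + 1 : ℕ) by push_cast; ring] at h1 h2
      rw [natCast_zsmul, ← Nat.cast_smul_eq_nsmul ℂ] at h1 h2
      rw [natCast_zsmul, ← Nat.cast_smul_eq_nsmul ℂ, map_smul] at h2
      push_cast at h1 h2 ⊢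
      refine ⟨?_, smul_right_injective _ hk h2⟩
      have := h1.smul ((k : ℂ) + 1)⁻¹
      rwa [smul_smul, inv_mul_cancel₀ hk, one_smul] at this

theorem IsIdealVector.commModes {u : V} (h : S.IsIdealVector u) (k : K) :
    ∃ N, CommModes (C.kfld k) (S.fld u) N fun i => S.fld ((C.kfld k).1 i u) := by
  obtain ⟨N, hN⟩ := (h.isLocal k).commModes
  refine ⟨N, ?_⟩
  simp only [h.fld_mode]
  exact hN

/-- Locality and compatibility of products are proved together by induction on v. The commutator
formula with a current k holds in the same form for modes on vectors and for residue products of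
fields, so both recursions agree; the sum runs over the vectors kᵢu, hence the induction over all u.
-/
theorem IsIdealVector.products {v : V} (hv : S.IsIdealVector v) {u : V} (hu : S.IsIdealVector u) :
    IsLocal (S.fld u) (S.fld v) ∧ ∀ n, S.IsIdealVector ((S.fld u).1 n v) ∧
      res n 0 (S.fld u) (S.fld v) = S.fld ((S.fld u).1 n v) := by
  induction hv generalizing u with
  | vac =>
    rw [S.fld_vac]
    exact ⟨⟨0, fun n p hn => res_one_right n p hn⟩, hu.mode_vac⟩
  | @add v w _ _ ih ih' =>
    obtain ⟨⟨N, hN⟩, h⟩ := ih hu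
    obtain ⟨⟨N', hN'⟩, h'⟩ := ih' hu
    refine ⟨⟨max N N', fun n p hn => ?_⟩, fun n => ?_⟩
    · rw [map_add, map_add, hN n p (by lia), hN' n p (by lia), add_zero]
    · rw [map_add, map_add, map_add, map_add, (h n).2, (h' n).2]
      exact ⟨(h n).1.add (h' n).1, rfl⟩
  | @smul c v _ ih =>
    obtain ⟨⟨N, hN⟩, h⟩ := ih hu
    refine ⟨⟨N, fun n p hn => ?_⟩, fun n => ?_⟩
    · rw [map_smul, map_smul, hN n p hn, smul_zero]
    · rw [map_smul, map_smul, map_smul, map_smul, (h n).2]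
      exact ⟨(h n).1.smul c, rfl⟩
  | @mode k m v hv ih =>
    obtain ⟨N, hN⟩ := hu.commModes k
    have hR := fun n p => hN.res_res (S.fld v) m n p
    have e := fun n => sub_eq_iff_eq_add'.1 (hN.apply m n v)
    have e' : ∀ n, (S.fld u).1 n ((C.kfld k).1 m v) = (C.kfld k).1 m ((S.fld u).1 n v) -
        ∑ i ∈ Finset.range N, Ring.choose m i •
          (S.fld ((C.kfld k).1 i u)).1 (n + (m - i)) v := fun n =>
      (sub_eq_iff_eq_add.2 (e n)).symm
    rw [hv.fld_mode]
    refine ⟨?_, fun n => ⟨?_, ?_⟩⟩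
    · obtain ⟨N0, h0⟩ := (ih hu).1
      choose N1 h1 using fun i : ℕ => (ih (hu.mode k i)).1
      refine ⟨max N0 (∑ i ∈ Finset.range N, |N1 i| + N - m), fun n p hn => ?_⟩
      have := hR n p
      rw [h0 n p (by lia), map_zero, zero_sub, Finset.sum_eq_zero, neg_eq_zero] at this
      · exact this
      · intro i hi
        have h3 : |N1 i| ≤ ∑ i ∈ Finset.range N, |N1 i| :=
          Finset.single_le_sum (f := fun i : ℕ => |N1 i|) (fun _ _ => abs_nonneg _) hi
        have h4 := le_abs_self (N1 i)
        have h5 := Finset.mem_range.1 hi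
        rw [h1 i _ p (by lia), smul_zero]
    · rw [e' n]
      refine S.idealSpace.sub_mem (((ih hu).2 n).1.mode k m) (S.idealSpace.sum_mem fun i _ => ?_)
      exact S.idealSpace.toAddSubgroup.zsmul_mem ((ih (hu.mode k i)).2 _).1 _
    · rw [e' n, map_sub, map_sum, ((ih hu).2 n).1.fld_mode, ← ((ih hu).2 n).2]
      rw [← sub_eq_iff_eq_add.2 (sub_eq_iff_eq_add'.1 (hR n 0))]
      congr 1
      refine Finset.sum_congr rfl fun i _ => ?_
      rw [map_zsmul, ← ((ih (hu.mode k i)).2 _).2, add_sub_assoc]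

/-! ### Commutators with the currents of the subalgebra -/

/-- The commutator with a(r) is a derivation of residue products and sends κ(x) to x^r [a,κ](x); the
weight x^r is then expanded by `res_eq_sum`. The vectors do not depend on r, and any longer range of
summation is allowed so that sums can be combined. -/
theorem IsIdealVector.exists_commNeg {u : V} (h : S.IsIdealVector u) (a : g) :
    ∃ (us : ℕ → V) (k : ℕ), (∀ j, S.IsIdealVector (us j)) ∧
      ∀ N, k ≤ N → CommNeg (C.gfld a) (S.fld u) N fun j => S.fld (us j) := by
  induction h with
  | vac =>
    refine ⟨fun _ => 0, 0, fun _ => S.idealSpace.zero_mem, fun N _ r _ => ?_⟩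
    rw [S.fld_vac]
    ext q w
    simp only [Fld.sub_apply, lcomp_apply, rcomp_apply, one_apply, map_zero, smul_zero,
      Finset.sum_const_zero, Fld.zero_apply]
    split_ifs <;> simp
  | add _ _ ih ih' =>
    obtain ⟨us, k, h1, h2⟩ := ih
    obtain ⟨us', k', h1', h2'⟩ := ih'
    refine ⟨fun j => us j + us' j, max k k', fun j => (h1 j).add (h1' j), fun N hN r hr => ?_⟩
    rw [map_add, map_add, map_add, add_sub_add_comm, h2 N (by lia) r hr, h2' N (by lia) r hr,
      ← Finset.sum_add_distrib]
    simp only [map_add, smul_add]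
  | smul c _ ih =>
    obtain ⟨us, k, h1, h2⟩ := ih
    refine ⟨fun j => c • us j, k, fun j => (h1 j).smul c, fun N hN r hr => ?_⟩
    rw [map_smul, map_smul, map_smul, ← smul_sub, h2 N hN r hr, Finset.smul_sum]
    refine Finset.sum_congr rfl fun i _ => ?_
    beta_reduce
    rw [map_smul, map_smul, smul_comm]
  | @mode κ n v hv ih =>
    obtain ⟨us, k, h1, h2⟩ := ih
    obtain ⟨k', h3⟩ := (hv.isLocal ⁅(a : E), κ⁆).res_eq_sum n
    refine ⟨fun j => (C.kfld ⁅(a : E), κ⁆).1 (n + j) v + (C.kfld κ).1 n (us j), max k k',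
      fun j => (hv.mode _ _).add ((h1 j).mode _ _), fun N hN r hr => ?_⟩
    have h4 := C.commNeg_kfld a κ r hr
    simp only [Finset.range_one, Finset.sum_singleton, Ring.choose_zero_right, one_smul,
      Nat.cast_zero, sub_zero] at h4
    rw [hv.fld_mode, lcomp_res_sub_rcomp_res, h2 N (by lia) r hr, h4, res_shift_left, zero_add,
      h3 N (by lia), map_sum, ← Finset.sum_add_distrib]
    refine Finset.sum_congr rfl fun i _ => ?_
    beta_reduce
    rw [map_zsmul, res_shift_right, map_add, hv.fld_mode, (h1 i).fld_mode, map_add, smul_add]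

end StateMap
end SemidirectVertex
end

noncomputable section
namespace SemidirectVertex

open Fld

namespace Fld

variable {V : Type*} [AddCommGroup V] [Module ℂ V]

/-! ### Action of a field in the first variable -/

theorem prodA_lmul_left (η α β : Fld V) (m : ℤ) (w : V) (n p q : ℤ) :
    prodA (lmul (-m) 0 η α) β w n p q = seqAct η m (fun p => prodA α β w n p q) p := by
  have h := prodB_lmul_left η α β m w n q p
  have e : prodB α β w n q = fun p => (-1 : ℂ) ^ n • prodA α β w n p q := rfl
  rw [e, seqAct_smul η m (evZero_prodA_left α β w n q)] at h
  exact smul_right_injective V (zpow_ne_zero n (by norm_num : (-1 : ℂ) ≠ 0)) h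

/-- The transposed form of `CommNeg.prodA_lmul`; the sign comes from rewriting (x₂ - x₁)^(-m-j) in
powers of x₁ - x₂. -/
theorem CommNeg.seqAct_prodB {η β : Fld V} {N : ℕ} {βs : ℕ → Fld V} (h : CommNeg η β N βs) {m : ℤ}
    (hm : 0 < m) (α : Fld V) (w : V) (n p q : ℤ) :
    seqAct η m (fun p => prodB β α w n p q) p = prodB β (lmul (-m) 0 η α) w n p q +
      ∑ j ∈ Finset.range N, ((-1 : ℂ) ^ (m + j) * (Ring.choose (-m) j : ℤ)) •
        prodB (βs j) α w (n + (-m - j)) p q := by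
  have h1 := h.prodA_lmul hm α w n q p
  have e : (fun p => prodB β α w n p q) = fun p => (-1 : ℂ) ^ n • prodA β α w n q p := rfl
  rw [e, seqAct_smul η m (evZero_prodA β α w n q), prodB, h1, smul_sub, Finset.smul_sum]
  refine eq_add_of_sub_eq (sub_right_inj.2 (Finset.sum_congr rfl fun j _ => ?_))
  have h2 : (-1 : ℂ) ^ (m + (j : ℤ)) * (-1 : ℂ) ^ (n + (-m - (j : ℤ))) = (-1) ^ n := by
    rw [← zpow_add₀ (by norm_num)]; congr 1; ring
  rw [prodB, smul_smul, mul_right_comm, h2, mul_smul, Int.cast_smul_eq_zsmul ℂ]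
  rw [show n + (-m - (j : ℤ)) = n - m - j by ring]

/-- With x₁ = x₂ + x₀, the hypothesis is the expansion of (z - x₂ - x₀)^(-m) in powers of x₀. The
identity is checked at p = 0 and extended by uniqueness. -/
theorem prodC_seqAct {γ γ' : ℤ → Fld V} (hγ : SeqTrunc γ) {η : Fld V} {m : ℤ}
    (h : ∀ (n : ℤ) (k : ℕ), (∀ i : ℕ, k ≤ i → γ (n + i) = 0) → γ' n =
      ∑ i ∈ Finset.range k, signedChoose (-m) i • lmul (-m - i) 0 η (γ (n + i)))
    (w : V) (n p q : ℤ) :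
    prodC γ' w n p q = seqAct η m (fun p => prodC γ w n p q) p := by
  have hγ' : SeqTrunc γ' := by
    obtain ⟨N, hN⟩ := hγ
    exact ⟨N, fun n hn => by rw [h n 0 (fun i _ => hN _ (by lia)), Finset.sum_range_zero]⟩
  refine IsPascal.eq_of_middle (isPascal_prodC hγ' w)
    (isPascal_seqAct_middle η m (isPascal_prodC hγ w) (evZero_prodC_left hγ w))
    (fun n q => ?_) (prodC_bdd hγ' w) ?_ n p q
  · obtain ⟨k₁, h1⟩ : ∃ k : ℕ, ∀ i : ℕ, k ≤ i → γ (n + i) = 0 := by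
      obtain ⟨N, hN⟩ := hγ
      exact ⟨(N - n).toNat, fun i hi => hN _ (by lia)⟩
    choose M hM using fun i : ℕ => (γ (n + i)).2 w
    -- For i ≥ k₁ the field vanishes, and for the finitely many smaller i its modes do; hence all
    -- terms of large total degree i + j vanish.
    have h2 : ∀ i j : ℕ, k₁ + (∑ i ∈ Finset.range k₁, |M i| - q).toNat ≤ i + j →
        (γ (n + i)).1 (q + j) w = 0 := by
      intro i j hij
      rcases le_or_gt k₁ i with hi | hi
      · rw [h1 i hi]; rfl
      · have h3 : |M i| ≤ ∑ i ∈ Finset.range k₁, |M i| :=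
          Finset.single_le_sum (f := fun i : ℕ => |M i|) (fun _ _ => abs_nonneg _)
            (Finset.mem_range.2 hi)
        have h4 := le_abs_self (M i)
        exact hM i _ (by lia)
    generalize hk : k₁ + (∑ i ∈ Finset.range k₁, |M i| - q).toNat = k at h2
    -- For a natural exponent l the binomial expansion stops at i = l.
    have hC : ∀ l : ℕ, prodC γ w n l q =
        ∑ i ∈ Finset.range (l + 1), Ring.choose (l : ℤ) i • (γ (n + i)).1 (q + (l - i : ℕ)) w := by
      intro l
      unfold prodC expandMid
      rw [finsum_eq_sum_of_support_subset (s := Finset.range (l + 1))]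
      · refine Finset.sum_congr rfl fun i hi => ?_
        rw [show (l : ℤ) + q - i = q + (l - i : ℕ) by have := Finset.mem_range.1 hi; lia]
      · intro i hi
        rw [Finset.coe_range, Set.mem_Iio]
        by_contra hli
        refine hi ?_
        beta_reduce
        rw [Ring.choose_natCast, Nat.choose_eq_zero_of_lt (by lia), Nat.cast_zero, zero_smul]
    rw [prodC_zero, h n k (fun i hi => h1 i (by lia)), sum_apply,
      seqAct_eq_sum η m k (fun l hl => by
        rw [zero_add, hC]
        refine Finset.sum_eq_zero fun i hi => ?_
        have := Finset.mem_range.1 hi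
        rw [h2 i (l - i) (by lia), smul_zero])]
    have e : ∀ i ∈ Finset.range k, (signedChoose (-m) i • lmul (-m - i) 0 η (γ (n + i))).1 q w =
        ∑ j ∈ Finset.range (k - i), (signedChoose (-m) i * signedChoose (-m - i) j) •
          η.1 (-m - (i + j : ℕ)) ((γ (n + i)).1 (q + j) w) := by
      intro i _
      rw [zsmul_apply, lmul_apply]
      unfold prodA
      rw [expand_eq_sum (k - i) (fun j hj => by rw [h2 i j (by lia), map_zero]), Finset.smul_sum]
      refine Finset.sum_congr rfl fun j _ => ?_
      rw [smul_smul, zero_add, show -m - (i : ℤ) - j = -m - (i + j : ℕ) by push_cast; ring]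
    rw [Finset.sum_congr rfl e, ← Finset.sum_range_diag_flip k (fun i j =>
      (signedChoose (-m) i * signedChoose (-m - i) j) •
          η.1 (-m - (i + j : ℕ)) ((γ (n + i)).1 (q + j) w))]
    refine Finset.sum_congr rfl fun l _ => ?_
    rw [zero_add, hC, map_sum, Finset.smul_sum]
    refine Finset.sum_congr rfl fun i hi => ?_
    have hil : i + (l - i) = l := by have := Finset.mem_range.1 hi; lia
    have e2 : signedChoose (-m) i * signedChoose (-m - i) (l - i) =
        signedChoose (-m) l * Ring.choose (l : ℤ) i := by
      have := choose_mul_choose_sub (-m) i (l - i)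
      rw [hil] at this
      unfold signedChoose
      rw [mul_mul_mul_comm, ← pow_add, this, hil, Ring.choose_natCast]
      ring
    rw [map_zsmul, smul_smul, hil, e2]
  · obtain ⟨N, hN⟩ := prodC_bdd hγ w
    refine ⟨N, fun n p q hn => ?_⟩
    exact seqAct_eq_zero η m (S := fun p => prodC γ w n p q) (N := p)
      (fun p _ => hN n p q hn) le_rfl

/-! ### Commutators of actions in the two variables -/

/-- The coefficients of the product of `Res_z (z - x₁)^n (z - x₂)^n' z^r c(z)` with the
series `T(x₁, x₂)`. -/
def mixAct (c : Fld V) (n n' r : ℤ) (T : ℤ → ℤ → V) (p q : ℤ) : V :=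
  expand (fun r p => expand (fun s q => c.1 s (T p q)) n' r q) n r p

/-- The bound `k'` does not depend on i, because T is zero beyond finitely many first indices. -/
theorem exists_support_bounds {M : Type*} [AddCommGroup M] {T : ℤ → ℤ → M}
    (hp : ∃ N : ℤ, ∀ p q, N ≤ p → T p q = 0)
    (hq : ∀ p, ∃ N : ℤ, ∀ q, N ≤ q → T p q = 0) (p q : ℤ) : ∃ k k' : ℕ, (∀ i : ℕ, k ≤ i → ∀ q, T (p + i) q = 0) ∧
      ∀ i j : ℕ, k' ≤ j → T (p + i) (q + j) = 0 := by
  obtain ⟨N, hN⟩ := hp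
  choose L hL using fun i : ℕ => hq (p + i)
  refine ⟨(N - p).toNat, (∑ i ∈ Finset.range (N - p).toNat, |L i| - q).toNat,
    fun i hi q => hN _ _ (by lia), fun i j hj => ?_⟩
  rcases le_or_gt (N - p).toNat i with hi | hi
  · exact hN _ _ (by lia)
  · have h3 : |L i| ≤ ∑ i ∈ Finset.range (N - p).toNat, |L i| :=
      Finset.single_le_sum (f := fun i : ℕ => |L i|) (fun _ _ => abs_nonneg _)
        (Finset.mem_range.2 hi)
    have h4 := le_abs_self (L i)
    exact hL i _ (by lia)

section MixAct

variable (c : Fld V) {T : ℤ → ℤ → V}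

theorem mixAct_zero_right (n : ℤ) (p q : ℤ) :
    mixAct c n 0 0 T p q = seqAct c (-n) (fun p => T p q) p := by
  unfold mixAct seqAct
  simp only [expand_zero, neg_neg]

theorem mixAct_zero_left (n : ℤ) (p q : ℤ) : mixAct c 0 n 0 T p q = seqAct c (-n) (T p) q := by
  unfold mixAct seqAct
  rw [expand_zero, neg_neg]

theorem mixAct_add_one_left (hp : ∃ N : ℤ, ∀ p q, N ≤ p → T p q = 0) (n n' r p q : ℤ) :
    mixAct c (n + 1) n' r T p q = mixAct c n n' (r + 1) T p q - mixAct c n n' r T (p + 1) q := by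
  refine isPascal_expand ?_ n r p
  obtain ⟨N, hN⟩ := hp
  refine ⟨N, fun r p hp => ?_⟩
  beta_reduce
  rw [expand_eq_sum 0 (fun i _ => by rw [hN p _ hp, map_zero]), Finset.sum_range_zero]

theorem mixAct_eq_sum {k k' : ℕ} {p q : ℤ} (hk : ∀ i : ℕ, k ≤ i → ∀ q, T (p + i) q = 0)
    (hk' : ∀ i j : ℕ, k' ≤ j → T (p + i) (q + j) = 0) (n n' r : ℤ) :
    mixAct c n n' r T p q = ∑ i ∈ Finset.range k, ∑ j ∈ Finset.range k',
      (signedChoose n i * signedChoose n' j) • c.1 (r + n - i + n' - j) (T (p + i) (q + j)) := by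
  unfold mixAct
  rw [expand_eq_sum k (fun i hi => by
    rw [expand_eq_sum 0 (fun j _ => by rw [hk i hi, map_zero]), Finset.sum_range_zero])]
  refine Finset.sum_congr rfl fun i _ => ?_
  rw [expand_eq_sum k' (fun j hj => by rw [hk' i j hj, map_zero]), Finset.smul_sum]
  simp only [smul_smul]

theorem mixAct_add_one_right (hp : ∃ N : ℤ, ∀ p q, N ≤ p → T p q = 0) (hq : ∀ p, EvZero (T p))
    (n n' r p q : ℤ) :
    mixAct c n (n' + 1) r T p q = mixAct c n n' (r + 1) T p q - mixAct c n n' r T p (q + 1) := by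
  obtain ⟨k, k', h1, h2⟩ := exists_support_bounds hp hq p q
  have key : ∀ p, expand (fun s q => c.1 s (T p q)) (n' + 1) = fun r q =>
      expand (fun s q => c.1 s (T p q)) n' (r + 1) q -
        expand (fun s q => c.1 s (T p q)) n' r (q + 1) := fun p =>
    funext₂ fun r q => isPascal_expand ((hq p).bddRight c) n' r q
  have hz : ∀ i : ℕ, k ≤ i → ∀ n' r q, expand (fun s q => c.1 s (T (p + i) q)) n' r q = 0 :=
    fun i hi n' r q => by
      rw [expand_eq_sum 0 (fun j _ => by rw [h1 i hi, map_zero]), Finset.sum_range_zero]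
  unfold mixAct
  rw [expand_eq_sum k (fun i hi => hz i hi _ _ _), expand_eq_sum k (fun i hi => hz i hi _ _ _),
    expand_eq_sum k (fun i hi => hz i hi _ _ _), ← Finset.sum_sub_distrib]
  refine Finset.sum_congr rfl fun i _ => ?_
  rw [key, ← smul_sub, show r + 1 + n - (i : ℤ) = r + n - i + 1 by ring]

theorem mixAct_sub {T' : ℤ → ℤ → V} (hp : ∃ N : ℤ, ∀ p q, N ≤ p → T p q = 0)
    (hq : ∀ p, EvZero (T p)) (hp' : ∃ N : ℤ, ∀ p q, N ≤ p → T' p q = 0)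
    (hq' : ∀ p, EvZero (T' p)) (n n' r p q : ℤ) :
    mixAct c n n' r (fun p q => T p q - T' p q) p q =
      mixAct c n n' r T p q - mixAct c n n' r T' p q := by
  obtain ⟨k, k', h1, h2⟩ := exists_support_bounds hp hq p q
  obtain ⟨l, l', h1', h2'⟩ := exists_support_bounds hp' hq' p q
  rw [mixAct_eq_sum c (k := max k l) (k' := max k' l')
      (fun i hi q => by rw [h1 i (by lia), h1' i (by lia), sub_zero])
      (fun i j hj => by rw [h2 i j (by lia), h2' i j (by lia), sub_zero]),
    mixAct_eq_sum c (k := max k l) (k' := max k' l') (fun i hi q => h1 i (by lia) q)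
      (fun i j hj => h2 i j (by lia)),
    mixAct_eq_sum c (k := max k l) (k' := max k' l') (fun i hi q => h1' i (by lia) q)
      (fun i j hj => h2' i j (by lia)), ← Finset.sum_sub_distrib]
  refine Finset.sum_congr rfl fun i _ => ?_
  rw [← Finset.sum_sub_distrib]
  simp only [map_sub, smul_sub]

theorem mixAct_shift (T : ℤ → ℤ → V) (n n' r p q a b : ℤ) :
    mixAct c n n' r (fun p q => T (p + a) (q + b)) p q = mixAct c n n' r T (p + a) (q + b) := by
  have h1 : ∀ p q r, expand (fun s q => c.1 s (T p (q + b))) n' r q =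
      expand (fun s q => c.1 s (T p q)) n' r (q + b) := fun p q r => by
    have := expand_shift (fun s q => c.1 s (T p q)) 0 b n' r q
    simp only [add_zero] at this
    exact this
  have := expand_shift (fun r p => expand (fun s q => c.1 s (T p q)) n' r (q + b)) 0 a n r p
  simp only [add_zero] at this
  unfold mixAct
  simp only [h1]
  exact this

/-- The relation x₁ - x₂ = (z - x₂) - (z - x₁), which is the source of the partial fraction
decomposition. -/
theorem mixAct_pascal {T : ℤ → ℤ → ℤ → V} (hT : IsPascal T)
    (hp : ∀ m, ∃ N : ℤ, ∀ p q, N ≤ p → T m p q = 0) (hq : ∀ m p, EvZero (T m p))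
    (m n n' r p q : ℤ) :
    mixAct c n n' r (T (m + 1)) p q =
      mixAct c n (n' + 1) r (T m) p q - mixAct c (n + 1) n' r (T m) p q := by
  have e : T (m + 1) = fun p q => T m (p + 1) (q + 0) - T m (p + 0) (q + 1) :=
    funext₂ fun p q => by rw [add_zero, add_zero]; exact hT m p q
  rw [e, mixAct_sub c _ _ _ _, mixAct_shift, mixAct_shift, mixAct_add_one_left c (hp m),
    mixAct_add_one_right c (hp m) (hq m), add_zero, add_zero]
  · abel
  · obtain ⟨N, hN⟩ := hp m
    exact ⟨N - 1, fun p q h => hN _ _ (by lia)⟩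
  · intro p
    exact (hq m (p + 1)).comp_add 0
  · obtain ⟨N, hN⟩ := hp m
    exact ⟨N, fun p q h => hN _ _ (by lia)⟩
  · intro p
    exact (hq m (p + 0)).comp_add 1

/-- Expanding both actions, each commutator of modes is one mode of ζ, and the coefficients are
those of (z - x₁)^(-m) (z - x₂)^(-m'). -/
theorem seqAct_comm {η ξ ζ : Fld V}
    (h : ∀ m n : ℤ, m < 0 → n < 0 → ∀ w, η.1 m (ξ.1 n w) - ξ.1 n (η.1 m w) = ζ.1 (m + n) w)
    {m m' : ℤ} (hm : 0 < m) (hm' : 0 < m') (hp : ∃ N : ℤ, ∀ p q, N ≤ p → T p q = 0)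
    (hq : ∀ p, EvZero (T p)) (p q : ℤ) :
    seqAct η m (fun p => seqAct ξ m' (T p) q) p =
      seqAct ξ m' (fun q => seqAct η m (fun p => T p q) p) q + mixAct ζ (-m) (-m') 0 T p q := by
  obtain ⟨k, k', h1, h2⟩ := exists_support_bounds hp hq p q
  have e1 : ∀ i : ℕ, seqAct ξ m' (T (p + i)) q = ∑ j ∈ Finset.range k',
      signedChoose (-m') j • ξ.1 (-m' - j) (T (p + i) (q + j)) := fun i =>
    seqAct_eq_sum ξ m' k' fun j hj => h2 i j hj
  have e2 : ∀ q, seqAct η m (fun p => T p q) p = ∑ i ∈ Finset.range k,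
      signedChoose (-m) i • η.1 (-m - i) (T (p + i) q) := fun q =>
    seqAct_eq_sum η m k fun i hi => h1 i hi q
  rw [mixAct_eq_sum ζ h1 h2, seqAct_eq_sum η m k (fun i hi => by
      rw [e1]; exact Finset.sum_eq_zero fun j _ => by rw [h1 i hi, map_zero, smul_zero]),
    seqAct_eq_sum ξ m' k' (fun j hj => by
      rw [e2]; exact Finset.sum_eq_zero fun i _ => by rw [h2 i j hj, map_zero, smul_zero])]
  simp only [e1, e2, map_sum, map_zsmul, Finset.smul_sum, smul_smul]
  rw [Finset.sum_comm (s := Finset.range k') (t := Finset.range k), ← Finset.sum_add_distrib]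
  refine Finset.sum_congr rfl fun i _ => ?_
  rw [← Finset.sum_add_distrib]
  refine Finset.sum_congr rfl fun j _ => ?_
  rw [show 0 + -m - (i : ℤ) + -m' - j = -m - i + (-m' - j) by ring, ← h _ _ (by lia) (by lia),
    mul_comm (signedChoose (-m') j), ← smul_add, add_sub_cancel]

end MixAct

end Fld
end SemidirectVertex
end

noncomputable section
namespace SemidirectVertex

open Fld

/-! ### The span of exchanged products -/

namespace StateMap

variable {E : Type*} [LieRing E] [LieAlgebra ℂ E] {K : LieIdeal ℂ E} {g : LieSubalgebra ℂ E}
  {V : Type*} [AddCommGroup V] [Module ℂ V] {C : CurrentFields K g V} (S : StateMap C)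

/-- The span of the products of fields of two vectors in exchanged order. -/
def exchangeSpan : Submodule ℂ (V → ℤ → ℤ → ℤ → V) :=
  Submodule.span ℂ {T | ∃ (v u : V) (k : ℤ),
    T = fun w n p q => prodB (S.fld v) (S.fld u) w (n + k) p q}

variable {S}

theorem prodB_mem_exchangeSpan (v u : V) (k : ℤ) :
    (fun w n p q => prodB (S.fld v) (S.fld u) w (n + k) p q) ∈ S.exchangeSpan :=
  Submodule.subset_span ⟨v, u, k, rfl⟩

theorem prodB_mem_exchangeSpan' (v u : V) : prodB (S.fld v) (S.fld u) ∈ S.exchangeSpan := by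
  have := prodB_mem_exchangeSpan (S := S) v u 0
  simp only [add_zero] at this
  exact this

/-- Stability under multiplication by (x₁ - x₂)^j for every integer j; negative j are what partial
fractions use. -/
theorem shift_mem_exchangeSpan {T : V → ℤ → ℤ → ℤ → V} (hT : T ∈ S.exchangeSpan) (j : ℤ) :
    (fun w n p q => T w (n + j) p q) ∈ S.exchangeSpan := by
  induction hT using Submodule.span_induction with
  | mem T hT =>
    obtain ⟨v, u, k, rfl⟩ := hT
    have := prodB_mem_exchangeSpan (S := S) v u (j + k)
    simp only [← add_assoc] at this
    exact this
  | zero => exact zero_mem _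
  | add T U _ _ hT hU => exact add_mem hT hU
  | smul c T _ hT => exact Submodule.smul_mem _ c hT

theorem evZero_of_mem_exchangeSpan {T : V → ℤ → ℤ → ℤ → V} (hT : T ∈ S.exchangeSpan) (w : V)
    (n : ℤ) : (∀ p, EvZero (T w n p)) ∧ ∀ q, EvZero fun p => T w n p q := by
  induction hT using Submodule.span_induction with
  | mem T hT =>
    obtain ⟨v, u, k, rfl⟩ := hT
    exact ⟨fun p => evZero_prodB _ _ w _ p, fun q => evZero_prodB_left _ _ w _ q⟩
  | zero => exact ⟨fun p => ⟨0, fun _ _ => rfl⟩, fun q => ⟨0, fun _ _ => rfl⟩⟩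
  | add T U _ _ hT hU =>
    exact ⟨fun p => (hT.1 p).add (hU.1 p), fun q => (hT.2 q).add (hU.2 q)⟩
  | smul c T _ hT => exact ⟨fun p => (hT.1 p).smul c, fun q => (hT.2 q).smul c⟩

/-- In the variable x₂ the half current stands next to the field of v and is absorbed by replacing v
with a(-m)v. -/
theorem seqAct_right_mem_exchangeSpan (a : g) {m : ℤ} (hm : 0 < m) {T : V → ℤ → ℤ → ℤ → V}
    (hT : T ∈ S.exchangeSpan) :
    (fun w n p q => seqAct (C.gfld a) m (T w n p) q) ∈ S.exchangeSpan := by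
  induction hT using Submodule.span_induction with
  | mem T hT =>
    obtain ⟨v, u, k, rfl⟩ := hT
    have := prodB_mem_exchangeSpan (S := S) ((C.gfld a).1 (-m) v) u k
    simp only [S.fld_gfld a m v hm, prodB_lmul_left] at this
    exact this
  | zero =>
    convert S.exchangeSpan.zero_mem using 1
    funext w n p q
    exact seqAct_eq_zero _ _ (S := fun _ => 0) (fun _ _ => rfl) le_rfl
  | add T U hT' hU' hT hU =>
    convert add_mem hT hU using 1
    funext w n p q
    exact seqAct_add _ _ ((evZero_of_mem_exchangeSpan hT' w n).1 p)
      ((evZero_of_mem_exchangeSpan hU' w n).1 p) q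
  | smul c T hT' hT =>
    convert Submodule.smul_mem _ c hT using 1
    funext w n p q
    exact seqAct_smul _ _ ((evZero_of_mem_exchangeSpan hT' w n).1 p) c q

/-- Partial fractions lower the total order m + m' by one at the price of a factor (x₁ - x₂)⁻¹,
until one exponent is zero and the action is in a single variable. -/
theorem mixAct_mem_exchangeSpan (v u : V)
    (h : ∀ (c : g) (m : ℤ), 0 < m → (fun w n p q => seqAct (C.gfld c) m
      (fun p => prodB (S.fld v) (S.fld u) w n p q) p) ∈ S.exchangeSpan)
    (c : g) (s : ℕ) (m m' : ℕ) (hs : m + m' = s + 1) :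
    (fun w n p q => mixAct (C.gfld c) (-m) (-m') 0 (prodB (S.fld v) (S.fld u) w n) p q) ∈
      S.exchangeSpan := by
  induction s generalizing m m' with
  | zero =>
    obtain ⟨rfl, rfl⟩ | ⟨rfl, rfl⟩ : m = 1 ∧ m' = 0 ∨ m = 0 ∧ m' = 1 := by lia
    · simp only [Nat.cast_zero, neg_zero, mixAct_zero_right, neg_neg]
      exact h c _ (by lia)
    · simp only [Nat.cast_zero, neg_zero, mixAct_zero_left, neg_neg]
      exact seqAct_right_mem_exchangeSpan c (by lia) (prodB_mem_exchangeSpan' v u)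
  | succ s ih =>
    rcases m with _ | m
    · simp only [Nat.cast_zero, neg_zero, mixAct_zero_left, neg_neg]
      exact seqAct_right_mem_exchangeSpan c (by lia) (prodB_mem_exchangeSpan' v u)
    rcases m' with _ | m'
    · simp only [Nat.cast_zero, neg_zero, mixAct_zero_right, neg_neg]
      exact h c _ (by lia)
    have h1 := ih (m + 1) m' (by lia)
    have h2 := ih m (m' + 1) (by lia)
    convert shift_mem_exchangeSpan (sub_mem h1 h2) (-1) using 1
    funext w n p q
    obtain ⟨N, hN⟩ := prodB_bdd (S.fld u) (S.fld v) w
    have := mixAct_pascal (C.gfld c) (isPascal_prodB (S.fld u) (S.fld v) w)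
      (fun n => ⟨N, fun p q hp => hN n p q hp⟩) (fun n p => evZero_prodB _ _ w n p)
      (n + -1) (-(m + 1 : ℕ)) (-(m' + 1 : ℕ)) 0 p q
    rw [neg_add_cancel_right, show -((m' + 1 : ℕ) : ℤ) + 1 = -(m' : ℤ) by push_cast; ring,
      show -((m + 1 : ℕ) : ℤ) + 1 = -(m : ℤ) by push_cast; ring] at this
    exact this

/-- In x₁ the half current has to pass the field of v. If v comes from K, the commutator consists of
fields of vectors of K. If v = b(-m')v', the half currents commute up to a mixed action of ⁅a, b⁆,
so the induction must cover all elements of g. -/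
theorem seqAct_left_prodB_mem (a : g) {m : ℤ} (hm : 0 < m) (v u : V) :
    (fun w n p q => seqAct (C.gfld a) m (fun p => prodB (S.fld v) (S.fld u) w n p q) p) ∈
      S.exchangeSpan := by
  induction v using S.induct generalizing a m with
  | ideal v hv =>
    obtain ⟨vs, k, -, h⟩ := hv.exists_commNeg a
    simp only [(h k le_rfl).seqAct_prodB hm, ← S.fld_gfld a m u hm]
    refine add_mem (prodB_mem_exchangeSpan' v _) ?_
    have := S.exchangeSpan.sum_mem (t := Finset.range k) fun j _ =>
      S.exchangeSpan.smul_mem ((-1 : ℂ) ^ (m + j) * (Ring.choose (-m) j : ℤ))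
        (prodB_mem_exchangeSpan (vs j) u (-m - j))
    convert this using 1
    funext w n p q
    simp only [Finset.sum_apply, Pi.smul_apply]
  | add v v' hv hv' =>
    convert add_mem (hv a hm) (hv' a hm) using 1
    funext w n p q
    refine Eq.trans ?_ (seqAct_add _ _ (evZero_prodB_left _ _ w n q)
      (evZero_prodB_left _ _ w n q) p)
    congr 1
    funext p
    rw [map_add]
    exact congrArg (fun f : Fld V => f.1 q w) (map_add (rmul n p (S.fld u)) _ _)
  | smul c v hv =>
    convert Submodule.smul_mem _ c (hv a hm) using 1
    funext w n p q
    refine Eq.trans ?_ (seqAct_smul _ _ (evZero_prodB_left _ _ w n q) c p)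
    congr 1
    funext p
    rw [map_smul]
    exact congrArg (fun f : Fld V => f.1 q w) (map_smul (rmul n p (S.fld u)) c _)
  | neg b m' hm' v hv =>
    have h1 := seqAct_right_mem_exchangeSpan b hm' (hv a hm)
    have h2 := mixAct_mem_exchangeSpan v u (fun c m hm => hv c hm) ⁅a, b⁆
      (m.toNat + m'.toNat - 1) m.toNat m'.toNat (by lia)
    convert add_mem h1 h2 using 1
    funext w n p q
    obtain ⟨N, hN⟩ := prodB_bdd (S.fld u) (S.fld v) w
    simp only [S.fld_gfld b m' v hm', prodB_lmul_left]
    have := seqAct_comm (fun m n hm hn w => C.gfld_gfld a b m n w hm hn) hm hm'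
      (T := prodB (S.fld v) (S.fld u) w n) ⟨N, fun p q hp => hN n p q hp⟩
      (fun p => evZero_prodB _ _ w n p) p q
    rw [this]
    simp only [Pi.add_apply, Int.toNat_of_nonneg hm.le, Int.toNat_of_nonneg hm'.le]

theorem seqAct_left_mem_exchangeSpan (a : g) {m : ℤ} (hm : 0 < m) {T : V → ℤ → ℤ → ℤ → V}
    (hT : T ∈ S.exchangeSpan) :
    (fun w n p q => seqAct (C.gfld a) m (fun p => T w n p q) p) ∈ S.exchangeSpan := by
  induction hT using Submodule.span_induction with
  | mem T hT =>
    obtain ⟨v, u, k, rfl⟩ := hT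
    exact shift_mem_exchangeSpan (seqAct_left_prodB_mem a hm v u) k
  | zero =>
    convert S.exchangeSpan.zero_mem using 1
    funext w n p q
    exact seqAct_eq_zero _ _ (S := fun _ => 0) (fun _ _ => rfl) le_rfl
  | add T U hT' hU' hT hU =>
    convert add_mem hT hU using 1
    funext w n p q
    exact seqAct_add _ _ ((evZero_of_mem_exchangeSpan hT' w n).2 q)
      ((evZero_of_mem_exchangeSpan hU' w n).2 q) p
  | smul c T hT' hT =>
    convert Submodule.smul_mem _ c hT using 1
    funext w n p q
    exact seqAct_smul _ _ ((evZero_of_mem_exchangeSpan hT' w n).2 q) c p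

/-! ### The Jacobi identity -/

theorem seqTrunc_fld (α : Fld V) (v : V) : SeqTrunc fun n => S.fld (α.1 n v) := by
  obtain ⟨N, hN⟩ := α.2 v
  exact ⟨N, fun n hn => by beta_reduce; rw [hN n hn, map_zero]⟩

variable (S) in
/-- The difference of the product and the iterate of the fields of two vectors. -/
def assocDefect (u v w : V) (n p q : ℤ) : V :=
  prodA (S.fld u) (S.fld v) w n p q - prodC (fun n => S.fld ((S.fld u).1 n v)) w n p q

theorem assocDefect_add_left (u u' v : V) :
    S.assocDefect (u + u') v = S.assocDefect u v + S.assocDefect u' v := by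
  funext w n p q
  simp only [assocDefect, map_add, prodA_add_left, Fld.add_apply, Pi.add_apply]
  rw [prodC_add (seqTrunc_fld _ _) (seqTrunc_fld _ _)]
  abel

theorem assocDefect_add_right (u v v' : V) :
    S.assocDefect u (v + v') = S.assocDefect u v + S.assocDefect u v' := by
  funext w n p q
  simp only [assocDefect, map_add, prodA_add_right, Pi.add_apply]
  rw [prodC_add (seqTrunc_fld _ _) (seqTrunc_fld _ _)]
  abel

theorem assocDefect_smul_left (c : ℂ) (u v : V) :
    S.assocDefect (c • u) v = c • S.assocDefect u v := by
  funext w n p q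
  simp only [assocDefect, map_smul, prodA_smul_left, Fld.smul_apply, Pi.smul_apply]
  rw [prodC_smul (seqTrunc_fld _ _), smul_sub]

theorem assocDefect_smul_right (c : ℂ) (u v : V) :
    S.assocDefect u (c • v) = c • S.assocDefect u v := by
  funext w n p q
  simp only [assocDefect, map_smul, prodA_smul_right, Pi.smul_apply]
  rw [prodC_smul (seqTrunc_fld _ _), smul_sub]

/-- Moving the half current past the field of u gives the same kind of correction in the product and
in the iterate, so the defects satisfy a closed recursion. -/
theorem assocDefect_gfld_right {u : V} {a : g} {us : ℕ → V} {N : ℕ}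
    (h : CommNeg (C.gfld a) (S.fld u) N fun j => S.fld (us j)) {m : ℤ} (hm : 0 < m)
    (v w : V) (n p q : ℤ) : S.assocDefect u ((C.gfld a).1 (-m) v) w n p q =
      seqAct (C.gfld a) m (S.assocDefect u v w n p) q -
      ∑ j ∈ Finset.range N, Ring.choose (-m) j • S.assocDefect (us j) v w (n + (-m - j)) p q := by
  have hγ : (fun n => S.fld ((S.fld u).1 n ((C.gfld a).1 (-m) v))) = fun n =>
      lmul (-m) 0 (C.gfld a) (S.fld ((S.fld u).1 n v)) -
        ∑ j ∈ Finset.range N, Ring.choose (-m) j • S.fld ((S.fld (us j)).1 (n + (-m - j)) v) := by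
    funext n
    have := sub_eq_iff_eq_add.2 (sub_eq_iff_eq_add'.1 (h.apply (r := -m) (by lia) n v))
    rw [← this, map_sub, S.fld_gfld a m _ hm, map_sum]
    simp only [map_zsmul]
  have hsum : ∀ k ≤ N, SeqTrunc (fun n => ∑ j ∈ Finset.range k,
        Ring.choose (-m) j • S.fld ((S.fld (us j)).1 (n + (-m - j)) v)) ∧ ∀ n p q,
      prodC (fun n => ∑ j ∈ Finset.range k,
        Ring.choose (-m) j • S.fld ((S.fld (us j)).1 (n + (-m - j)) v)) w n p q =
      ∑ j ∈ Finset.range k, Ring.choose (-m) j •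
        prodC (fun n => S.fld ((S.fld (us j)).1 n v)) w (n + (-m - j)) p q := by
    intro k _
    induction k with
    | zero =>
      simp only [Finset.sum_range_zero]
      refine ⟨⟨0, fun _ _ => rfl⟩, fun n p q => ?_⟩
      unfold prodC
      rw [expandMid_eq_sum 0 (fun i _ => by simp)]
      simp
    | succ k ih =>
      obtain ⟨h1, h2⟩ := ih (by lia)
      have h3 : SeqTrunc fun n => S.fld ((S.fld (us k)).1 (n + (-m - k)) v) :=
        (seqTrunc_fld (S := S) (S.fld (us k)) v).comp_add (-m - k)
      simp only [Finset.sum_range_succ, ← Int.cast_smul_eq_zsmul ℂ (Ring.choose (-m) k)]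
      refine ⟨h1.add (h3.smul _), fun n p q => ?_⟩
      rw [prodC_add h1 (h3.smul _), h2, prodC_smul h3]
      congr 2
      exact prodC_comp_add (fun n => S.fld ((S.fld (us k)).1 n v)) (-m - k) w n p q
  have e : S.assocDefect u v w n p = fun q => prodA (S.fld u) (S.fld v) w n p q -
    prodC (fun n => S.fld ((S.fld u).1 n v)) w n p q := rfl
  rw [e, seqAct_sub _ _ (evZero_prodA _ _ w n p) (evZero_prodC (seqTrunc_fld _ _) w n p)]
  unfold assocDefect
  rw [hγ, prodC_sub ((seqTrunc_fld _ _).map _) (hsum N le_rfl).1, (hsum N le_rfl).2,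
    prodC_lmul (seqTrunc_fld _ _), S.fld_gfld a m v hm, h.prodA_lmul hm]
  simp only [smul_sub, Finset.sum_sub_distrib, ← add_sub_assoc, ← sub_eq_add_neg]
  abel

theorem assocDefect_gfld_left (a : g) {m : ℤ} (hm : 0 < m) (u v w : V) (n p q : ℤ) :
    S.assocDefect ((C.gfld a).1 (-m) u) v w n p q =
      seqAct (C.gfld a) m (fun p => S.assocDefect u v w n p q) p := by
  unfold assocDefect
  rw [seqAct_sub _ _ (evZero_prodA_left _ _ w n q) (evZero_prodC_left (seqTrunc_fld _ _) w n q),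
    S.fld_gfld a m u hm, prodA_lmul_left]
  congr 1
  refine prodC_seqAct (seqTrunc_fld _ _) (fun n k hk => ?_) w n p q
  -- The field determines its vector by the creation property, so a vanishing field comes from the
  -- zero vector.
  have hk' : ∀ i : ℕ, k ≤ i → (S.fld u).1 (n + i) v = 0 := fun i hi => by
    have := (S.creation ((S.fld u).1 (n + i) v)).2
    rw [hk i hi] at this
    exact this.symm
  rw [lmul_eq_seqAct, seqAct_eq_sum _ _ k hk', map_sum]
  refine Finset.sum_congr rfl fun i _ => ?_
  rw [map_zsmul, show -m - (i : ℤ) = -(m + i) by ring, S.fld_gfld a (m + i) _ (by lia)]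

/-- For u and v generated by K the Jacobi identity of local fields makes the defect equal to the
exchanged product. Half currents on v, then on u, act on the defect by operations that preserve the
span. -/
theorem assocDefect_mem (u v : V) : S.assocDefect u v ∈ S.exchangeSpan := by
  induction u using S.induct generalizing v with
  | ideal u hu =>
    induction v using S.induct generalizing u with
    | ideal v hv =>
      convert prodB_mem_exchangeSpan' (S := S) v u using 1
      funext w n p q
      have h := (hv.products hu).1.jacobi w n p q
      simp only [((hv.products hu).2 _).2] at h
      exact sub_eq_iff_eq_add.2 (sub_eq_iff_eq_add'.1 h)
    | add v v' hv hv' => rw [assocDefect_add_right]; exact add_mem (hv u hu) (hv' u hu)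
    | smul c v hv => rw [assocDefect_smul_right]; exact Submodule.smul_mem _ c (hv u hu)
    | neg a m hm v hv =>
      obtain ⟨us, k, hus, h⟩ := hu.exists_commNeg a
      have h1 := seqAct_right_mem_exchangeSpan a hm (hv u hu)
      have h2 := S.exchangeSpan.sum_mem (t := Finset.range k) fun j _ =>
        S.exchangeSpan.toAddSubgroup.zsmul_mem
          (shift_mem_exchangeSpan (hv (us j) (hus j)) (-m - j)) (Ring.choose (-m) j)
      convert sub_mem h1 h2 using 1
      funext w n p q
      rw [assocDefect_gfld_right (h k le_rfl) hm]
      simp only [Pi.sub_apply, Finset.sum_apply, Pi.smul_apply]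
  | add u u' hu hu' => rw [assocDefect_add_left]; exact add_mem (hu v) (hu' v)
  | smul c u hu => rw [assocDefect_smul_left]; exact Submodule.smul_mem _ c (hu v)
  | neg a m hm u hu =>
    convert seqAct_left_mem_exchangeSpan a hm (hu v) using 1
    funext w n p q
    exact assocDefect_gfld_left a hm u v w n p q

end StateMap
end SemidirectVertex
end

noncomputable section
namespace SemidirectVertex

open Fld VertexOperator

/-! ### Fields as vertex operators -/

section VertexOperators

variable {V : Type*} [AddCommGroup V] [Module ℂ V]

theorem ncoeff_injective {A B : VertexOperator ℂ V} (h : ∀ n w, ncoeff A n w = ncoeff B n w) :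
    A = B := by
  refine HVertexOperator.coeff_inj (funext fun n => LinearMap.ext fun w => ?_)
  rw [coeff_eq_ncoeff, coeff_eq_ncoeff]
  exact h _ w

/-- Fields, given by their modes, are the same as vertex operators. -/
def fldEquiv : Fld V ≃ₗ[ℂ] VertexOperator ℂ V where
  -- The coefficient of x^n is the mode with index -n - 1.
  toFun α := of_coeff (fun n => α.1 (-n - 1)) fun w => by
    obtain ⟨N, hN⟩ := α.2 w
    refine ⟨-N, fun n hn => ?_⟩
    by_contra h
    exact hn (hN _ (by lia))
  map_add' α β := ncoeff_injective fun n w => by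
    rw [map_add, Pi.add_apply, LinearMap.add_apply]
    simp only [ncoeff_of_coeff]
    rfl
  map_smul' c α := ncoeff_injective fun n w => by
    rw [map_smul, Pi.smul_apply, LinearMap.smul_apply]
    simp only [ncoeff_of_coeff]
    rfl
  invFun A := ⟨ncoeff A, fun w =>
    ⟨-(HahnSeries.order ((HahnModule.of ℂ).symm (A w))), fun n hn =>
      ncoeff_eq_zero_of_lt_order A n w (by lia)⟩⟩
  left_inv α := by
    ext n w
    simp only [ncoeff_of_coeff]
    rw [show -(-n - 1) - 1 = n by ring]
  right_inv A := ncoeff_injective fun n w => by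
    simp only [ncoeff_of_coeff]
    rw [show -(-n - 1) - 1 = n by ring]

theorem ncoeff_fldEquiv (α : Fld V) (n : ℤ) : ncoeff (fldEquiv α) n = α.1 n :=
  congrArg (fun β : Fld V => β.1 n) (fldEquiv.symm_apply_apply α)

/-- The fields of vectors given by a linear map to vertex operators. -/
def fldMap (Y : V →ₗ[ℂ] VertexOperator ℂ V) : V →ₗ[ℂ] Fld V := fldEquiv.symm.toLinearMap ∘ₗ Y

theorem fldMap_mode (Y : V →ₗ[ℂ] VertexOperator ℂ V) (v : V) :
    (fldMap Y v).1 = ncoeff (Y v) := rfl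

theorem fldEquiv_fldMap (Y : V →ₗ[ℂ] VertexOperator ℂ V) (v : V) :
    fldEquiv (fldMap Y v) = Y v := fldEquiv.apply_symm_apply (Y v)

variable (Y : V →ₗ[ℂ] VertexOperator ℂ V) (u v w : V) (n p q : ℤ)

theorem jacobiLeft_eq_prodA :
    jacobiLeft Y u v w n p q = prodA (fldMap Y u) (fldMap Y v) w n p q := rfl

theorem jacobiIterate_eq_prodC : jacobiIterate Y u v w n p q =
    prodC (fun n => fldMap Y ((fldMap Y u).1 n v)) w n p q := by
  unfold jacobiIterate prodC expandMid
  refine finsum_congr fun i => ?_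
  rw [signedChoose_sub_one]
  rfl

/-- The series enters as f(-x₀), so the sign in the monomial makes f(-x₀) = c x₀^k. Multiplication
by x₀^k is the shift n ↦ n + k of the exchanged product. -/
theorem jacobiRight_single (k : ℤ) (c : ℂ) :
    jacobiRight (HahnSeries.single k (c * (-1) ^ k)) Y v u w n p q =
      c • prodB (fldMap Y v) (fldMap Y u) w (n + k) p q := by
  obtain ⟨N, hN⟩ := (fldMap Y u).2 w
  have hN' : ∀ i : ℕ, (N - p).toNat ≤ i → ncoeff (Y u) (p + i) w = 0 := fun i hi => hN _ (by lia)
  unfold jacobiRight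
  rw [finsum_eq_sum_of_support_subset (s := Finset.range (N - p).toNat ×ˢ {k})]
  · rw [Finset.sum_product]
    simp only [Finset.sum_singleton]
    unfold prodB prodA
    rw [expand_eq_sum (N - p).toNat (fun i hi => by
      change ncoeff (Y v) _ (ncoeff (Y u) (p + i) w) = 0
      rw [hN' i hi, map_zero]), smul_smul, Finset.smul_sum]
    refine Finset.sum_congr rfl fun i _ => ?_
    rw [HahnSeries.coeff_single_same, ← Int.cast_smul_eq_zsmul ℂ, smul_smul, mul_left_comm,
      ← zpow_add₀ (by norm_num : (-1 : ℂ) ≠ 0), ← add_assoc q n k]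
    rfl
  · rintro ⟨i, k'⟩ hik
    simp only [Finset.coe_product, Finset.coe_range, Finset.coe_singleton, Set.mem_prod,
      Set.mem_Iio, Set.mem_singleton_iff]
    by_contra hne
    refine hik ?_
    beta_reduce
    rw [not_and_or, not_lt] at hne
    rcases hne with h | h
    · rw [hN' i h, map_zero, smul_zero]
    · rw [HahnSeries.coeff_single_of_ne h, mul_zero, zero_mul, zero_smul]

variable {Y u v w n p q} {vac : V}

/-- Only finitely many u⁽ⁱ⁾ occur, so for large p all their modes kill w and the exchanged terms
drop out, whatever the series fᵢ are. -/
theorem IsWeakQuantumVertexAlgebra.isProduct (h : IsWeakQuantumVertexAlgebra Y vac) (u v : V) :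
    IsProduct (fldMap Y u) (fldMap Y v) fun n => fldMap Y ((fldMap Y u).1 n v) := by
  refine ⟨?_, fun w => ?_⟩
  · obtain ⟨N, hN⟩ := (fldMap Y u).2 v
    exact ⟨N, fun n hn => by beta_reduce; rw [hN n hn, map_zero]⟩
  · obtain ⟨r, v', u', f, hj⟩ := h.jacobi u v
    choose N hN using fun i => (fldMap Y (u' i)).2 w
    refine ⟨∑ i, |N i|, fun n p q hp => ?_⟩
    rw [← jacobiLeft_eq_prodA, ← jacobiIterate_eq_prodC, ← hj w n p q, Finset.sum_eq_zero, sub_zero]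
    intro i _
    have h3 : |N i| ≤ ∑ i, |N i| :=
      Finset.single_le_sum (f := fun i => |N i|) (fun _ _ => abs_nonneg _) (Finset.mem_univ i)
    have h4 := le_abs_self (N i)
    unfold jacobiRight
    refine finsum_eq_zero_of_forall_eq_zero fun ik => ?_
    have : ncoeff (Y (u' i)) (p + ik.1) w = 0 := hN i _ (by lia)
    rw [this, map_zero, smul_zero]

end VertexOperators

namespace StateMap

variable {E : Type*} [LieRing E] [LieAlgebra ℂ E] {K : LieIdeal ℂ E} {g : LieSubalgebra ℂ E}
  {V : Type*} [AddCommGroup V] [Module ℂ V] {C : CurrentFields K g V} (S : StateMap C)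

/-- The vertex operators of vectors. -/
def vertexOperator : V →ₗ[ℂ] VertexOperator ℂ V := fldEquiv.toLinearMap ∘ₗ S.fld

theorem fldMap_vertexOperator : fldMap S.vertexOperator = S.fld :=
  LinearMap.ext fun v => fldEquiv.symm_apply_apply (S.fld v)

theorem ncoeff_vertexOperator (v : V) (n : ℤ) :
    ncoeff (S.vertexOperator v) n = (S.fld v).1 n := ncoeff_fldEquiv _ n

theorem isWeakQuantumVertexAlgebra : IsWeakQuantumVertexAlgebra S.vertexOperator S.vac where
  vacuum n := by rw [ncoeff_vertexOperator, S.fld_vac]; rfl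
  creation_regular v n hn := by rw [ncoeff_vertexOperator]; exact (S.creation v).1 n hn
  creation v := by rw [ncoeff_vertexOperator]; exact (S.creation v).2
  jacobi u v := by
    -- A finite combination representing the defect provides the vectors, and each fᵢ is a single
    -- Laurent monomial.
    obtain ⟨r, c, T, hT⟩ := Submodule.mem_span_set'.1 (S.assocDefect_mem u v)
    choose v' u' k h using fun i => (T i).2
    refine ⟨r, v', u', fun i => HahnSeries.single (k i) (c i * (-1) ^ k i), fun w n p q => ?_⟩
    have := congrFun (congrFun (congrFun (congrFun hT w) n) p) q
    simp only [Finset.sum_apply, Pi.smul_apply, h] at this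
    simp only [jacobiRight_single, fldMap_vertexOperator, this]
    rw [jacobiLeft_eq_prodA, jacobiIterate_eq_prodC, fldMap_vertexOperator]
    exact sub_sub_cancel _ _

theorem fld_kfld_vac (u : K) : S.fld ((C.kfld u).1 (-1) S.vac) = C.kfld u := by
  rw [IsIdealVector.vac.fld_mode, S.fld_vac, res_neg_one_right]

theorem fld_gfld_vac (a : g) : S.fld ((C.gfld a).1 (-1) S.vac) = C.gfld a := by
  have h := res_neg_one_right (φ := C.gfld a)
  have h0 : rmul (-1) 0 (C.gfld a) one = 0 := by
    ext q w
    rw [rmul_apply]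
    unfold prodB prodA
    rw [expand_eq_sum 0 (fun i _ => by rw [C.gfld_nonneg a _ _ (by lia), map_zero])]
    simp
  rw [res_eq, h0, sub_zero] at h
  rw [S.fld_gfld a 1 _ one_pos, S.fld_vac, h]

theorem existsUnique : ∃! Y : V →ₗ[ℂ] VertexOperator ℂ V, IsWeakQuantumVertexAlgebra Y S.vac ∧
    (∀ u n, ncoeff (Y ((C.kfld u).1 (-1) S.vac)) n = (C.kfld u).1 n) ∧
    ∀ a n, ncoeff (Y ((C.gfld a).1 (-1) S.vac)) n = (C.gfld a).1 n := by
  refine ⟨S.vertexOperator, ⟨S.isWeakQuantumVertexAlgebra, fun u n => ?_, fun a n => ?_⟩, ?_⟩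
  · rw [ncoeff_vertexOperator, S.fld_kfld_vac]
  · rw [ncoeff_vertexOperator, S.fld_gfld_vac]
  · rintro Y ⟨hY, hk, hg⟩
    have hk' : ∀ u, fldMap Y ((C.kfld u).1 (-1) S.vac) = C.kfld u := fun u => by
      ext n w; rw [fldMap_mode, hk]
    have hg' : ∀ a, fldMap Y ((C.gfld a).1 (-1) S.vac) = C.gfld a := fun a => by
      ext n w; rw [fldMap_mode, hg]
    -- Both maps satisfy weak associativity with the same generating fields, so by uniqueness of
    -- products the set where they agree is stable under all currents.
    have key : LinearMap.eqLocus (fldMap Y) S.fld = ⊤ := by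
      refine S.eq_top _ ?_ (fun u n v hv => ?_) fun a n _ v hv => ?_
      · rw [LinearMap.mem_eqLocus, S.fld_vac]
        ext n w
        rw [fldMap_mode, hY.vacuum]; rfl
      · rw [LinearMap.mem_eqLocus] at hv ⊢
        have h := hY.isProduct ((C.kfld u).1 (-1) S.vac) v
        rw [hk', hv] at h
        exact congrFun (h.eq (S.isProduct u v)) n
      · rw [LinearMap.mem_eqLocus] at hv ⊢
        have h := hY.isProduct ((C.gfld a).1 (-1) S.vac) v
        have h' := S.isWeakQuantumVertexAlgebra.isProduct ((C.gfld a).1 (-1) S.vac) v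
        rw [hg', hv] at h
        rw [fldMap_vertexOperator, S.fld_gfld_vac] at h'
        exact congrFun (h.eq h') n
    refine LinearMap.ext fun v => ?_
    have hv : v ∈ LinearMap.eqLocus (fldMap Y) S.fld := by rw [key]; exact Submodule.mem_top
    rw [← fldEquiv_fldMap Y, LinearMap.mem_eqLocus.1 hv]
    rfl

end StateMap

/-! ### The vacuum module -/

section VacuumModule

attribute [local instance 100] LieRing.ofAssociativeRing

variable {E : Type*} [LieRing E] [LieAlgebra ℂ E] {Φ : LinearMap.BilinForm ℂ E}
  (hΦ : Φ.lieInvariant E) (hs : Φ.IsSymm) (K : LieIdeal ℂ E) (g : LieSubalgebra ℂ E) (ℓ : ℂ)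

/-- The vacuum module with its universal property. -/
def vacuumRep : VacuumRep hΦ hs K g ℓ (VacuumModule hΦ hs K g ℓ) where
  act :=
    { toFun := InducedModule.act (polyPartL hΦ hs K g) (levelRep hΦ hs K g ℓ)
      map_add' := fun x y => LinearMap.ext (InducedModule.act_add x y)
      map_smul' := fun c x => LinearMap.ext (InducedModule.act_smul c x) }
  act_lie := InducedModule.act_lie
  vac := vacuumVector hΦ hs K g ℓ
  act_vac x hx hx' := by
    refine (InducedModule.act_mk (H := polyPartL hΦ hs K g) (ρ := levelRep hΦ hs K g ℓ)
      ⟨⟨x, hx⟩, hx'⟩ 1).trans ?_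
    exact Eq.symm (congrArg Submodule.Quotient.mk (TensorProduct.tmul_smul
      (ℓ * cenCoeff hΦ hs x) (1 : UniversalEnvelopingAlgebra ℂ (curlyL hΦ hs K g)) (1 : ℂ)).symm)
  eq_top p hvac hact := by
    refine InducedModule.eq_top_of_act_mem p (fun c => ?_) hact
    have : InducedModule.mk (polyPartL hΦ hs K g) (levelRep hΦ hs K g ℓ) c =
        c • vacuumVector hΦ hs K g ℓ := by
      unfold vacuumVector InducedModule.mk
      rw [← Submodule.Quotient.mk_smul, ← TensorProduct.tmul_smul, smul_eq_mul, mul_one]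
    rw [this]
    exact p.smul_mem c hvac
  exists_lift {N} _ _ σ z hσ hz := by
    have hf : ∀ (h : polyPartL hΦ hs K g) (c : ℂ),
        σ h (LinearMap.toSpanSingleton ℂ N z c) =
          LinearMap.toSpanSingleton ℂ N z (levelRep hΦ hs K g ℓ h c) := fun h c => by
      have e : σ h z = (ℓ * cenCoeff hΦ hs h) • z := hz _ _ h.2
      rw [LinearMap.toSpanSingleton_apply, map_smul, e, smul_smul, mul_comm]
      rfl
    let σ' : curlyL hΦ hs K g →ₗ⁅ℂ⁆ Module.End ℂ N :=
      { σ with map_lie' := fun {x y} => LinearMap.ext (hσ x y) }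
    refine ⟨InducedModule.lift σ' hf, ?_, InducedModule.lift_act σ' hf⟩
    exact (InducedModule.lift_mk σ' hf 1).trans (one_smul ℂ z)

end VacuumModule

/-- The fields of the vectors of the vacuum module. -/
def VacuumRep.stateMap {E : Type*} [LieRing E] [LieAlgebra ℂ E] {Φ : LinearMap.BilinForm ℂ E}
    {hΦ : Φ.lieInvariant E} {hs : Φ.IsSymm} {K : LieIdeal ℂ E} {g : LieSubalgebra ℂ E} {ℓ : ℂ}
    {V : Type*} [AddCommGroup V] [Module ℂ V] (R : VacuumRep hΦ hs K g ℓ V)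
    (hKg : IsCompl K.toSubmodule g.toSubmodule) (hg : ∀ a ∈ g, ∀ x, Φ a x = 0) :
    StateMap (R.currents hg) where
  vac := R.vac
  fld := R.stateField hKg hg
  eq_top p hvac hK hN := R.eq_top_of_mem p hvac hK fun a n hn v hv => by
    rw [← R.gcur_of_neg a hn]; exact hN a n hn v hv
  kfld_vac u n hn := R.opK_vac u n hn
  fld_vac := R.stateField_vac hKg hg
  isProduct := R.isProduct_stateField hKg hg
  fld_gfld a m v hm := Eq.trans
    (congrArg (fun f : Module.End ℂ V => R.stateField hKg hg (f v)) (R.gcur_of_neg a (by lia)))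
    (R.stateField_opNeg hKg hg a hm v)

theorem VacuumRep.existsUnique {E : Type*} [LieRing E] [LieAlgebra ℂ E]
    {Φ : LinearMap.BilinForm ℂ E} {hΦ : Φ.lieInvariant E} {hs : Φ.IsSymm} {K : LieIdeal ℂ E}
    {g : LieSubalgebra ℂ E} {ℓ : ℂ} {V : Type*} [AddCommGroup V] [Module ℂ V]
    (R : VacuumRep hΦ hs K g ℓ V) (hKg : IsCompl K.toSubmodule g.toSubmodule)
    (hg : ∀ a ∈ g, ∀ x, Φ a x = 0) :
    ∃! Y : V →ₗ[ℂ] VertexOperator ℂ V, IsWeakQuantumVertexAlgebra Y R.vac ∧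
      (∀ (u : K) (n : ℤ), ncoeff (Y (R.opK u (-1) R.vac)) n = R.opK u n) ∧
      ∀ a : g, (∀ (n : ℕ) (hn : 1 ≤ n), ncoeff (Y (R.opNeg a (-(1 : ℕ)) (by lia) R.vac)) (-n) =
        R.opNeg a (-n) (by lia)) ∧
      ∀ n : ℤ, 0 ≤ n → ncoeff (Y (R.opNeg a (-(1 : ℕ)) (by lia) R.vac)) n = 0 := by
  refine (existsUnique_congr fun Y => and_congr_right fun _ => and_congr_right fun _ =>
    forall_congr' fun a => ?_).1 (R.stateMap hKg hg).existsUnique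
  -- Extending a(x)⁺ by zero in nonnegative modes merges the two conditions on Y(a,x) into a single
  -- equality of fields.
  have h1 : (R.gcur a).1 (-1) = R.opNeg a (-(1 : ℕ)) (by lia) := R.gcur_of_neg a _
  change (∀ n, ncoeff (Y ((R.gcur a).1 (-1) R.vac)) n = (R.gcur a).1 n) ↔ _
  rw [h1]
  have hz : ∀ n : ℤ, 0 ≤ n → (R.gcur a).1 n = 0 := fun n hn => dif_neg (not_lt.2 hn)
  constructor
  · exact fun h => ⟨fun n hn => (h _).trans (R.gcur_of_neg a _),
      fun n hn => (h n).trans (hz n hn)⟩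
  · rintro ⟨h, h'⟩ n
    rcases lt_or_ge n 0 with hn | hn
    · obtain ⟨k, rfl⟩ : ∃ k : ℕ, n = -k := ⟨(-n).toNat, by lia⟩
      exact (h k (by lia)).trans (R.gcur_of_neg a hn).symm
    · exact (h' n hn).trans (hz n hn).symm

theorem extendForm_apply_of_mem {E : Type*} [LieRing E] [LieAlgebra ℂ E] {K : LieIdeal ℂ E}
    {g : LieSubalgebra ℂ E} (hKg : IsCompl K.toSubmodule g.toSubmodule)
    (B : LinearMap.BilinForm ℂ K) {a : E} (ha : a ∈ g) (x : E) : extendForm hKg B a x = 0 := by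
  have h : K.toSubmodule.projectionOnto g.toSubmodule hKg a = 0 :=
    Submodule.projectionOnto_apply_right hKg ⟨a, ha⟩
  change B (K.toSubmodule.projectionOnto g.toSubmodule hKg a) _ = 0
  rw [h, map_zero, LinearMap.zero_apply]

end SemidirectVertex
end

theorem proposition6p8 {E : Type*} [LieRing E] [LieAlgebra ℂ E]
    -- `E = K ⊕ g` with `K` an ideal and `g` a subalgebra
    (K : LieIdeal ℂ E) (g : LieSubalgebra ℂ E) (hKg : IsCompl K.toSubmodule g.toSubmodule)
    -- a symmetric invariant bilinear form on `K` for which `g` acts by skew operators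
    (B : LinearMap.BilinForm ℂ K) (hB : B.IsSymm)
    (_hinv : ∀ u v w : K, B ⁅u, v⁆ w = B u ⁅v, w⁆)
    (_hskew : ∀ (a : g) (u v : K), B ⁅(a : E), u⁆ v = -B u ⁅(a : E), v⁆)
    -- the extension `⟨u + a, v + b⟩ = ⟨u, v⟩` of the form to `E` is invariant, so that the affine
    -- Lie algebra of `E` is a Lie algebra
    (hE : (extendForm hKg B).lieInvariant E)
    (ℓ : ℂ) :
    ∃! Y : VacuumModule hE (extendForm_isSymm hKg hB) K g ℓ →ₗ[ℂ]
        VertexOperator ℂ (VacuumModule hE (extendForm_isSymm hKg hB) K g ℓ),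
      IsWeakQuantumVertexAlgebra Y (vacuumVector hE (extendForm_isSymm hKg hB) K g ℓ) ∧
      -- `Y(u, x) = ∑ₙ u(n) x^(-n-1)` for `u ∈ K`, identified with `u(-1) 1`
      (∀ (u : K) (n : ℤ),
        VertexOperator.ncoeff
          (Y (opK hE (extendForm_isSymm hKg hB) K g ℓ u (-1)
            (vacuumVector hE (extendForm_isSymm hKg hB) K g ℓ))) n =
        opK hE (extendForm_isSymm hKg hB) K g ℓ u n) ∧
      -- `Y(a, x) = ∑_{n ≥ 1} a(-n) x^(n-1)` for `a ∈ g`, identified with `a(-1) 1`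
      (∀ a : g,
        (∀ (n : ℕ) (hn : 1 ≤ n),
          VertexOperator.ncoeff
            (Y (opG hE (extendForm_isSymm hKg hB) K g ℓ a 1 le_rfl
              (vacuumVector hE (extendForm_isSymm hKg hB) K g ℓ))) (-n) =
          opG hE (extendForm_isSymm hKg hB) K g ℓ a n hn) ∧
        (∀ n : ℤ, 0 ≤ n →
          VertexOperator.ncoeff
            (Y (opG hE (extendForm_isSymm hKg hB) K g ℓ a 1 le_rfl
              (vacuumVector hE (extendForm_isSymm hKg hB) K g ℓ))) n = 0)) :=
  (vacuumRep hE (extendForm_isSymm hKg hB) K g ℓ).existsUnique hKg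
    fun _ ha x => extendForm_apply_of_mem hKg B ha x
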